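/- Let $N,n\ge 0$ be integers, let $U(N)$ be the group of $N\times N$ unitary matrices with normalized Haar measure $dX$, and write $e^{i\theta_1},\dots,e^{i\theta_N}$, $\theta_j\in[0,2\pi)$, for the eigenvalues of $X\in U(N)$ with multiplicity. Put $z(x)=1/(1-e^{-x})$. For finite families $A,B$ of complex numbers put $Z(A,B)=\prod_{\alpha\in A,\,\beta\in B}z(\alpha+\beta)$, let $Z^\dagger(A,B)$ be the same product with every factor whose argument is $0$ omitted, let $S^-=\{-s:s\in S\}$, and define $$J^*(A;B)=\sum_{\substack{S\subset A,\ T\subset B\\ |S|=|T|}}e^{-N\left(\sum_{\hat\alpha\in S}\hat\alpha+\sum_{\hat\beta\in T}\hat\beta\right)}\frac{Z(S,T)\,Z(S^-,T^-)}{Z^\dagger(S,S^-)\,Z^\dagger(T,T^-)}\sum_{\substack{(A-S)+(B-T)=U_1+\dots+U_R\\ |U_r|\le 2}}\ \prod_{r=1}^R H_{S,T}(U_r),$$ where the inner sum is over all partitions of the disjoint union of $A-S$ and $B-T$ into nonempty sets with at most two elements, and, for $\alpha\in A-S$ and $\beta\in B-T$, $$H_{S,T}(\{\alpha\})=\sum_{\hat\alpha\in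 S}\frac{z'}{z}(\alpha-\hat\alpha)-\sum_{\hat\beta\in T}\frac{z'}{z}(\alpha+\hat\beta),\qquad H_{S,T}(\{\beta\})=\sum_{\hat\beta\in T}\frac{z'}{z}(\beta-\hat\beta)-\sum_{\hat\alpha\in S}\frac{z'}{z}(\beta+\hat\alpha),$$ $$H_{S,T}(\{\alpha,\beta\})=\Big(\frac{z'}{z}\Big)'(\alpha+\beta),\qquad H_{S,T}(W)=0\ \text{ for all other } W.$$ For $\theta=(\theta_1,\dots,\theta_n)\in\mathbb C^n$ with $\theta_j-\theta_k\notin 2\pi\mathbb Z$ for all $j\ne k$ let $$\Sigma(\theta)=\sum_{K+L+M=\{1,\dots,n\}}N^{|M|}\,J^*(-i\theta_K;\,i\theta_L),$$ the sum being over all ordered triples of disjoint sets $K,L,M$ with union $\{1,\dots,n\}$, where $-i\theta_K=\{-i\theta_k:k\in K\}$ and $i\theta_L=\{i\theta_\ell:\ell\in L\}$. (1) $\Sigma$ extends to an entire function on $\mathbb C^n$; in particular the integrand below has no poles on the path of integration. (2) Let $\delta>0$ and let $f$ be a function that is holomorphic on $\{w\in\mathbb C^n:|\operatorname{Im}w_j|<\delta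 \text{ for all } j\}$ and there $2\pi$-periodic in each variable (for instance, the restriction of an entire $2\pi$-periodic function). Then both integrands below are integrable, and $$\int_{U(N)}\ \sum_{\substack{1\le j_1,\dots,j_n\le N\\ j_1,\dots,j_n\text{ distinct}}}f(\theta_{j_1},\dots,\theta_{j_n})\,dX=\frac1{(2\pi)^n}\int_{[0,2\pi]^n}\Sigma(\theta)\,f(\theta_1,\dots,\theta_n)\,d\theta_1\cdots d\theta_n .$$ -/

import Mathlib

open MeasureTheory

namespace UnitaryCorrelation

noncomputable section

/-! ### The function `z` and the products `Z` and `Z†` -/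

/-- `z(x) = 1 / (1 - e^{-x})`. -/
def z (x : ℂ) : ℂ := 1 / (1 - Complex.exp (-x))

/-- `(z'/z)(x)`. -/
def zLog (x : ℂ) : ℂ := logDeriv z x

/-- `(z'/z)'(x)`. -/
def zLog' (x : ℂ) : ℂ := deriv zLog x

/-- `Z(X, Y) = ∏_{x ∈ X, y ∈ Y} z(x + y)`, where the finite families `X`, `Y` of complex numbers are
given as `X = {u i : i ∈ S}` and `Y = {v k : k ∈ T}`. -/
def Zprod {ι κ : Type*} (S : Finset ι) (u : ι → ℂ) (T : Finset κ) (v : κ → ℂ) : ℂ :=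
  ∏ i ∈ S, ∏ k ∈ T, z (u i + v k)

/-- `Z†(X, Y)`: the same product, in which a factor `z(x)` is omitted if its argument is zero. -/
def Zdagger {ι κ : Type*} (S : Finset ι) (u : ι → ℂ) (T : Finset κ) (v : κ → ℂ) : ℂ :=
  ∏ i ∈ S, ∏ k ∈ T, if u i + v k = 0 then 1 else z (u i + v k)

/-! ### The expression `J*(A; B)` -/

section JStar

variable {ι κ : Type*} [Fintype ι] [DecidableEq ι] [Fintype κ] [DecidableEq κ]

/-- `H_{S,T}(W)`. The set `W` is a set of labels in the disjoint union `ι ⊕ κ`: the label `inl a`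
stands for the variable `α a` and the label `inr b` for the variable `β b`. -/
def HST (α : ι → ℂ) (β : κ → ℂ) (S : Finset ι) (T : Finset κ) (W : Finset (ι ⊕ κ)) : ℂ :=
  if W.toLeft.card = 1 ∧ W.toRight.card = 0 then
    ∑ a ∈ W.toLeft, (∑ s ∈ S, zLog (α a - α s) - ∑ t ∈ T, zLog (α a + β t))
  else if W.toLeft.card = 0 ∧ W.toRight.card = 1 then
    ∑ b ∈ W.toRight, (∑ t ∈ T, zLog (β b - β t) - ∑ s ∈ S, zLog (β b + α s))
  else if W.toLeft.card = 1 ∧ W.toRight.card = 1 then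
    ∑ a ∈ W.toLeft, ∑ b ∈ W.toRight, zLog' (α a + β b)
  else 0

/-- The factor
`e^{-N (∑_{α̂ ∈ S} α̂ + ∑_{β̂ ∈ T} β̂)} Z(S,T) Z(S⁻,T⁻) / (Z†(S,S⁻) Z†(T,T⁻))`. -/
def QST (N : ℕ) (α : ι → ℂ) (β : κ → ℂ) (S : Finset ι) (T : Finset κ) : ℂ :=
  Complex.exp (-(N : ℂ) * (∑ s ∈ S, α s + ∑ t ∈ T, β t)) *
    (Zprod S α T β * Zprod S (-α) T (-β) / (Zdagger S α S (-α) * Zdagger T β T (-β)))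

/-- `J*(A; B)` for the families `A = {α k : k ∈ K}` and `B = {β l : l ∈ L}`: the sum over `S ⊆ A` and
`T ⊆ B` with `|S| = |T|` of `QST` times the sum, over all set partitions of `(A - S) + (B - T)` into
parts of size at most two, of the product of `H_{S,T}` over the parts. -/
def JStar (N : ℕ) (α : ι → ℂ) (β : κ → ℂ) (K : Finset ι) (L : Finset κ) : ℂ :=
  ∑ S ∈ K.powerset, ∑ T ∈ L.powerset.filter (fun T => S.card = T.card),
    QST N α β S T *
      ∑ P : Finpartition ((K \ S).disjSum (L \ T)) with ∀ U ∈ P.parts, U.card ≤ 2,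
        ∏ U ∈ P.parts, HST α β S T U

end JStar

/-- `∑_{K + L + M = {1, …, n}} N^{|M|} J*(-iθ_K; iθ_L)`: here `L` runs over the subsets of the
complement of `K`, and `M` is the complement of `K ∪ L`. -/
def correlationSum (N n : ℕ) (θ : Fin n → ℂ) : ℂ :=
  ∑ K : Finset (Fin n), ∑ L ∈ Kᶜ.powerset,
    (N : ℂ) ^ ((K ∪ L)ᶜ).card *
      JStar N (fun k => -(Complex.I * θ k)) (fun l => Complex.I * θ l) K L

/-! ### Eigenangles of unitary matrices -/

/-- `θ` lists the eigenangles, in `[0, 2π)` and with multiplicity, of the unitary matrix `X`: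
`det (x - X) = ∏_j (x - e^{iθ_j})`. -/
def IsEigenangles {N : ℕ} (X : Matrix.unitaryGroup (Fin N) ℂ) (θ : Fin N → ℝ) : Prop :=
  (∀ j, θ j ∈ Set.Ico 0 (2 * Real.pi)) ∧
    (X : Matrix (Fin N) (Fin N) ℂ).charpoly =
      ∏ j, (Polynomial.X - Polynomial.C (Complex.exp (Complex.I * θ j)))

open scoped Matrix.Norms.L2Operator in
theorem exists_isEigenangles {N : ℕ} (X : Matrix.unitaryGroup (Fin N) ℂ) :
    ∃ θ : Fin N → ℝ, IsEigenangles X θ := by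
  set A : Matrix (Fin N) (Fin N) ℂ := X.1 with hA
  have hsplit := IsAlgClosed.splits A.charpoly
  have hcard : A.charpoly.roots.card = N := by
    rw [← hsplit.natDegree_eq_card_roots, Matrix.charpoly_natDegree_eq_dim, Fintype.card_fin]
  have hprod := hsplit.eq_prod_roots_of_monic A.charpoly_monic
  obtain ⟨l, hl⟩ : ∃ l : List ℂ, (l : Multiset ℂ) = A.charpoly.roots := Quot.exists_rep _
  have hlen : l.length = N := by rw [← hcard, ← hl]; rfl
  subst hlen
  have hroot : ∀ j : Fin l.length, ∃ t : ℝ, t ∈ Set.Ico 0 (2 * Real.pi) ∧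
      Complex.exp (Complex.I * t) = l.get j := by
    intro j
    have hm : l.get j ∈ A.charpoly.roots := by
      rw [← hl]; exact Multiset.mem_coe.2 (List.get_mem l j)
    have hs : l.get j ∈ spectrum ℂ A := by
      rw [Matrix.mem_spectrum_iff_isRoot_charpoly]
      exact (Polynomial.mem_roots'.1 hm).2
    have hnorm : ‖l.get j‖ = 1 := by
      have h0 := spectrum.subset_circle_of_unitary (𝕜 := ℂ) X.2 hs
      simpa using h0
    refine ⟨toIcoMod Real.two_pi_pos 0 (Complex.arg (l.get j)), ?_, ?_⟩
    · simpa using toIcoMod_mem_Ico Real.two_pi_pos 0 (Complex.arg (l.get j))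
    · have h1 := Complex.norm_mul_exp_arg_mul_I (l.get j)
      rw [hnorm] at h1
      refine Eq.trans ?_ h1
      rw [toIcoMod]
      simp only [Complex.ofReal_one, one_mul]
      rw [Complex.exp_eq_exp_iff_exists_int]
      refine ⟨-toIcoDiv Real.two_pi_pos 0 (Complex.arg (l.get j)), ?_⟩
      push_cast
      simp
      ring
  choose θ hθ hexp using hroot
  refine ⟨θ, hθ, ?_⟩
  simp_rw [hexp]
  rw [hprod, ← hl]
  simpa using (Fin.prod_univ_fun_getElem l (fun x : ℂ => Polynomial.X - Polynomial.C x)).symm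

/-- The eigenangles `θ_1, …, θ_N` of `X`, in some order. -/
def eigenangle {N : ℕ} (X : Matrix.unitaryGroup (Fin N) ℂ) : Fin N → ℝ :=
  (exists_isEigenangles X).choose

/-- `∑* f(θ_{j_1}, …, θ_{j_n})`: the sum over all `n`-tuples of distinct indices
`j_1, …, j_n` in `{1, …, N}`. -/
def distinctSum {N n : ℕ} (f : (Fin n → ℂ) → ℂ) (X : Matrix.unitaryGroup (Fin N) ℂ) : ℂ :=
  ∑ j : Fin n ↪ Fin N, f (fun m => (eigenangle X (j m) : ℂ))

/-! ### Test functions -/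

/-- The set `{w ∈ ℂⁿ : |Im w_j| < δ for all j}`. -/
def strip (n : ℕ) (δ : ℝ) : Set (Fin n → ℂ) := {w | ∀ j, |(w j).im| < δ}

end

end UnitaryCorrelation

/-! Both sides are compared with the determinant of the Dyson kernel `∑_{a < N} e^{i a (θ_k - θ_j)}`
(`dysonMatrix`). It is a trigonometric polynomial, hence entire.

Algebraic half: away from the hyperplanes the combinatorial sum equals this determinant. With `x_j =
e^{iθ_j}` and `y_j = x_j ^ N`, geometric summation turns the transposed kernel into the matrix with
entries `x_k (1 - y_j / y_k) / (x_k - x_j)` and diagonal `N` (`difMatrix`). Each entry is a sum of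
two Cauchy-type terms, and expanding along rows and columns gives every point a row label and a
column label; the points whose two labels differ form `S` and `T`
(`det_difMatrix_eq_sum_labelledSum`). For fixed `S` and `T` the other points are removed one at a
time: partial fractions make the Ward identity `det_ward` applicable, which yields the recursion
`labelledSum_insert`. The sum over `K - S`, `L - T`, `M` and over partitions into singletons and
pairs satisfies the same recursion (`splitSum_insert`), so the two are proportional
(`eq_mul_of_recursion`). The constant is the determinant with no further points. It is a product of
two Cauchy determinants, which is the quotient of `Z`-products (`det_labelled_base`, `QST_eq`), and
it vanishes unless `|S| = |T|`.

Integral half: a Weyl integration formula for the algebra generated by the power sums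
(`integral_evalUnitary`), obtained without a Jacobian. Invariance of Haar measure gives the
Schwinger–Dyson equations, so all loop expressions have integral zero
(`integral_loopExpr_powTrace`). The same expressions are produced by the radial Laplacian acting on
the Vandermonde determinant times a product of power sums (`radialOp_vdm_mul_prod`). That operator
is diagonal on monomials, and an alternating polynomial in its kernel is a multiple of the
Vandermonde determinant. Hence every element of the algebra is a constant plus loop expressions
(`sub_coeff_mem_loopSpan`), and the constant, a coefficient, is its integral.

For a character `f` the sum over distinct eigenangles lies in this algebra. Its coefficient and the
Fourier integral against the Dyson determinant are the same sum of 0/1 determinants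
(`coeff_vdm_mul_distinctMono`, `integral_det_dysonMatrix_mul_exp`). Density of trigonometric
polynomials extends the identity to continuous functions on the torus (`integral_torusSum`);
coincident angles form a null set, so the determinant may be replaced by the combinatorial sum under
the integral. -/

namespace UnitaryCorrelation

noncomputable section

/-! ### Bordered determinants and a Ward identity. -/

section Bordered

variable {ι R : Type*} [Fintype ι] [DecidableEq ι] [CommRing R]

/-- The matrix `M` with row `r` and column `r` replaced by those of the identity. -/
def isolate (M : Matrix ι ι R) (r : ι) : Matrix ι ι R :=
  Matrix.of fun i j => if i = r ∨ j = r then (if i = j then 1 else 0) else M i j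

/-- Only permutations fixing `r` contribute, and these never meet column `r` outside row `r`. -/
theorem det_congr_of_row_eq_single {A B : Matrix ι ι R} {r : ι}
    (hA : A r = Pi.single r 1) (hB : B r = Pi.single r 1)
    (h : ∀ i j, j ≠ r → A i j = B i j) : A.det = B.det := by
  rw [Matrix.det_apply, Matrix.det_apply]
  refine Finset.sum_congr rfl fun σ _ => ?_
  congr 1
  by_cases hσ : σ r = r
  · refine Finset.prod_congr rfl fun i _ => ?_
    by_cases hi : i = r
    · subst hi; rw [hσ, hA, hB]
    · exact h _ _ hi
  · have hne : σ.symm r ≠ r := fun h' => hσ ((σ.symm_apply_eq.1 h').symm)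
    rw [Finset.prod_eq_zero (Finset.mem_univ (σ.symm r)),
      Finset.prod_eq_zero (Finset.mem_univ (σ.symm r))]
    · rw [σ.apply_symm_apply, hB, Pi.single_eq_of_ne hne]
    · rw [σ.apply_symm_apply, hA, Pi.single_eq_of_ne hne]

theorem adjugate_diag_eq_det_isolate (M : Matrix ι ι R) (r : ι) :
    M.adjugate r r = (isolate M r).det := by
  rw [Matrix.adjugate_apply]
  refine det_congr_of_row_eq_single (r := r) (by simp) ?_ ?_
  · ext j; simp [isolate, Pi.single_apply, eq_comm]
  · intro i j hj
    by_cases hi : i = r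
    · subst hi; simp [isolate, hj, hj.symm]
    · simp [isolate, hi, hj]

/-- Expansion along column `r`. The resulting cofactors are those of `isolate M r` with rows `r` and
`j` exchanged, and the transposition accounts for the sign. -/
theorem adjugate_eq_neg_sum_isolate (M : Matrix ι ι R) {r k : ι} (hk : k ≠ r) :
    M.adjugate k r = -∑ j ∈ Finset.univ.erase r, M j r * (isolate M r).adjugate k j := by
  rw [Matrix.adjugate_apply, Matrix.det_eq_sum_mul_adjugate_col _ r,
    ← Finset.add_sum_erase _ _ (Finset.mem_univ r)]
  simp only [Matrix.updateRow_self, Pi.single_apply, hk.symm, if_false, zero_mul, zero_add]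
  rw [← Finset.sum_neg_distrib]
  refine Finset.sum_congr rfl fun j hj => ?_
  have hj' : j ≠ r := (Finset.mem_erase.1 hj).1
  rw [Matrix.updateRow_ne hj', ← mul_neg]
  congr 1
  rw [Matrix.adjugate_apply, Matrix.adjugate_apply]
  have := Matrix.det_permute (Equiv.swap j r)
    (((M.updateRow r (Pi.single k 1)).updateRow j (Pi.single r 1)))
  rw [Equiv.Perm.sign_swap hj'] at this
  simp only [Units.val_neg, Units.val_one, Int.cast_neg, Int.cast_one, neg_mul, one_mul] at this
  rw [← neg_eq_iff_eq_neg, ← this]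
  refine det_congr_of_row_eq_single (r := r) ?_ ?_ ?_
  · ext l; simp [Matrix.submatrix]
  · ext l; simp [Matrix.updateRow_ne hj'.symm, isolate, Pi.single_apply, eq_comm]
  · intro i l hl
    by_cases hi : i = r
    · subst hi
      simp [Matrix.submatrix, Matrix.updateRow_ne hj'.symm, isolate, hl, hl.symm]
    · by_cases hij : i = j
      · subst hij; simp [Matrix.submatrix, Matrix.updateRow_ne hj'.symm]
      · simp [Matrix.submatrix, Equiv.swap_apply_of_ne_of_ne hij hi, Matrix.updateRow_ne hij,
          isolate, hi, hl]

/-- The Schur complement formula for one border, written with the adjugate so that no minor has to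
be invertible. -/
theorem det_eq_bordered (M : Matrix ι ι R) (r : ι) :
    M.det = M r r * (isolate M r).det -
      ∑ k ∈ Finset.univ.erase r, ∑ j ∈ Finset.univ.erase r,
        M j r * M r k * (isolate M r).adjugate k j := by
  rw [Matrix.det_eq_sum_mul_adjugate_row M r, ← Finset.add_sum_erase _ _ (Finset.mem_univ r),
    adjugate_diag_eq_det_isolate, sub_eq_add_neg, ← Finset.sum_neg_distrib]
  congr 1
  refine Finset.sum_congr rfl fun k hk => ?_
  rw [adjugate_eq_neg_sum_isolate M (Finset.mem_erase.1 hk).1, mul_neg, Finset.mul_sum]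
  congr 1
  exact Finset.sum_congr rfl fun j _ => by ring

/-- A Ward identity: if the products `M j r * M r k` are, off the diagonal, of the form
`M j k * (u j - v k)`, the row and the column `r` can be removed from the determinant. -/
theorem det_ward (M : Matrix ι ι R) (r : ι) (u v : ι → R)
    (h : ∀ j k, j ≠ r → k ≠ r → j ≠ k → M j r * M r k = M j k * (u j - v k)) :
    M.det = (M r r - ∑ j ∈ Finset.univ.erase r, (u j - v j)) * (isolate M r).det -
      ∑ k ∈ Finset.univ.erase r,
        (M k r * M r k - M k k * (u k - v k)) * (isolate (isolate M r) k).det := by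
  -- The hypothesis says nothing for `j = k`. The defect there is split off; its cofactor is the
  -- determinant with both `r` and `k` removed.
  have key : ∀ k ∈ Finset.univ.erase r, ∀ j ∈ Finset.univ.erase r,
      M j r * M r k * (isolate M r).adjugate k j =
        (isolate M r) j k * (isolate M r).adjugate k j * u j -
        (isolate M r) j k * (isolate M r).adjugate k j * v k +
        if j = k then (M k r * M r k - M k k * (u k - v k)) * (isolate (isolate M r) k).det
          else 0 := by
    intro k hk j hj
    have hk := (Finset.mem_erase.1 hk).1
    have hj := (Finset.mem_erase.1 hj).1
    have h1 : isolate M r j k = M j k := by simp [isolate, hk, hj]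
    rw [h1]
    split_ifs with hjk
    · subst hjk
      rw [← adjugate_diag_eq_det_isolate]; ring
    · rw [h j k hj hk hjk]; ring
  -- For fixed `j` the sum over `k` is the expansion of the whole determinant along row `j`. In `hv`
  -- below, fixing `k` gives the expansion along column `k`.
  have hu : ∑ k ∈ Finset.univ.erase r, ∑ j ∈ Finset.univ.erase r,
      (isolate M r) j k * (isolate M r).adjugate k j * u j =
      (∑ j ∈ Finset.univ.erase r, u j) * (isolate M r).det := by
    rw [Finset.sum_comm, Finset.sum_mul]
    refine Finset.sum_congr rfl fun j hj => ?_
    have hj := (Finset.mem_erase.1 hj).1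
    rw [Matrix.det_eq_sum_mul_adjugate_row _ j, Finset.mul_sum,
      ← Finset.add_sum_erase _ _ (Finset.mem_univ r)]
    have : isolate M r j r = 0 := by simp [isolate, hj]
    rw [this, zero_mul, mul_zero, zero_add]
    exact Finset.sum_congr rfl fun k _ => by ring
  have hv : ∑ k ∈ Finset.univ.erase r, ∑ j ∈ Finset.univ.erase r,
      (isolate M r) j k * (isolate M r).adjugate k j * v k =
      (∑ j ∈ Finset.univ.erase r, v j) * (isolate M r).det := by
    rw [Finset.sum_mul]
    refine Finset.sum_congr rfl fun k hk => ?_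
    have hk := (Finset.mem_erase.1 hk).1
    rw [Matrix.det_eq_sum_mul_adjugate_col _ k, Finset.mul_sum,
      ← Finset.add_sum_erase _ _ (Finset.mem_univ r)]
    have : isolate M r r k = 0 := by simp [isolate, hk.symm]
    rw [this, zero_mul, mul_zero, zero_add]
    exact Finset.sum_congr rfl fun k _ => by ring
  rw [det_eq_bordered M r, Finset.sum_congr rfl fun k hk => Finset.sum_congr rfl (key k hk)]
  simp only [Finset.sum_add_distrib, Finset.sum_sub_distrib]
  rw [hu, hv]
  have hd : ∑ k ∈ Finset.univ.erase r, ∑ j ∈ Finset.univ.erase r,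
      (if j = k then (M k r * M r k - M k k * (u k - v k)) * (isolate (isolate M r) k).det
          else 0) = ∑ k ∈ Finset.univ.erase r,
        (M k r * M r k - M k k * (u k - v k)) * (isolate (isolate M r) k).det := by
    refine Finset.sum_congr rfl fun k hk => ?_
    rw [Finset.sum_ite_eq' , if_pos hk]
  rw [hd]
  ring

end Bordered

/-! ### Sums over a subset together with a point inside or outside it. -/

section PowersetSums

variable {ι E : Type*} [DecidableEq ι] [AddCommMonoid E]

theorem sum_powerset_sum_sdiff (R : Finset ι) (f : ι → Finset ι → E) :
    ∑ B ∈ R.powerset, ∑ k ∈ R \ B, f k B = ∑ k ∈ R, ∑ B ∈ (R.erase k).powerset, f k B := by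
  refine Finset.sum_comm' fun B k => ?_
  simp only [Finset.mem_powerset, Finset.mem_sdiff, Finset.subset_erase]
  tauto

theorem sum_powerset_sum_mem (R : Finset ι) (f : ι → Finset ι → E) :
    ∑ B ∈ R.powerset, ∑ k ∈ B, f k (B.erase k) =
      ∑ k ∈ R, ∑ B ∈ (R.erase k).powerset, f k B := by
  rw [Finset.sum_comm' (s := R.powerset) (t := fun B => B) (t' := R)
    (s' := fun k => R.powerset.filter (k ∈ ·)) (by
      intro B k; simp only [Finset.mem_powerset, Finset.mem_filter]
      exact ⟨fun h => ⟨⟨h.1, h.2⟩, h.1 h.2⟩, fun h => h.1⟩)]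
  refine Finset.sum_congr rfl fun k hk => ?_
  refine Finset.sum_bij' (fun B _ => B.erase k) (fun B _ => insert k B) ?_ ?_ ?_ ?_ ?_
  · intro B hB
    simp only [Finset.mem_filter, Finset.mem_powerset] at hB ⊢
    exact Finset.erase_subset_erase _ hB.1
  · intro B hB
    simp only [Finset.mem_filter, Finset.mem_powerset] at hB ⊢
    refine ⟨?_, Finset.mem_insert_self _ _⟩
    exact Finset.insert_subset hk (hB.trans (Finset.erase_subset _ _))
  · intro B hB
    simp only [Finset.mem_filter] at hB
    exact Finset.insert_erase hB.2
  · intro B hB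
    simp only [Finset.mem_powerset, Finset.subset_erase] at hB
    exact Finset.erase_insert hB.2
  · intro B _; rfl

end PowersetSums

/-! ### Labelled Cauchy-type matrices and the removal of a point. -/

section Labelled

variable {ι : Type*} [Fintype ι] [DecidableEq ι]

/-- The summand of the matrix `x_k (1 - y_j / y_k) / (x_k - x_j)` with active set `V` in which the
rows in `I` and the columns in `J` carry the second label, the others the first one. Only entries
with matching labels are kept; outside `V` the matrix is the identity. -/
def labelled (x y : ι → ℂ) (c : ℂ) (V I J : Finset ι) : Matrix ι ι ℂ :=
  Matrix.of fun j k =>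
    if j ∈ V ∧ k ∈ V then
      if j ∈ I then
        if k ∈ J then if j = k then 0 else -(y j / y k) * (x k / (x k - x j)) else 0
      else if k ∈ J then 0 else if j = k then c else x k / (x k - x j)
    else if j = k then 1 else 0

/-- The weight of a pair. -/
def pairWeight (x : ι → ℂ) (j k : ι) : ℂ := x j * x k / (x j - x k) ^ 2

/-- The interaction of a point `r` with a labelled point `j`. -/
def interaction (x : ι → ℂ) (r j : ι) : ℂ := (x r + x j) / (2 * (x r - x j))

omit [Fintype ι] in
-- Removing a point only shrinks the active set; the label sets may keep the removed point, because
-- labels of inactive points are never read.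
theorem isolate_labelled (x y : ι → ℂ) (c : ℂ) (V I J : Finset ι) (r : ι) :
    isolate (labelled x y c V I J) r = labelled x y c (V.erase r) I J := by
  ext j k
  simp only [isolate, labelled, Matrix.of_apply, Finset.mem_erase]
  split_ifs <;> simp_all

omit [Fintype ι] in
theorem labelled_congr (x y : ι → ℂ) (c : ℂ) {V I J I' J' : Finset ι}
    (hI : ∀ j ∈ V, j ∈ I ↔ j ∈ I') (hJ : ∀ j ∈ V, j ∈ J ↔ j ∈ J') :
    labelled x y c V I J = labelled x y c V I' J' := by
  ext j k
  simp only [labelled, Matrix.of_apply]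
  by_cases h : j ∈ V ∧ k ∈ V
  · simp only [h, hI j h.1, hJ k h.2]
  · simp only [h, if_false]

omit [Fintype ι] [DecidableEq ι] in
-- Partial fractions in `x r`: the product of the two kernels through `r` is the direct kernel times
-- a difference of a function of `j` and a function of `k`. This is the hypothesis of `det_ward`,
-- and it fixes `interaction` up to an additive constant.
theorem interaction_mul (x : ι → ℂ) (hx : Function.Injective x) {j k r : ι}
    (hj : j ≠ r) (hk : k ≠ r) (hjk : j ≠ k) :
    x r / (x r - x j) * (x k / (x k - x r)) =
      x k / (x k - x j) * (interaction x r j - interaction x r k) := by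
  have h1 : x r - x j ≠ 0 := sub_ne_zero.2 fun h => hj (hx h).symm
  have h2 : x k - x r ≠ 0 := sub_ne_zero.2 fun h => hk (hx h)
  have h3 : x k - x j ≠ 0 := sub_ne_zero.2 fun h => hjk (hx h).symm
  have h4 : x r - x k ≠ 0 := sub_ne_zero.2 fun h => hk (hx h).symm
  unfold interaction
  field_simp
  ring

omit [Fintype ι] [DecidableEq ι] in
theorem interaction_mul_self (x : ι → ℂ) (hx : Function.Injective x) {k r : ι} (hk : k ≠ r) :
    x r / (x r - x k) * (x k / (x k - x r)) = -pairWeight x r k := by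
  have h2 : x k - x r ≠ 0 := sub_ne_zero.2 fun h => hk (hx h)
  have h4 : x r - x k ≠ 0 := sub_ne_zero.2 fun h => hk (hx h).symm
  unfold pairWeight
  field_simp
  ring

variable (x y : ι → ℂ) (c : ℂ) (hx : Function.Injective x) (hy : ∀ j, y j ≠ 0)

include hx in
-- Here both labels of `r` are the first one, so its column meets only rows outside `S ∪ B` and its
-- row only columns outside `T ∪ B`. In the sum of `u - v` the points of `R` cancel, leaving `T`
-- with one sign and `S` with the other. A diagonal defect survives only on `R \ B`, where both
-- couplings to `r` are present.
theorem det_labelled_insert_first {S T R B : Finset ι} {r : ι} (hST : Disjoint S T)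
    (hSR : Disjoint S R) (hTR : Disjoint T R) (hrS : r ∉ S) (hrT : r ∉ T) (hrR : r ∉ R)
    (hB : B ⊆ R) :
    (labelled x y c (S ∪ T ∪ insert r R) (S ∪ B) (T ∪ B)).det =
      (c + ∑ s ∈ S, interaction x r s - ∑ t ∈ T, interaction x r t) *
        (labelled x y c (S ∪ T ∪ R) (S ∪ B) (T ∪ B)).det +
      ∑ k ∈ R \ B, pairWeight x r k *
        (labelled x y c (S ∪ T ∪ R.erase k) (S ∪ B) (T ∪ B)).det := by
  have hrB : r ∉ B := fun h => hrR (hB h)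
  rw [Finset.disjoint_left] at hST hSR hTR
  set M := labelled x y c (S ∪ T ∪ insert r R) (S ∪ B) (T ∪ B) with hM
  have hV : (S ∪ T ∪ insert r R).erase r = S ∪ T ∪ R := by
    ext j; simp only [Finset.mem_erase, Finset.mem_union, Finset.mem_insert]; grind
  have hVk : ∀ k ∈ R \ B, (S ∪ T ∪ R).erase k = S ∪ T ∪ R.erase k := by
    intro k hk; ext j
    simp only [Finset.mem_erase, Finset.mem_union, Finset.mem_sdiff] at hk ⊢; grind
  have hMr : M r r = c := by simp [hM, labelled, hrS, hrT, hrB]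
  have e1 : ∀ j ≠ r, M j r = if j ∈ S ∪ T ∪ R ∧ j ∉ S ∪ B then x r / (x r - x j) else 0 := by
    intro j hj
    simp only [hM, labelled, Matrix.of_apply, Finset.mem_union, Finset.mem_insert, hj]
    grind
  have e2 : ∀ k ≠ r, M r k = if k ∈ S ∪ T ∪ R ∧ k ∉ T ∪ B then x k / (x k - x r) else 0 := by
    intro j hj
    simp only [hM, labelled, Matrix.of_apply, Finset.mem_union, Finset.mem_insert, hj, Ne.symm hj]
    grind
  rw [det_ward M r (fun j => if j ∈ S ∪ T ∪ R ∧ j ∉ S ∪ B then interaction x r j else 0)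
    (fun j => if j ∈ S ∪ T ∪ R ∧ j ∉ T ∪ B then interaction x r j else 0)]
  · rw [hMr, hM, isolate_labelled, hV]
    simp_rw [isolate_labelled]
    have s1 : ∑ j ∈ Finset.univ.erase r,
        ((if j ∈ S ∪ T ∪ R ∧ j ∉ S ∪ B then interaction x r j else 0) -
          (if j ∈ S ∪ T ∪ R ∧ j ∉ T ∪ B then interaction x r j else 0)) =
        ∑ t ∈ T, interaction x r t - ∑ s ∈ S, interaction x r s := by
      rw [← Finset.sum_subset (Finset.subset_univ (T ∪ S : Finset ι) |> fun h =>
        Finset.subset_erase.2 ⟨h, by simp [hrS, hrT]⟩ : T ∪ S ⊆ Finset.univ.erase r)]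
      · rw [Finset.sum_union (Finset.disjoint_left.2 fun a h1 h2 => hST h2 h1), sub_eq_add_neg,
          ← Finset.sum_neg_distrib]
        congr 1
        · refine Finset.sum_congr rfl fun j hj => ?_
          simp only [Finset.mem_union]; grind
        · refine Finset.sum_congr rfl fun j hj => ?_
          simp only [Finset.mem_union]; grind
      · intro j _ hj; simp only [Finset.mem_union] at hj ⊢; grind
    rw [s1]
    have s2 : ∑ k ∈ Finset.univ.erase r, (M k r * M r k - M k k *
        ((if k ∈ S ∪ T ∪ R ∧ k ∉ S ∪ B then interaction x r k else 0) -
          (if k ∈ S ∪ T ∪ R ∧ k ∉ T ∪ B then interaction x r k else 0))) *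
          (labelled x y c ((S ∪ T ∪ R).erase k) (S ∪ B) (T ∪ B)).det =
        -∑ k ∈ R \ B, pairWeight x r k *
          (labelled x y c (S ∪ T ∪ R.erase k) (S ∪ B) (T ∪ B)).det := by
      rw [← Finset.sum_subset (s₁ := R \ B), ← Finset.sum_neg_distrib]
      · refine Finset.sum_congr rfl fun k hk => ?_
        have hkr : k ≠ r := by rintro rfl; simp [hrR] at hk
        rw [hVk k hk, e1 k hkr, e2 k hkr]
        simp only [Finset.mem_sdiff] at hk
        have h1 : k ∉ S := fun h => hSR h hk.1
        have h2 : k ∉ T := fun h => hTR h hk.1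
        simp only [Finset.mem_union, hk.1, hk.2, h1, h2, or_true, or_self, not_false_eq_true,
          and_self, if_true, interaction_mul_self x hx hkr]
        ring
      · intro k hk; simp only [Finset.mem_sdiff] at hk
        simp only [Finset.mem_erase, Finset.mem_univ, and_true]; rintro rfl; exact hrR hk.1
      · intro k hk hk'
        have hkr := (Finset.mem_erase.1 hk).1
        rw [e1 k hkr, e2 k hkr]
        have : M k k = if k ∈ S ∪ T ∪ R then (if k ∈ S ∪ T ∪ B then 0 else c) else 1 := by
          simp only [hM, labelled, Matrix.of_apply, Finset.mem_union, Finset.mem_insert, hkr]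
          grind
        rw [this]
        simp only [Finset.mem_sdiff, Finset.mem_union] at hk' ⊢
        by_cases a1 : k ∈ S <;> by_cases a2 : k ∈ T <;> by_cases a3 : k ∈ R <;>
          by_cases a4 : k ∈ B <;> simp_all
    rw [← hM, s2]; ring
  · intro j k hj hk hjk
    rw [e1 j hj, e2 k hk]
    have e3 : M j k = if j ∈ S ∪ T ∪ R ∧ k ∈ S ∪ T ∪ R then
      if j ∈ S ∪ B then
        if k ∈ T ∪ B then -(y j / y k) * (x k / (x k - x j)) else 0
      else if k ∈ T ∪ B then 0 else x k / (x k - x j) else 0 := by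
      simp only [hM, labelled, Matrix.of_apply, Finset.mem_union, Finset.mem_insert, hj, hk, hjk,
        false_or, if_false]
    rw [e3]
    have := interaction_mul x hx hj hk hjk
    by_cases a1 : j ∈ S ∪ T ∪ R <;> by_cases a2 : k ∈ S ∪ T ∪ R <;> by_cases a3 : j ∈ S ∪ B <;>
      by_cases a4 : k ∈ T ∪ B <;> simp only [a1, a2, a3, a4, and_self, and_true,
        and_false, if_true, if_false, not_true_eq_false, not_false_eq_true] <;>
      first
        | exact this
        | ring

include hx hy in
-- Here both labels of `r` are the second one. The ratios of `y` telescope through `r`, at the price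
-- of a sign reversing the interaction. The points seen are now the complementary ones, `S` in rows
-- and `T` in columns, which reverses it again, so the interaction term agrees with the one for the
-- first label. There is no `c`, since a point with both labels second has diagonal entry zero.
theorem det_labelled_insert_second {S T R B : Finset ι} {r : ι} (hST : Disjoint S T)
    (hSR : Disjoint S R) (hTR : Disjoint T R) (hrS : r ∉ S) (hrT : r ∉ T) (hrR : r ∉ R)
    (hB : B ⊆ R) :
    (labelled x y c (S ∪ T ∪ insert r R) (S ∪ insert r B) (T ∪ insert r B)).det =
      (∑ s ∈ S, interaction x r s - ∑ t ∈ T, interaction x r t) *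
        (labelled x y c (S ∪ T ∪ R) (S ∪ B) (T ∪ B)).det +
      ∑ k ∈ B, pairWeight x r k *
        (labelled x y c (S ∪ T ∪ R.erase k) (S ∪ B.erase k) (T ∪ B.erase k)).det := by
  have hrB : r ∉ B := fun h => hrR (hB h)
  rw [Finset.disjoint_left] at hST hSR hTR
  set M := labelled x y c (S ∪ T ∪ insert r R) (S ∪ insert r B) (T ∪ insert r B) with hM
  have hV : (S ∪ T ∪ insert r R).erase r = S ∪ T ∪ R := by
    ext j; simp only [Finset.mem_erase, Finset.mem_union, Finset.mem_insert]; grind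
  have hVk : ∀ k ∈ B, labelled x y c ((S ∪ T ∪ R).erase k) (S ∪ B) (T ∪ B) =
      labelled x y c (S ∪ T ∪ R.erase k) (S ∪ B.erase k) (T ∪ B.erase k) := by
    intro k hk
    have hk' := hB hk
    have : (S ∪ T ∪ R).erase k = S ∪ T ∪ R.erase k := by
      ext j; simp only [Finset.mem_erase, Finset.mem_union]; grind
    rw [this]
    refine labelled_congr x y c ?_ ?_ <;> intro j hj <;>
      simp only [Finset.mem_erase, Finset.mem_union] at hj ⊢ <;> grind
  have hV0 : labelled x y c (S ∪ T ∪ R) (S ∪ insert r B) (T ∪ insert r B) =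
      labelled x y c (S ∪ T ∪ R) (S ∪ B) (T ∪ B) := by
    refine labelled_congr x y c ?_ ?_ <;> intro j hj <;>
      simp only [Finset.mem_union, Finset.mem_insert] at hj ⊢ <;> grind
  have hMr : M r r = 0 := by simp [hM, labelled]
  have e1 : ∀ j ≠ r, M j r = if j ∈ S ∪ T ∪ R ∧ j ∈ S ∪ B
      then -(y j / y r) * (x r / (x r - x j)) else 0 := by
    intro j hj
    simp only [hM, labelled, Matrix.of_apply, Finset.mem_union, Finset.mem_insert, hj]
    grind
  have e2 : ∀ k ≠ r, M r k = if k ∈ S ∪ T ∪ R ∧ k ∈ T ∪ B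
      then -(y r / y k) * (x k / (x k - x r)) else 0 := by
    intro j hj
    simp only [hM, labelled, Matrix.of_apply, Finset.mem_union, Finset.mem_insert, hj, Ne.symm hj]
    grind
  rw [det_ward M r (fun j => if j ∈ S ∪ T ∪ R ∧ j ∈ S ∪ B then -interaction x r j else 0)
    (fun j => if j ∈ S ∪ T ∪ R ∧ j ∈ T ∪ B then -interaction x r j else 0)]
  · rw [hMr, hM, isolate_labelled, hV, hV0]
    simp_rw [isolate_labelled]
    have s1 : ∑ j ∈ Finset.univ.erase r,
        ((if j ∈ S ∪ T ∪ R ∧ j ∈ S ∪ B then -interaction x r j else 0) -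
          (if j ∈ S ∪ T ∪ R ∧ j ∈ T ∪ B then -interaction x r j else 0)) =
        ∑ t ∈ T, interaction x r t - ∑ s ∈ S, interaction x r s := by
      rw [← Finset.sum_subset (Finset.subset_univ (T ∪ S : Finset ι) |> fun h =>
        Finset.subset_erase.2 ⟨h, by simp [hrS, hrT]⟩ : T ∪ S ⊆ Finset.univ.erase r)]
      · rw [Finset.sum_union (Finset.disjoint_left.2 fun a h1 h2 => hST h2 h1), sub_eq_add_neg,
          ← Finset.sum_neg_distrib]
        congr 1
        · refine Finset.sum_congr rfl fun j hj => ?_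
          simp only [Finset.mem_union]; grind
        · refine Finset.sum_congr rfl fun j hj => ?_
          simp only [Finset.mem_union]; grind
      · intro j _ hj; simp only [Finset.mem_union] at hj ⊢; grind
    rw [s1]
    have s2 : ∑ k ∈ Finset.univ.erase r, (M k r * M r k - M k k *
        ((if k ∈ S ∪ T ∪ R ∧ k ∈ S ∪ B then -interaction x r k else 0) -
          (if k ∈ S ∪ T ∪ R ∧ k ∈ T ∪ B then -interaction x r k else 0))) *
          (labelled x y c ((S ∪ T ∪ R).erase k) (S ∪ B) (T ∪ B)).det =
        -∑ k ∈ B, pairWeight x r k *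
          (labelled x y c (S ∪ T ∪ R.erase k) (S ∪ B.erase k) (T ∪ B.erase k)).det := by
      rw [← Finset.sum_subset (s₁ := B), ← Finset.sum_neg_distrib]
      · refine Finset.sum_congr rfl fun k hk => ?_
        have hkr : k ≠ r := by rintro rfl; exact hrB hk
        rw [hVk k hk, e1 k hkr, e2 k hkr]
        have h0 := hy k
        have h0' := hy r
        simp only [Finset.mem_union, hB hk, hk, or_true, and_self, if_true]
        rw [mul_mul_mul_comm, interaction_mul_self x hx hkr, neg_mul_neg,
          div_mul_div_cancel₀ h0', div_self h0]
        ring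
      · intro k hk
        simp only [Finset.mem_erase, Finset.mem_univ, and_true]; rintro rfl; exact hrB hk
      · intro k hk hk'
        have hkr := (Finset.mem_erase.1 hk).1
        rw [e1 k hkr, e2 k hkr]
        have : M k k = if k ∈ S ∪ T ∪ R then (if k ∈ S ∪ T ∪ B then 0 else c) else 1 := by
          simp only [hM, labelled, Matrix.of_apply, Finset.mem_union, Finset.mem_insert, hkr]
          grind
        rw [this]
        simp only [Finset.mem_union] at hk' ⊢
        by_cases a1 : k ∈ S <;> by_cases a2 : k ∈ T <;> by_cases a3 : k ∈ R <;>
          by_cases a4 : k ∈ B <;> simp_all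
    rw [← hM, s2]; ring
  · intro j k hj hk hjk
    rw [e1 j hj, e2 k hk]
    have e3 : M j k = if j ∈ S ∪ T ∪ R ∧ k ∈ S ∪ T ∪ R then
      if j ∈ S ∪ B then
        if k ∈ T ∪ B then -(y j / y k) * (x k / (x k - x j)) else 0
      else if k ∈ T ∪ B then 0 else x k / (x k - x j) else 0 := by
      simp only [hM, labelled, Matrix.of_apply, Finset.mem_union, Finset.mem_insert, hj, hk, hjk,
        false_or, if_false]
    rw [e3]
    have := interaction_mul x hx hj hk hjk
    have h0' := hy r
    have : -(y j / y r) * (x r / (x r - x j)) * (-(y r / y k) * (x k / (x k - x r))) =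
        -(y j / y k) * (x k / (x k - x j)) * (-interaction x r j - -interaction x r k) := by
      rw [mul_mul_mul_comm, this, neg_mul_neg, div_mul_div_cancel₀ h0']
      ring
    by_cases a1 : j ∈ S ∪ T ∪ R <;> by_cases a2 : k ∈ S ∪ T ∪ R <;> by_cases a3 : j ∈ S ∪ B <;>
      by_cases a4 : k ∈ T ∪ B <;> simp only [a1, a2, a3, a4, and_self, and_true,
        and_false, if_true, if_false] <;>
      first
        | exact this
        | ring


/-- The sum over all labellings of the points of `R`, with fixed `S` and `T`. -/
def labelledSum (x y : ι → ℂ) (c : ℂ) (S T R : Finset ι) : ℂ :=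
  ∑ B ∈ R.powerset, (labelled x y c (S ∪ T ∪ R) (S ∪ B) (T ∪ B)).det

include hx hy in
-- Both labels of `r` give the same interaction, whence the first factor 2. A partner `k` must carry
-- the label of `r`; once `k` is deleted, each case runs over all labellings of `R.erase k`, whence
-- the second factor 2.
theorem labelledSum_insert {S T R : Finset ι} {r : ι} (hST : Disjoint S T)
    (hSR : Disjoint S R) (hTR : Disjoint T R) (hrS : r ∉ S) (hrT : r ∉ T) (hrR : r ∉ R) :
    labelledSum x y c S T (insert r R) =
      (c + 2 * (∑ s ∈ S, interaction x r s - ∑ t ∈ T, interaction x r t)) *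
        labelledSum x y c S T R +
      ∑ k ∈ R, 2 * pairWeight x r k * labelledSum x y c S T (R.erase k) := by
  rw [labelledSum, Finset.sum_powerset_insert hrR]
  rw [Finset.sum_congr rfl fun B hB => det_labelled_insert_first x y c hx hST hSR hTR hrS hrT hrR
    (Finset.mem_powerset.1 hB)]
  rw [Finset.sum_congr (s₁ := R.powerset) rfl fun B hB => det_labelled_insert_second x y c hx hy
    hST hSR hTR hrS hrT hrR (Finset.mem_powerset.1 hB)]
  rw [Finset.sum_add_distrib, Finset.sum_add_distrib, sum_powerset_sum_sdiff R fun k B =>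
    pairWeight x r k * (labelled x y c (S ∪ T ∪ R.erase k) (S ∪ B) (T ∪ B)).det,
    sum_powerset_sum_mem R fun k B =>
    pairWeight x r k * (labelled x y c (S ∪ T ∪ R.erase k) (S ∪ B) (T ∪ B)).det]
  simp only [labelledSum, Finset.mul_sum]
  rw [add_add_add_comm, ← Finset.sum_add_distrib, ← Finset.sum_add_distrib]
  congr 1
  · exact Finset.sum_congr rfl fun B _ => by ring
  · refine Finset.sum_congr rfl fun k _ => ?_
    rw [← Finset.sum_add_distrib]
    exact Finset.sum_congr rfl fun B _ => by ring

end Labelled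

/-! ### Sums over set partitions. -/

section Partitions

variable {σ E : Type*} [DecidableEq σ] [CommSemiring E]

/-- The sum over all set partitions of `V` of the product of `H` over the parts. -/
def partitionSum (H : Finset σ → E) (V : Finset σ) : E :=
  ∑ P : Finpartition V, ∏ U ∈ P.parts, H U

theorem partitionSum_empty (H : Finset σ → E) : partitionSum H ∅ = 1 := by
  unfold partitionSum
  have : (Finset.univ : Finset (Finpartition (∅ : Finset σ))) = {Finpartition.empty _} := by
    ext P; simp only [Finset.mem_univ, Finset.mem_singleton, true_iff]
    exact Subsingleton.elim (α := Finpartition (⊥ : Finset σ)) _ _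
  rw [this]
  simp

theorem sum_finpartition_of_mem (H : Finset σ → E) {V W : Finset σ} (hW : W ⊆ V)
    (hne : W.Nonempty) :
    ∑ P : Finpartition V with W ∈ P.parts, ∏ U ∈ P.parts, H U =
      H W * partitionSum H (V \ W) := by
  rw [partitionSum, Finset.mul_sum]
  have hsup : ∀ P : Finpartition V, W ∈ P.parts → (P.parts.erase W).sup id = V \ W := by
    intro P hP
    ext a
    simp only [Finset.mem_sup, Finset.mem_erase, id, Finset.mem_sdiff]
    constructor
    · rintro ⟨U, ⟨hUW, hU⟩, ha⟩
      refine ⟨P.le hU ha, fun haW => ?_⟩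
      exact Finset.disjoint_left.1 (P.disjoint hU hP hUW) ha haW
    · rintro ⟨ha, haW⟩
      obtain ⟨U, hU, haU⟩ := P.exists_mem ha
      exact ⟨U, ⟨fun h => haW (h ▸ haU), hU⟩, haU⟩
  refine Finset.sum_bij'
    (fun P hP => P.ofSubset (Finset.erase_subset W P.parts)
      (hsup P (Finset.mem_filter.1 hP).2))
    (fun P _ => P.extend hne.ne_empty (Finset.sdiff_disjoint) (Finset.sdiff_union_of_subset hW))
    ?_ ?_ ?_ ?_ ?_
  · intro P _; exact Finset.mem_univ _
  · intro P _; simp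
  · intro P hP
    ext1
    simp [Finset.insert_erase (Finset.mem_filter.1 hP).2]
  · intro P _
    have hWP : W ∉ P.parts := by
      intro h
      obtain ⟨a, ha⟩ := hne
      exact (Finset.mem_sdiff.1 (P.le h ha)).2 ha
    ext1
    simp [Finset.erase_insert hWP]
  · intro P hP
    exact (Finset.mul_prod_erase _ _ (Finset.mem_filter.1 hP).2).symm

/-- Partitions are classified by the block containing `r`. -/
theorem partitionSum_insert (H : Finset σ → E) {V : Finset σ} {r : σ} (hr : r ∉ V) :
    partitionSum H (insert r V) = ∑ U ∈ V.powerset, H (insert r U) * partitionSum H (V \ U) := by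
  have h1 : ∀ U ∈ V.powerset, H (insert r U) * partitionSum H (V \ U) =
      ∑ P : Finpartition (insert r V) with insert r U ∈ P.parts, ∏ U ∈ P.parts, H U := by
    intro U hU
    rw [sum_finpartition_of_mem H (Finset.insert_subset_insert r (Finset.mem_powerset.1 hU))
      (Finset.insert_nonempty r U)]
    congr 2
    ext a; simp only [Finset.mem_sdiff, Finset.mem_insert]; grind
  rw [Finset.sum_congr rfl h1, partitionSum]
  simp_rw [Finset.sum_filter]
  rw [Finset.sum_comm]
  refine Finset.sum_congr rfl fun P _ => ?_
  have hmem := P.part_mem.2 (Finset.mem_insert_self r V)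
  have hrp : r ∈ P.part r := P.mem_part (Finset.mem_insert_self r V)
  have hins : insert r ((P.part r).erase r) = P.part r := Finset.insert_erase hrp
  rw [Finset.sum_eq_single ((P.part r).erase r)]
  · rw [hins, if_pos hmem]
  · intro U hU hne
    rw [if_neg]
    intro h
    have hrU : r ∉ U := fun h => hr (Finset.mem_powerset.1 hU h)
    apply hne
    rw [P.part_eq_of_mem h (Finset.mem_insert_self r U), Finset.erase_insert hrU]
  · intro h
    exfalso; apply h
    rw [Finset.mem_powerset]
    intro a ha
    obtain ⟨ha1, ha2⟩ := Finset.mem_erase.1 ha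
    exact (Finset.mem_insert.1 (P.le hmem ha2)).resolve_left ha1

theorem partitionSum_insert_of_pairs (H : Finset σ → E) (hH : ∀ U, 2 < U.card → H U = 0)
    {V : Finset σ} {r : σ} (hr : r ∉ V) :
    partitionSum H (insert r V) =
      H {r} * partitionSum H V + ∑ k ∈ V, H {r, k} * partitionSum H (V.erase k) := by
  rw [partitionSum_insert H hr]
  have hsub : insert ∅ (V.image fun k => ({k} : Finset σ)) ⊆ V.powerset := by
    intro U hU
    simp only [Finset.mem_insert, Finset.mem_image] at hU
    rcases hU with rfl | ⟨k, hk, rfl⟩ <;> simp_all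
  rw [← Finset.sum_subset hsub]
  · rw [Finset.sum_insert (by simp), Finset.sum_image (by intro a _ b _ h; simpa using h)]
    simp [Finset.sdiff_singleton_eq_erase]
  · intro U hU hU'
    rw [hH, zero_mul]
    rw [Finset.card_insert_of_notMem fun h => hr (Finset.mem_powerset.1 hU h)]
    simp only [Finset.mem_insert, Finset.mem_image, not_or, not_exists, not_and] at hU'
    have h0 : U.card ≠ 0 := fun h => hU'.1 (Finset.card_eq_zero.1 h)
    have h1 : U.card ≠ 1 := by
      intro h
      obtain ⟨k, rfl⟩ := Finset.card_eq_one.1 h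
      exact hU'.2 k (by simpa using hU) rfl
    omega

end Partitions

/-! ### The recursion for the partition side. -/

section Split

variable {ι : Type*} [DecidableEq ι]

/-- The sum over all ways to distribute the points of `R` among a left copy, a right copy and a
remainder, in which each point carries the weight `c`. -/
def splitSum (c : ℂ) (H : Finset (ι ⊕ ι) → ℂ) (R : Finset ι) : ℂ :=
  ∑ K ∈ R.powerset, ∑ L ∈ (R \ K).powerset,
    c ^ ((R \ K) \ L).card * partitionSum H (K.disjSum L)

/-- The new point joins the remainder, or one of the two copies, where it is a singleton or is
paired with a point of the opposite copy. A pair of `r` and `k` occurs in two ways, with `r` on the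
left or on the right, and symmetry of `w` merges them into the factor 2. -/
theorem splitSum_insert (c : ℂ) (H : Finset (ι ⊕ ι) → ℂ) (w : ι → ι → ℂ)
    (hH : ∀ U, 2 < U.card → H U = 0)
    (hll : ∀ i j, i ≠ j → H {Sum.inl i, Sum.inl j} = 0)
    (hrr : ∀ i j, i ≠ j → H {Sum.inr i, Sum.inr j} = 0)
    (hlr : ∀ i j, i ≠ j → H {Sum.inl i, Sum.inr j} = w i j)
    (hw : ∀ i j, w i j = w j i) {R : Finset ι} {r : ι} (hr : r ∉ R) :
    splitSum c H (insert r R) =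
      (c + (H {Sum.inl r} + H {Sum.inr r})) * splitSum c H R +
        ∑ k ∈ R, 2 * w r k * splitSum c H (R.erase k) := by
  have hsplit : splitSum c H (insert r R) =
      ∑ K ∈ R.powerset, ∑ L ∈ (R \ K).powerset,
        (c ^ ((R \ K) \ L).card * (c * partitionSum H (K.disjSum L)) +
          c ^ ((R \ K) \ L).card * partitionSum H (K.disjSum (insert r L)) +
          c ^ ((R \ K) \ L).card * partitionSum H ((insert r K).disjSum L)) := by
    rw [splitSum, Finset.sum_powerset_insert hr, ← Finset.sum_add_distrib]
    refine Finset.sum_congr rfl fun K hK => ?_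
    have hK := Finset.mem_powerset.1 hK
    have hrK : r ∉ K := fun h => hr (hK h)
    have e1 : insert r R \ K = insert r (R \ K) := by
      ext a; simp only [Finset.mem_sdiff, Finset.mem_insert]; grind
    have e2 : insert r R \ insert r K = R \ K := by
      ext a; simp only [Finset.mem_sdiff, Finset.mem_insert]; grind
    have hr' : r ∉ R \ K := by simp [hr]
    rw [e1, e2, Finset.sum_powerset_insert hr', ← Finset.sum_add_distrib,
      ← Finset.sum_add_distrib]
    refine Finset.sum_congr rfl fun L hL => ?_
    have hrL : r ∉ L := fun h => hr' (Finset.mem_powerset.1 hL h)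
    have e3 : insert r (R \ K) \ L = insert r ((R \ K) \ L) := by
      ext a; simp only [Finset.mem_sdiff, Finset.mem_insert]; grind
    have e4 : insert r (R \ K) \ insert r L = (R \ K) \ L := by
      ext a; simp only [Finset.mem_sdiff, Finset.mem_insert]; grind
    rw [e3, e4, Finset.card_insert_of_notMem (by simp [hr]), pow_succ, mul_assoc]
  have hR : ∀ K ∈ R.powerset, ∀ L ∈ (R \ K).powerset,
      partitionSum H (K.disjSum (insert r L)) = H {Sum.inr r} * partitionSum H (K.disjSum L) +
        ∑ k ∈ K, w r k * partitionSum H ((K.erase k).disjSum L) := by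
    intro K hK L hL
    have hK := Finset.mem_powerset.1 hK
    have hL := Finset.mem_powerset.1 hL
    have hrL : r ∉ L := fun h => hr (Finset.mem_sdiff.1 (hL h)).1
    have e : K.disjSum (insert r L) = insert (Sum.inr r) (K.disjSum L) := by
      ext (a | a) <;> simp
    rw [e, partitionSum_insert_of_pairs H hH (by simpa using hrL)]
    congr 1
    rw [Finset.sum_disjSum]
    have z : ∑ k ∈ L, H {Sum.inr r, Sum.inr k} * partitionSum H ((K.disjSum L).erase (Sum.inr k))
        = 0 := Finset.sum_eq_zero fun k hk => by
      rw [hrr r k (by rintro rfl; exact hrL hk), zero_mul]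
    rw [z, add_zero]
    refine Finset.sum_congr rfl fun k hk => ?_
    rw [Finset.pair_comm, hlr k r (by rintro rfl; exact hr (hK hk)), hw]
    congr 2
    ext (a | a) <;> simp
  have hL' : ∀ K ∈ R.powerset, ∀ L ∈ (R \ K).powerset,
      partitionSum H ((insert r K).disjSum L) = H {Sum.inl r} * partitionSum H (K.disjSum L) +
        ∑ k ∈ L, w r k * partitionSum H (K.disjSum (L.erase k)) := by
    intro K hK L hL
    have hK := Finset.mem_powerset.1 hK
    have hL := Finset.mem_powerset.1 hL
    have hrL : r ∉ L := fun h => hr (Finset.mem_sdiff.1 (hL h)).1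
    have hrK : r ∉ K := fun h => hr (hK h)
    have e : (insert r K).disjSum L = insert (Sum.inl r) (K.disjSum L) := by
      ext (a | a) <;> simp
    rw [e, partitionSum_insert_of_pairs H hH (by simpa using hrK)]
    congr 1
    rw [Finset.sum_disjSum]
    have z : ∑ k ∈ K, H {Sum.inl r, Sum.inl k} * partitionSum H ((K.disjSum L).erase (Sum.inl k))
        = 0 := Finset.sum_eq_zero fun k hk => by
      rw [hll r k (by rintro rfl; exact hrK hk), zero_mul]
    rw [z, zero_add]
    refine Finset.sum_congr rfl fun k hk => ?_
    rw [hlr r k (by rintro rfl; exact hrL hk)]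
    congr 2
    ext (a | a) <;> simp
  -- The pairs with `r` in the right copy: the partner `k` disappears from `K`, and the sum is
  -- reindexed by what is left of `K`. The pairs with `r` in the left copy are treated in `t2`.
  have t1 : ∑ K ∈ R.powerset, ∑ L ∈ (R \ K).powerset, ∑ k ∈ K,
      c ^ ((R \ K) \ L).card * (w r k * partitionSum H ((K.erase k).disjSum L)) =
      ∑ k ∈ R, w r k * splitSum c H (R.erase k) := by
    have : ∀ K ∈ R.powerset, ∑ L ∈ (R \ K).powerset, ∑ k ∈ K,
        c ^ ((R \ K) \ L).card * (w r k * partitionSum H ((K.erase k).disjSum L)) =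
        ∑ k ∈ K, (fun k (K' : Finset ι) => ∑ L ∈ (R.erase k \ K').powerset,
          c ^ ((R.erase k \ K') \ L).card * (w r k * partitionSum H (K'.disjSum L)))
          k (K.erase k) := by
      intro K hK
      rw [Finset.sum_comm]
      refine Finset.sum_congr rfl fun k hk => ?_
      have : R.erase k \ K.erase k = R \ K := by
        ext a; simp only [Finset.mem_sdiff, Finset.mem_erase]; grind
      simp only [this]
    rw [Finset.sum_congr rfl this, sum_powerset_sum_mem R fun k (K' : Finset ι) =>
      ∑ L ∈ (R.erase k \ K').powerset,
          c ^ ((R.erase k \ K') \ L).card * (w r k * partitionSum H (K'.disjSum L))]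
    refine Finset.sum_congr rfl fun k _ => ?_
    rw [splitSum, Finset.mul_sum]
    refine Finset.sum_congr rfl fun K _ => ?_
    rw [Finset.mul_sum]
    exact Finset.sum_congr rfl fun L _ => by ring
  have t2 : ∑ K ∈ R.powerset, ∑ L ∈ (R \ K).powerset, ∑ k ∈ L,
      c ^ ((R \ K) \ L).card * (w r k * partitionSum H (K.disjSum (L.erase k))) =
      ∑ k ∈ R, w r k * splitSum c H (R.erase k) := by
    have : ∀ K ∈ R.powerset, ∑ L ∈ (R \ K).powerset, ∑ k ∈ L,
        c ^ ((R \ K) \ L).card * (w r k * partitionSum H (K.disjSum (L.erase k))) =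
        ∑ k ∈ R \ K, ∑ L ∈ ((R.erase k) \ K).powerset,
          c ^ (((R.erase k) \ K) \ L).card * (w r k * partitionSum H (K.disjSum L)) := by
      intro K hK
      have e : ∀ k, R.erase k \ K = (R \ K).erase k := fun k => by
        ext a; simp only [Finset.mem_sdiff, Finset.mem_erase]; grind
      simp only [e]
      rw [← sum_powerset_sum_mem (R \ K) fun k L =>
        c ^ (((R \ K).erase k) \ L).card * (w r k * partitionSum H (K.disjSum L))]
      refine Finset.sum_congr rfl fun L _ => Finset.sum_congr rfl fun k hk => ?_
      have : (R \ K).erase k \ L.erase k = (R \ K) \ L := by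
        ext a; simp only [Finset.mem_sdiff, Finset.mem_erase]; grind
      rw [this]
    rw [Finset.sum_congr rfl this, sum_powerset_sum_sdiff R fun k K =>
      ∑ L ∈ ((R.erase k) \ K).powerset,
          c ^ (((R.erase k) \ K) \ L).card * (w r k * partitionSum H (K.disjSum L))]
    refine Finset.sum_congr rfl fun k _ => ?_
    rw [splitSum, Finset.mul_sum]
    refine Finset.sum_congr rfl fun K _ => ?_
    rw [Finset.mul_sum]
    exact Finset.sum_congr rfl fun L _ => by ring
  have hfin : ∑ k ∈ R, 2 * w r k * splitSum c H (R.erase k) =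
      ∑ k ∈ R, w r k * splitSum c H (R.erase k) + ∑ k ∈ R, w r k * splitSum c H (R.erase k) := by
    rw [← Finset.sum_add_distrib]
    exact Finset.sum_congr rfl fun k _ => by ring
  rw [hsplit, hfin]
  nth_rewrite 1 [← t1]
  rw [← t2]
  conv_rhs => rw [splitSum]
  rw [Finset.mul_sum, ← Finset.sum_add_distrib, ← Finset.sum_add_distrib]
  refine Finset.sum_congr rfl fun K hK => ?_
  rw [Finset.mul_sum, ← Finset.sum_add_distrib, ← Finset.sum_add_distrib]
  refine Finset.sum_congr rfl fun L hL => ?_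
  rw [hR K hK L hL, hL' K hK L hL]
  simp only [← Finset.mul_sum]
  ring

theorem splitSum_empty (c : ℂ) (H : Finset (ι ⊕ ι) → ℂ) : splitSum c H ∅ = 1 := by
  simp [splitSum, partitionSum_empty]

end Split

/-! ### Cauchy determinants via Lagrange interpolation. -/

section Cauchy

/-- The Cauchy matrix `v_j / (v_j - u_i)`. -/
def cauchyMatrix {m : ℕ} (u v : Fin m → ℂ) : Matrix (Fin m) (Fin m) ℂ :=
  Matrix.of fun i j => v j / (v j - u i)

/-- Interpolating the monomials of degree below `m` at the nodes `v` and evaluating at `u` shows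
that the matrix of Lagrange basis values carries the Vandermonde matrix of `v` to that of `u`. The
Cauchy matrix is this matrix up to diagonal factors on both sides. -/
theorem det_cauchyMatrix_mul_vandermonde {m : ℕ} (u v : Fin m → ℂ) (hv : Function.Injective v)
    (huv : ∀ i j, u i ≠ v j) :
    (cauchyMatrix u v).det * (Matrix.vandermonde v).det * ∏ i, ∏ k, (v k - u i) =
      (Matrix.vandermonde u).det * ∏ j, (v j * ∏ k ∈ Finset.univ.erase j, (v k - v j)) := by
  set Λ : Matrix (Fin m) (Fin m) ℂ := Matrix.of fun i j =>
    (Lagrange.basis Finset.univ v j).eval (u i) with hΛ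
  have h1 : Λ * Matrix.vandermonde v = Matrix.vandermonde u := by
    ext i p
    rw [Matrix.mul_apply, Matrix.vandermonde_apply]
    have hdeg : ((Polynomial.X : Polynomial ℂ) ^ (p : ℕ)).degree <
        (Finset.univ : Finset (Fin m)).card := by
      rw [Polynomial.degree_X_pow, Finset.card_univ, Fintype.card_fin]
      exact_mod_cast p.2
    have := Lagrange.eq_interpolate (v := v) (s := Finset.univ) hv.injOn hdeg
    have h2 := congrArg (Polynomial.eval (u i)) this
    rw [Lagrange.interpolate_apply, Polynomial.eval_finsetSum] at h2
    simp only [Polynomial.eval_mul, Polynomial.eval_C, Polynomial.eval_pow, Polynomial.eval_X] at h2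
    rw [h2]
    refine Finset.sum_congr rfl fun j _ => ?_
    rw [hΛ, Matrix.of_apply, Matrix.vandermonde_apply, mul_comm]
  have h2 : Matrix.diagonal (fun i => ∏ k, (v k - u i)) * cauchyMatrix u v =
      Λ * Matrix.diagonal (fun j => v j * ∏ k ∈ Finset.univ.erase j, (v k - v j)) := by
    ext i j
    rw [Matrix.diagonal_mul, Matrix.mul_diagonal, cauchyMatrix, Matrix.of_apply, hΛ,
      Matrix.of_apply, Lagrange.basis, Polynomial.eval_prod,
      ← Finset.mul_prod_erase Finset.univ _ (Finset.mem_univ j)]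
    have hne : v j - u i ≠ 0 := sub_ne_zero.2 (huv i j).symm
    have h3 : (∏ k ∈ Finset.univ.erase j,
        Polynomial.eval (u i) (Lagrange.basisDivisor (v j) (v k))) *
        ∏ k ∈ Finset.univ.erase j, (v k - v j) = ∏ k ∈ Finset.univ.erase j, (v k - u i) := by
      rw [← Finset.prod_mul_distrib]
      refine Finset.prod_congr rfl fun k hk => ?_
      have : v j - v k ≠ 0 := sub_ne_zero.2 fun h => (Finset.mem_erase.1 hk).1 (hv h).symm
      simp only [Lagrange.basisDivisor, Polynomial.eval_mul, Polynomial.eval_C,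
        Polynomial.eval_sub, Polynomial.eval_X]
      field_simp
      ring
    rw [← h3]
    field_simp
  have h3 := congrArg Matrix.det h2
  rw [Matrix.det_mul, Matrix.det_mul, Matrix.det_diagonal, Matrix.det_diagonal] at h3
  rw [← h1, Matrix.det_mul]
  linear_combination (Matrix.vandermonde v).det * h3

/-- The Vandermonde quotients of the two Cauchy determinants are reciprocal and cancel. -/
theorem det_cauchyMatrix_mul {m : ℕ} (u v : Fin m → ℂ) (hu : Function.Injective u)
    (hv : Function.Injective v) (huv : ∀ i j, u i ≠ v j) :
    (cauchyMatrix u v).det * (cauchyMatrix v u).det *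
        ((∏ i, ∏ k, (v k - u i)) * ∏ k, ∏ i, (u i - v k)) =
      (∏ j, (v j * ∏ k ∈ Finset.univ.erase j, (v k - v j))) *
        ∏ j, (u j * ∏ k ∈ Finset.univ.erase j, (u k - u j)) := by
  have h1 := det_cauchyMatrix_mul_vandermonde u v hv huv
  have h2 := det_cauchyMatrix_mul_vandermonde v u hu fun i j => (huv j i).symm
  have hu' := Matrix.det_vandermonde_ne_zero_iff.2 hu
  have hv' := Matrix.det_vandermonde_ne_zero_iff.2 hv
  apply mul_left_cancel₀ (mul_ne_zero hu' hv')
  linear_combination (cauchyMatrix v u).det * (Matrix.vandermonde u).det *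
    (∏ k, ∏ i, (u i - v k)) * h1
    + (Matrix.vandermonde u).det * (∏ j, (v j * ∏ k ∈ Finset.univ.erase j, (v k - v j))) * h2

theorem prod_prod_ite_ne {m : ℕ} (u : Fin m → ℂ) (hu : Function.Injective u) :
    (∏ i, ∏ k, (if i = k then 1 else u k / (u k - u i))) *
      ∏ i, (u i * ∏ k ∈ Finset.univ.erase i, (u k - u i)) = ∏ _i : Fin m, ∏ k, u k := by
  rw [← Finset.prod_mul_distrib]
  refine Finset.prod_congr rfl fun i _ => ?_
  rw [← Finset.mul_prod_erase _ _ (Finset.mem_univ i),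
    ← Finset.mul_prod_erase (s := Finset.univ) (f := u) (Finset.mem_univ i), if_pos rfl,
    one_mul, mul_left_comm,
    ← Finset.prod_mul_distrib]
  congr 1
  refine Finset.prod_congr rfl fun k hk => ?_
  have hk := (Finset.mem_erase.1 hk).1
  have : u k - u i ≠ 0 := sub_ne_zero.2 fun h => hk (hu h)
  rw [if_neg hk.symm]
  field_simp

theorem det_cauchyMatrix_mul_eq {m : ℕ} (u v : Fin m → ℂ) (hu : Function.Injective u)
    (hv : Function.Injective v) (huv : ∀ i j, u i ≠ v j) (hu0 : ∀ i, u i ≠ 0)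
    (hv0 : ∀ i, v i ≠ 0) :
    (cauchyMatrix u v).det * (cauchyMatrix v u).det =
      ((∏ i, ∏ k, v k / (v k - u i)) * ∏ i, ∏ k, u i / (u i - v k)) /
        ((∏ i, ∏ k, (if i = k then 1 else u k / (u k - u i))) *
          ∏ i, ∏ k, (if i = k then 1 else v i / (v i - v k))) := by
  have e1 := prod_prod_ite_ne u hu
  have e2 := prod_prod_ite_ne v hv
  have e3 := det_cauchyMatrix_mul u v hu hv huv
  have e4 : (∏ i, ∏ k, (if i = k then 1 else v i / (v i - v k))) =
      ∏ i, ∏ k, (if i = k then 1 else v k / (v k - v i)) := by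
    rw [Finset.prod_comm]
    simp only [eq_comm]
  have n1 : (∏ i, ∏ k, (v k - u i)) ≠ 0 :=
    Finset.prod_ne_zero_iff.2 fun i _ => Finset.prod_ne_zero_iff.2 fun k _ =>
      sub_ne_zero.2 (huv i k).symm
  have n2 : (∏ i, ∏ k, (u i - v k)) ≠ 0 :=
    Finset.prod_ne_zero_iff.2 fun i _ => Finset.prod_ne_zero_iff.2 fun k _ =>
      sub_ne_zero.2 (huv i k)
  have n3 : (∏ i, ∏ k, (if i = k then 1 else u k / (u k - u i))) ≠ 0 := by
    refine left_ne_zero_of_mul (b := ∏ i, (u i * ∏ k ∈ Finset.univ.erase i, (u k - u i))) ?_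
    rw [e1]
    exact Finset.prod_ne_zero_iff.2 fun i _ => Finset.prod_ne_zero_iff.2 fun k _ => hu0 k
  have n4 : (∏ i, ∏ k, (if i = k then 1 else v k / (v k - v i))) ≠ 0 := by
    refine left_ne_zero_of_mul (b := ∏ i, (v i * ∏ k ∈ Finset.univ.erase i, (v k - v i))) ?_
    rw [e2]
    exact Finset.prod_ne_zero_iff.2 fun i _ => Finset.prod_ne_zero_iff.2 fun k _ => hv0 k
  have e5 : ∏ i : Fin m, ∏ k : Fin m, u i = ∏ i : Fin m, ∏ k, u k := Finset.prod_comm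
  rw [Finset.prod_comm (f := fun (k i : Fin m) => u i - v k)] at e3
  rw [e4, eq_div_iff (mul_ne_zero n3 n4)]
  simp only [Finset.prod_div_distrib] at *
  rw [e5, ← e1, ← e2, div_mul_div_comm, eq_div_iff (mul_ne_zero n1 n2)]
  linear_combination (∏ i, ∏ k, (if i = k then 1 else u k / (u k - u i))) *
    (∏ i, ∏ k, (if i = k then 1 else v k / (v k - v i))) * e3

/-- The antidiagonal factor with blocks `-1` and `1` is a product of three unipotent block matrices,
so no sign depending on the size appears. -/
theorem det_fromBlocks_antidiagonal {m : Type*} [Fintype m] [DecidableEq m]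
    (A B : Matrix m m ℂ) :
    (Matrix.fromBlocks 0 (-A) B 0).det = A.det * B.det := by
  have hJ : (Matrix.fromBlocks 0 (-1) 1 0 : Matrix (m ⊕ m) (m ⊕ m) ℂ) =
      Matrix.fromBlocks 1 (-1) 0 1 * Matrix.fromBlocks 1 0 1 1 * Matrix.fromBlocks 1 (-1) 0 1 := by
    simp [Matrix.fromBlocks_multiply]
  have : (Matrix.fromBlocks 0 (-A) B 0 : Matrix (m ⊕ m) (m ⊕ m) ℂ) =
      Matrix.fromBlocks A 0 0 B * Matrix.fromBlocks 0 (-1) 1 0 := by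
    simp [Matrix.fromBlocks_multiply]
  rw [this, hJ]
  simp [Matrix.det_mul]

end Cauchy

/-! ### The determinant with only the points of `S` and `T`. -/

section Base

variable {ι : Type*} [Fintype ι] [DecidableEq ι]

/-- A permutation with a nonzero term has to map `S` into `T` and `T` into `S`. -/
theorem det_labelled_of_card_ne (x y : ι → ℂ) (c : ℂ) {S T : Finset ι} (hST : Disjoint S T)
    (h : S.card ≠ T.card) : (labelled x y c (S ∪ T) S T).det = 0 := by
  rw [Finset.disjoint_left] at hST
  rw [Matrix.det_apply]
  refine Finset.sum_eq_zero fun σ _ => ?_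
  have : ∃ i, labelled x y c (S ∪ T) S T (σ i) i = 0 := by
    by_contra! hne
    have hT : ∀ i ∈ T, σ i ∈ S := by
      intro i hi
      by_contra hS
      apply hne i
      simp only [labelled, Matrix.of_apply, Finset.mem_union, hi, hS]
      grind
    have hS : ∀ i ∈ S, σ i ∈ T := by
      intro i hi
      by_contra hS
      apply hne i
      simp only [labelled, Matrix.of_apply, Finset.mem_union, hi, hS]
      grind
    exact h (le_antisymm (Finset.card_le_card_of_injOn σ hS σ.injective.injOn)
      (Finset.card_le_card_of_injOn σ hT σ.injective.injOn))
  obtain ⟨i, hi⟩ := this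
  have h0 : ∏ i, labelled x y c (S ∪ T) S T (σ i) i = 0 :=
    Finset.prod_eq_zero (Finset.mem_univ i) hi
  rw [h0, smul_zero]

/-- Matching labels couple rows in `S` to columns in `T` and conversely. In the order `S`, `T`, rest
the matrix is block antidiagonal plus an identity block, and the ratios of `y` are diagonal factors
on one of the two Cauchy blocks. -/
theorem det_labelled_eq_cauchy (x y : ι → ℂ) (c : ℂ) {S T : Finset ι}
    (hST : Disjoint S T) {m : ℕ} (hS : S.card = m) (hT : T.card = m) :
    (labelled x y c (S ∪ T) S T).det =
      ((∏ s ∈ S, y s) / ∏ t ∈ T, y t) *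
      ((cauchyMatrix (fun i => x ((S.equivFinOfCardEq hS).symm i))
          (fun i => x ((T.equivFinOfCardEq hT).symm i))).det *
        (cauchyMatrix (fun i => x ((T.equivFinOfCardEq hT).symm i))
          (fun i => x ((S.equivFinOfCardEq hS).symm i))).det) := by
  rw [Finset.disjoint_left] at hST
  set eS : Fin m → ι := fun i => (S.equivFinOfCardEq hS).symm i with heS
  set eT : Fin m → ι := fun i => (T.equivFinOfCardEq hT).symm i with heT
  have hSm : ∀ i, eS i ∈ S := fun i => ((S.equivFinOfCardEq hS).symm i).2
  have hTm : ∀ i, eT i ∈ T := fun i => ((T.equivFinOfCardEq hT).symm i).2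
  have hSi : Function.Injective eS := Subtype.val_injective.comp (Equiv.injective _)
  have hTi : Function.Injective eT := Subtype.val_injective.comp (Equiv.injective _)
  have hSs : ∀ s ∈ S, ∃ i, eS i = s := fun s hs =>
    ⟨S.equivFinOfCardEq hS ⟨s, hs⟩, by simp [heS]⟩
  have hTs : ∀ s ∈ T, ∃ i, eT i = s := fun s hs =>
    ⟨T.equivFinOfCardEq hT ⟨s, hs⟩, by simp [heT]⟩
  let φ : (Fin m ⊕ Fin m) ⊕ {j // j ∉ S ∪ T} → ι := Sum.elim (Sum.elim eS eT) Subtype.val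
  have hφ : Function.Bijective φ := by
    constructor
    · refine Function.Injective.sumElim (Function.Injective.sumElim hSi hTi ?_)
        Subtype.val_injective ?_
      · intro a b h; exact hST (hSm a) (h ▸ hTm b)
      · rintro (a | a) ⟨b, hb⟩ h
        · simp only [Sum.elim_inl] at h; apply hb; rw [← h]; simp [hSm]
        · simp only [Sum.elim_inr] at h; apply hb; rw [← h]; simp [hTm]
    · intro j
      by_cases h1 : j ∈ S
      · obtain ⟨i, hi⟩ := hSs j h1; exact ⟨Sum.inl (Sum.inl i), hi⟩
      by_cases h2 : j ∈ T
      · obtain ⟨i, hi⟩ := hTs j h2; exact ⟨Sum.inl (Sum.inr i), hi⟩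
      exact ⟨Sum.inr ⟨j, by simp [h1, h2]⟩, rfl⟩
  rw [← Matrix.det_submatrix_equiv_self (Equiv.ofBijective φ hφ)]
  have hblock : (labelled x y c (S ∪ T) S T).submatrix (Equiv.ofBijective φ hφ)
      (Equiv.ofBijective φ hφ) = Matrix.fromBlocks (Matrix.fromBlocks 0
        (-(Matrix.diagonal (fun i => y (eS i)) *
          cauchyMatrix (fun i => x (eS i)) (fun i => x (eT i)) *
          Matrix.diagonal (fun i => (y (eT i))⁻¹)))
        (cauchyMatrix (fun i => x (eT i)) (fun i => x (eS i))) 0) 0 0 1 := by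
    have hnST : ∀ i j, eS i ≠ eT j := fun i j h => hST (hSm i) (h ▸ hTm j)
    have h1 : ∀ i, eS i ∉ T := fun i => hST (hSm i)
    have h2 : ∀ i, eT i ∉ S := fun i h => hST h (hTm i)
    ext ((i | i) | i) ((j | j) | j)
    · simp [φ, labelled, hSm, h1]
    · simp [φ, labelled, hSm, hTm, hnST, cauchyMatrix, Matrix.diagonal_mul, Matrix.mul_diagonal]
      ring
    · have hj := j.2
      have : eS i ≠ j := fun h => hj (by rw [← h]; simp [hSm])
      simp [φ, labelled, hj, this, -Finset.mem_union]
    · simp [φ, labelled, hSm, hTm, h1, h2, (hnST _ _).symm, cauchyMatrix]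
    · simp [φ, labelled, hTm, h2]
    · have hj := j.2
      have : eT i ≠ j := fun h => hj (by rw [← h]; simp [hTm])
      simp [φ, labelled, hj, this, -Finset.mem_union]
    · have hi := i.2
      have : i ≠ eS j := fun h => hi (by rw [h]; simp [hSm])
      simp [φ, labelled, hi, this, -Finset.mem_union]
    · have hi := i.2
      have : i ≠ eT j := fun h => hi (by rw [h]; simp [hTm])
      simp [φ, labelled, hi, this, -Finset.mem_union]
    · have hi := i.2
      have hj := j.2
      simp [φ, labelled, hi, hj, Matrix.one_apply, Subtype.ext_iff, -Finset.mem_union]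
  rw [hblock, Matrix.det_fromBlocks_zero₂₁, Matrix.det_one, mul_one, det_fromBlocks_antidiagonal,
    Matrix.det_mul, Matrix.det_mul, Matrix.det_diagonal, Matrix.det_diagonal,
    Finset.prod_inv_distrib]
  have p1 : ∏ s ∈ S, y s = ∏ i, y (eS i) := by
    rw [← Finset.prod_coe_sort, ← (S.equivFinOfCardEq hS).symm.prod_comp]
  have p2 : ∏ s ∈ T, y s = ∏ i, y (eT i) := by
    rw [← Finset.prod_coe_sort, ← (T.equivFinOfCardEq hT).symm.prod_comp]
  rw [p1, p2]
  ring

theorem det_labelled_base (x y : ι → ℂ) (c : ℂ) (hx : Function.Injective x) (hx0 : ∀ j, x j ≠ 0)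
    {S T : Finset ι} (hST : Disjoint S T) (h : S.card = T.card) :
    (labelled x y c (S ∪ T) S T).det =
      ((∏ s ∈ S, y s) / ∏ t ∈ T, y t) *
      (((∏ s ∈ S, ∏ t ∈ T, x t / (x t - x s)) * ∏ s ∈ S, ∏ t ∈ T, x s / (x s - x t)) /
        ((∏ s ∈ S, ∏ s' ∈ S, (if s = s' then 1 else x s' / (x s' - x s))) *
          ∏ t ∈ T, ∏ t' ∈ T, (if t = t' then 1 else x t / (x t - x t')))) := by
  rw [det_labelled_eq_cauchy x y c hST h rfl]
  rw [det_cauchyMatrix_mul_eq]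
  · have p1 : ∀ f : ι → ℂ, ∏ s ∈ S, f s = ∏ i, f ((S.equivFinOfCardEq h).symm i) := fun f => by
      rw [← Finset.prod_coe_sort, ← (S.equivFinOfCardEq h).symm.prod_comp]
    have p2 : ∀ f : ι → ℂ, ∏ s ∈ T, f s = ∏ i, f ((T.equivFinOfCardEq rfl).symm i) := fun f => by
      rw [← Finset.prod_coe_sort, ← (T.equivFinOfCardEq rfl).symm.prod_comp]
    simp only [p1, p2, Subtype.ext_iff.symm, EmbeddingLike.apply_eq_iff_eq]
  · exact hx.comp (Subtype.val_injective.comp (Equiv.injective _))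
  · exact hx.comp (Subtype.val_injective.comp (Equiv.injective _))
  · intro i j hij
    exact Finset.disjoint_left.1 hST ((S.equivFinOfCardEq h).symm i).2
      (hx hij ▸ ((T.equivFinOfCardEq rfl).symm j).2)
  · exact fun i => hx0 _
  · exact fun i => hx0 _

end Base

/-! ### Expansion over labels and comparison of recursions. -/

section Expansion

variable {ι : Type*} [Fintype ι] [DecidableEq ι]

/-- The matrix `x_k (1 - y_j / y_k) / (x_k - x_j)` with diagonal entries `c`. -/
def difMatrix (x y : ι → ℂ) (c : ℂ) : Matrix ι ι ℂ :=
  Matrix.of fun j k => if j = k then c else x k / (x k - x j) * (1 - y j / y k)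

/-- Multilinearity is used twice: each row chooses a summand, and then each column is split
according to whether its entries lie in rows of `I`. Splitting the columns as well makes the labels
of rows and columns independent. -/
theorem det_difMatrix_eq_sum_labelled (x y : ι → ℂ) (c : ℂ) :
    (difMatrix x y c).det = ∑ I : Finset ι, ∑ J : Finset ι,
      (labelled x y c Finset.univ I J).det := by
  set A : Matrix ι ι ℂ := Matrix.of fun j k =>
    if j = k then 0 else -(y j / y k) * (x k / (x k - x j))
    with hA
  set B : Matrix ι ι ℂ := Matrix.of fun j k => if j = k then c else x k / (x k - x j) with hB
  have h1 : difMatrix x y c = A + B := by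
    ext j k
    simp only [difMatrix, hA, hB, Matrix.of_apply, Matrix.add_apply]
    split_ifs <;> ring
  have h2 := (Matrix.detRowAlternating (n := ι) (R := ℂ)).toMultilinearMap.map_add_univ A B
  have h3 : (difMatrix x y c).det = ∑ I : Finset ι, (Matrix.of (I.piecewise A B)).det := by
    rw [h1]; exact h2
  rw [h3]
  refine Finset.sum_congr rfl fun I _ => ?_
  set C : Matrix ι ι ℂ := Matrix.of fun k j => if j ∈ I then A j k else 0 with hC
  set C' : Matrix ι ι ℂ := Matrix.of fun k j => if j ∈ I then 0 else B j k with hC'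
  have h4 : Matrix.transpose (Matrix.of (I.piecewise A B)) = C + C' := by
    ext k j
    simp only [hC, hC', Matrix.transpose_apply, Matrix.of_apply, Matrix.add_apply, Finset.piecewise]
    split_ifs <;> simp
  have h5 := (Matrix.detRowAlternating (n := ι) (R := ℂ)).toMultilinearMap.map_add_univ C C'
  rw [← Matrix.det_transpose, h4]
  refine Eq.trans h5 (Finset.sum_congr rfl fun J _ => ?_)
  rw [← Matrix.det_transpose (labelled x y c Finset.univ I J)]
  refine congrArg Matrix.det ?_
  ext k j
  simp only [Finset.piecewise, labelled, hC, hC', hA, hB, Matrix.transpose_apply, Matrix.of_apply,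
    Finset.mem_univ, and_self, if_true]
  split_ifs <;> simp_all

/-- Take `S = I \ J`, `T = J \ I` and `B = I ∩ J`: two kinds of points with unequal labels, and the
points carrying the second label twice. -/
theorem sum_sum_eq_sum_disjoint {E : Type*} [AddCommMonoid E] (f : Finset ι → Finset ι → E) :
    ∑ I : Finset ι, ∑ J : Finset ι, f I J =
      ∑ S : Finset ι, ∑ T ∈ Sᶜ.powerset, ∑ B ∈ ((S ∪ T)ᶜ).powerset, f (S ∪ B) (T ∪ B) := by
  simp_rw [Finset.sum_sigma']
  refine Finset.sum_bij' (fun p _ => ⟨p.1 \ p.2, p.2 \ p.1, p.1 ∩ p.2⟩)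
    (fun p _ => ⟨p.1 ∪ p.2.2, p.2.1 ∪ p.2.2⟩) ?_ ?_ ?_ ?_ ?_
  · rintro ⟨I, J⟩ _
    simp only [Finset.mem_sigma, Finset.mem_univ, Finset.mem_powerset, true_and]
    constructor <;> intro a <;> simp <;> tauto
  · intro p _; simp
  · rintro ⟨I, J⟩ _
    simp only [Sigma.mk.injEq, heq_eq_eq]
    constructor <;> ext a <;> simp <;> tauto
  · rintro ⟨S, T, B⟩ h
    simp only [Finset.mem_sigma, Finset.mem_univ, Finset.mem_powerset, true_and] at h
    have h1 : ∀ a ∈ T, a ∉ S := fun a ha => by simpa using h.1 ha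
    have h2 : ∀ a ∈ B, a ∉ S ∧ a ∉ T := fun a ha => by simpa using h.2 ha
    simp only [Sigma.mk.injEq, heq_eq_eq]
    refine ⟨?_, ?_, ?_⟩ <;> ext a <;> simp only [Finset.mem_sdiff, Finset.mem_union,
      Finset.mem_inter] <;> grind
  · rintro ⟨I, J⟩ _
    simp only
    congr 1 <;> ext a <;> simp <;> tauto

theorem det_difMatrix_eq_sum_labelledSum (x y : ι → ℂ) (c : ℂ) :
    (difMatrix x y c).det = ∑ S : Finset ι, ∑ T ∈ Sᶜ.powerset,
      labelledSum x y c S T (S ∪ T)ᶜ := by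
  rw [det_difMatrix_eq_sum_labelled, sum_sum_eq_sum_disjoint]
  refine Finset.sum_congr rfl fun S _ => Finset.sum_congr rfl fun T _ => ?_
  rw [labelledSum, Finset.union_compl]

omit [Fintype ι] in
/-- Two functions of a finite set with the same two-step recursion are proportional. -/
theorem eq_mul_of_recursion (D W : Finset ι → ℂ) (h : ι → ℂ) (w : ι → ι → ℂ) (R₀ : Finset ι)
    (hD : ∀ R r, insert r R ⊆ R₀ → r ∉ R →
      D (insert r R) = h r * D R + ∑ k ∈ R, w r k * D (R.erase k))
    (hW : ∀ R r, insert r R ⊆ R₀ → r ∉ R →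
      W (insert r R) = h r * W R + ∑ k ∈ R, w r k * W (R.erase k))
    (hW0 : W ∅ = 1) : ∀ R ⊆ R₀, D R = D ∅ * W R := by
  intro R
  induction R using Finset.strongInduction with
  | H R ih =>
    intro hR
    rcases R.eq_empty_or_nonempty with rfl | ⟨r, hr⟩
    · rw [hW0, mul_one]
    · obtain ⟨R', hr', rfl⟩ : ∃ R', r ∉ R' ∧ insert r R' = R :=
        ⟨R.erase r, Finset.notMem_erase r R, Finset.insert_erase hr⟩
      have hR' : R' ⊆ insert r R' := Finset.subset_insert r R'
      rw [hD R' r hR hr', hW R' r hR hr', ih R' (Finset.ssubset_insert hr') (hR'.trans hR), mul_add,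
        Finset.mul_sum]
      congr 1
      · ring
      · refine Finset.sum_congr rfl fun k _ => ?_
        rw [ih (R'.erase k) ((Finset.erase_subset k R').trans_ssubset (Finset.ssubset_insert hr'))
          ((Finset.erase_subset k R').trans (hR'.trans hR))]
        ring

end Expansion

/-! ### Closed forms of the derivatives of `z`. -/

section SpecialFunctions

theorem hasDerivAt_z {x : ℂ} (hx : Complex.exp (-x) ≠ 1) :
    HasDerivAt z (-Complex.exp (-x) / (1 - Complex.exp (-x)) ^ 2) x := by
  have h1 : HasDerivAt (fun x : ℂ => 1 - Complex.exp (-x)) (Complex.exp (-x)) x := by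
    have := ((hasDerivAt_neg x).cexp).const_sub 1
    simpa using this
  have h2 := h1.inv (sub_ne_zero.2 hx.symm)
  refine h2.congr_of_eventuallyEq (Filter.Eventually.of_forall fun t => ?_)
  simp [z]

theorem zLog_eq {x : ℂ} (hx : Complex.exp x ≠ 1) : zLog x = 1 / (1 - Complex.exp x) := by
  have hx' : Complex.exp (-x) ≠ 1 := by
    rw [Complex.exp_neg]; intro h; exact hx (inv_eq_one.1 h)
  rw [zLog, logDeriv_apply, (hasDerivAt_z hx').deriv, z]
  have h1 : 1 - Complex.exp (-x) ≠ 0 := sub_ne_zero.2 hx'.symm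
  have h2 : 1 - Complex.exp x ≠ 0 := sub_ne_zero.2 hx.symm
  have h3 : Complex.exp x * Complex.exp (-x) = 1 := by rw [← Complex.exp_add]; simp
  field_simp
  linear_combination h3

theorem zLog'_eq {x : ℂ} (hx : Complex.exp x ≠ 1) :
    zLog' x = Complex.exp x / (1 - Complex.exp x) ^ 2 := by
  have hev : zLog =ᶠ[nhds x] fun t => (1 - Complex.exp t)⁻¹ := by
    have : ∀ᶠ t in nhds x, Complex.exp t ≠ 1 :=
      Complex.continuous_exp.continuousAt.eventually_ne hx
    filter_upwards [this] with t ht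
    rw [zLog_eq ht, one_div]
  rw [zLog', hev.deriv_eq]
  have h1 : HasDerivAt (fun x : ℂ => 1 - Complex.exp x) (-Complex.exp x) x := by
    simpa using (Complex.hasDerivAt_exp x).const_sub 1
  have h2 := h1.inv (sub_ne_zero.2 hx.symm)
  exact h2.deriv.trans (by rw [neg_neg])

end SpecialFunctions

/-! ### Values of `HST` on small blocks. -/

section HST

theorem toLeft_singleton_inl {ι κ : Type*} (i : ι) :
    ({Sum.inl i} : Finset (ι ⊕ κ)).toLeft = {i} := by
  ext; simp

theorem toRight_singleton_inl {ι κ : Type*} (i : ι) :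
    ({Sum.inl i} : Finset (ι ⊕ κ)).toRight = ∅ := by
  ext; simp

theorem toLeft_singleton_inr {ι κ : Type*} (i : κ) :
    ({Sum.inr i} : Finset (ι ⊕ κ)).toLeft = ∅ := by
  ext; simp

theorem toRight_singleton_inr {ι κ : Type*} (i : κ) :
    ({Sum.inr i} : Finset (ι ⊕ κ)).toRight = {i} := by
  ext; simp

variable {ι : Type*} [Fintype ι] [DecidableEq ι] (α β : ι → ℂ) (S T : Finset ι)

omit [Fintype ι] [DecidableEq ι] in
theorem HST_inl (i : ι) : HST α β S T {Sum.inl i} =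
    ∑ s ∈ S, zLog (α i - α s) - ∑ t ∈ T, zLog (α i + β t) := by
  simp [HST, toLeft_singleton_inl, toRight_singleton_inl]

omit [Fintype ι] [DecidableEq ι] in
theorem HST_inr (i : ι) : HST α β S T {Sum.inr i} =
    ∑ t ∈ T, zLog (β i - β t) - ∑ s ∈ S, zLog (β i + α s) := by
  simp [HST, toLeft_singleton_inr, toRight_singleton_inr]

omit [Fintype ι] in
theorem HST_inl_inr (i j : ι) : HST α β S T {Sum.inl i, Sum.inr j} = zLog' (α i + β j) := by
  simp [HST, toLeft_singleton_inr, toRight_singleton_inr]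

omit [Fintype ι] in
theorem HST_inl_inl {i j : ι} (h : i ≠ j) : HST α β S T {Sum.inl i, Sum.inl j} = 0 := by
  simp [HST, Finset.card_pair h, toLeft_singleton_inl, toRight_singleton_inl]

omit [Fintype ι] in
theorem HST_inr_inr {i j : ι} (h : i ≠ j) : HST α β S T {Sum.inr i, Sum.inr j} = 0 := by
  simp [HST, Finset.card_pair h, toLeft_singleton_inr, toRight_singleton_inr]

omit [Fintype ι] [DecidableEq ι] in
theorem HST_of_two_lt_card {U : Finset (ι ⊕ ι)} (h : 2 < U.card) : HST α β S T U = 0 := by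
  have := Finset.card_toLeft_add_card_toRight (u := U)
  unfold HST
  rw [if_neg (by omega), if_neg (by omega), if_neg (by omega)]

theorem sum_filter_finpartition_HST (V : Finset (ι ⊕ ι)) :
    ∑ P : Finpartition V with ∀ U ∈ P.parts, U.card ≤ 2, ∏ U ∈ P.parts, HST α β S T U =
      partitionSum (HST α β S T) V := by
  rw [partitionSum, Finset.sum_filter]
  refine Finset.sum_congr rfl fun P _ => ?_
  split_ifs with h
  · rfl
  · push Not at h
    obtain ⟨U, hU, hU2⟩ := h
    rw [Finset.prod_eq_zero hU (HST_of_two_lt_card α β S T hU2)]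

end HST

/-! ### Summing over `S` and `T` first. -/

section Reorder

variable {ι : Type*} [Fintype ι] [DecidableEq ι]

/-- Once `S` and `T` are chosen, the remainders of `K` and `L` form an arbitrary disjoint pair in
the complement. This isolates the inner sum to which the recursion applies. -/
theorem sum_disjoint_eq_sum_disjoint (f : Finset ι → Finset ι → Finset ι → Finset ι → ℂ) :
    ∑ K : Finset ι, ∑ L ∈ Kᶜ.powerset, ∑ S ∈ K.powerset,
      ∑ T ∈ L.powerset.filter (fun T => S.card = T.card), f S T (K \ S) (L \ T) =
    ∑ S : Finset ι, ∑ T ∈ Sᶜ.powerset.filter (fun T => S.card = T.card),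
      ∑ K ∈ (S ∪ T)ᶜ.powerset, ∑ L ∈ ((S ∪ T)ᶜ \ K).powerset, f S T K L := by
  simp_rw [Finset.sum_sigma']
  refine Finset.sum_bij'
    (fun p _ => ⟨p.2.2.1, p.2.2.2, p.1 \ p.2.2.1, p.2.1 \ p.2.2.2⟩)
    (fun p _ => ⟨p.1 ∪ p.2.2.1, p.2.1 ∪ p.2.2.2, p.1, p.2.1⟩) ?_ ?_ ?_ ?_ ?_
  · rintro ⟨K, L, S, T⟩ h
    simp only [Finset.mem_sigma, Finset.mem_univ, Finset.mem_powerset, true_and,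
      Finset.mem_filter, Finset.subset_iff, Finset.mem_compl, Finset.mem_sdiff,
      Finset.mem_union] at h ⊢
    refine ⟨⟨?_, h.2.2.2⟩, ?_, ?_⟩ <;> grind
  · rintro ⟨S, T, K, L⟩ h
    simp only [Finset.mem_sigma, Finset.mem_univ, Finset.mem_powerset, true_and,
      Finset.mem_filter, Finset.subset_iff, Finset.mem_compl, Finset.mem_sdiff,
      Finset.mem_union] at h ⊢
    refine ⟨?_, ?_, ?_, h.1.2⟩ <;> grind
  · rintro ⟨K, L, S, T⟩ h
    simp only [Finset.mem_sigma, Finset.mem_univ, Finset.mem_powerset, true_and,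
      Finset.mem_filter] at h
    simp only [Finset.union_sdiff_of_subset h.2.1, Finset.union_sdiff_of_subset h.2.2.1]
  · rintro ⟨S, T, K, L⟩ h
    simp only [Finset.mem_sigma, Finset.mem_univ, Finset.mem_powerset, true_and,
      Finset.mem_filter, Finset.subset_iff, Finset.mem_compl, Finset.mem_sdiff,
      Finset.mem_union] at h
    simp only [Sigma.mk.injEq, heq_eq_eq, true_and]
    constructor <;> ext a <;> simp only [Finset.mem_sdiff, Finset.mem_union] <;> grind
  · rintro ⟨K, L, S, T⟩ h
    rfl

end Reorder

/-! ### The combinatorial sum as a determinant. -/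

section Correlation

variable {n : ℕ} (N : ℕ) (θ : Fin n → ℂ)

theorem correlationSum_eq_sum_splitSum :
    correlationSum N n θ = ∑ S : Finset (Fin n),
      ∑ T ∈ Sᶜ.powerset.filter (fun T => S.card = T.card),
        QST N (fun k => -(Complex.I * θ k)) (fun l => Complex.I * θ l) S T *
          splitSum N (HST (fun k => -(Complex.I * θ k)) (fun l => Complex.I * θ l) S T)
            (S ∪ T)ᶜ := by
  have := sum_disjoint_eq_sum_disjoint fun S T K L =>
    QST N (fun k => -(Complex.I * θ k)) (fun l => Complex.I * θ l) S T *
      ((N : ℂ) ^ (((S ∪ T)ᶜ \ K) \ L).card *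
        partitionSum (HST (fun k => -(Complex.I * θ k)) (fun l => Complex.I * θ l) S T)
          (K.disjSum L))
  simp only [splitSum, Finset.mul_sum]
  refine Eq.trans ?_ this
  unfold correlationSum JStar
  simp only [sum_filter_finpartition_HST, Finset.mul_sum]
  refine Finset.sum_congr rfl fun K _ => Finset.sum_congr rfl fun L _ =>
    Finset.sum_congr rfl fun S hS => Finset.sum_congr rfl fun T hT => ?_
  have hS := Finset.mem_powerset.1 hS
  have hT := Finset.mem_powerset.1 (Finset.mem_filter.1 hT).1
  have : ((S ∪ T)ᶜ \ (K \ S)) \ (L \ T) = (K ∪ L)ᶜ := by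
    ext a
    have h1 := @hS a
    have h2 := @hT a
    simp only [Finset.mem_sdiff, Finset.mem_compl, Finset.mem_union]
    tauto
  rw [this]
  ring

variable (hθ : ∀ j k, j ≠ k → ∀ m : ℤ, θ j - θ k ≠ 2 * (Real.pi : ℂ) * (m : ℂ))

include hθ in
theorem exp_injective_of_separated : Function.Injective fun j => Complex.exp (Complex.I * θ j) := by
  intro j k h
  by_contra hjk
  obtain ⟨m, hm⟩ := Complex.exp_eq_exp_iff_exists_int.1 h
  apply hθ j k hjk m
  apply mul_left_cancel₀ Complex.I_ne_zero
  linear_combination hm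

include hθ in
theorem zLog_sub {j k : Fin n} (h : j ≠ k) :
    zLog (Complex.I * θ j - Complex.I * θ k) = Complex.exp (Complex.I * θ k) /
      (Complex.exp (Complex.I * θ k) - Complex.exp (Complex.I * θ j)) := by
  have hne : Complex.exp (Complex.I * θ j) ≠ Complex.exp (Complex.I * θ k) := fun h' =>
    h (exp_injective_of_separated θ hθ h')
  have h0 := Complex.exp_ne_zero (Complex.I * θ k)
  have h1 : Complex.exp (Complex.I * θ k) - Complex.exp (Complex.I * θ j) ≠ 0 :=
    sub_ne_zero.2 hne.symm
  rw [zLog_eq, Complex.exp_sub]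
  · rw [one_sub_div h0, one_div_div]
  · rw [Complex.exp_sub, Ne, div_eq_one_iff_eq h0]; exact hne

include hθ in
theorem zLog'_sub {j k : Fin n} (h : j ≠ k) :
    zLog' (Complex.I * θ j - Complex.I * θ k) =
      pairWeight (fun j => Complex.exp (Complex.I * θ j)) j k := by
  have hne : Complex.exp (Complex.I * θ j) ≠ Complex.exp (Complex.I * θ k) := fun h' =>
    h (exp_injective_of_separated θ hθ h')
  have h0 := Complex.exp_ne_zero (Complex.I * θ k)
  have h1 : Complex.exp (Complex.I * θ k) - Complex.exp (Complex.I * θ j) ≠ 0 :=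
    sub_ne_zero.2 hne.symm
  have h2 : Complex.exp (Complex.I * θ j) - Complex.exp (Complex.I * θ k) ≠ 0 :=
    sub_ne_zero.2 hne
  rw [zLog'_eq, Complex.exp_sub, pairWeight]
  · rw [one_sub_div h0]
    field_simp
    ring
  · rw [Complex.exp_sub, Ne, div_eq_one_iff_eq h0]; exact hne

theorem z_sub (j k : Fin n) :
    z (Complex.I * θ j - Complex.I * θ k) = Complex.exp (Complex.I * θ j) /
      (Complex.exp (Complex.I * θ j) - Complex.exp (Complex.I * θ k)) := by
  have h0 := Complex.exp_ne_zero (Complex.I * θ j)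
  rw [z, neg_sub, Complex.exp_sub, one_sub_div h0, one_div_div]

include hθ in
theorem QST_eq (S T : Finset (Fin n)) :
    QST N (fun k => -(Complex.I * θ k)) (fun l => Complex.I * θ l) S T =
      (let x := fun j => Complex.exp (Complex.I * θ j)
      ((∏ s ∈ S, x s ^ N) / ∏ t ∈ T, x t ^ N) *
      (((∏ s ∈ S, ∏ t ∈ T, x t / (x t - x s)) * ∏ s ∈ S, ∏ t ∈ T, x s / (x s - x t)) /
        ((∏ s ∈ S, ∏ s' ∈ S, (if s = s' then 1 else x s' / (x s' - x s))) *
          ∏ t ∈ T, ∏ t' ∈ T, (if t = t' then 1 else x t / (x t - x t'))))) := by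
  have hinj := exp_injective_of_separated θ hθ
  unfold QST Zprod Zdagger
  simp only [Pi.neg_apply]
  congr 1
  · simp only [← Complex.exp_nat_mul, ← Complex.exp_sum, ← Complex.exp_sub]
    congr 1
    simp only [← Finset.mul_sum, Finset.sum_neg_distrib]
    ring
  · congr 1
    · congr 1
      · refine Finset.prod_congr rfl fun s hs => Finset.prod_congr rfl fun t ht => ?_
        rw [← z_sub θ t s]
        congr 1; ring
      · refine Finset.prod_congr rfl fun s hs => Finset.prod_congr rfl fun t ht => ?_
        rw [← z_sub θ s t]
        congr 1; ring
    · have hzero : ∀ s t, s ≠ t → Complex.I * θ s - Complex.I * θ t ≠ 0 := by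
        intro s t h h0
        exact h (hinj (by simp only [sub_eq_zero.1 h0]))
      congr 1
      · refine Finset.prod_congr rfl fun s hs => Finset.prod_congr rfl fun t ht => ?_
        have e : -(Complex.I * θ s) + - -(Complex.I * θ t) = Complex.I * θ t - Complex.I * θ s := by
          ring
        rw [e]
        by_cases h : s = t
        · subst h; simp
        · rw [if_neg h, if_neg (hzero t s (Ne.symm h)), z_sub θ t s]
      · refine Finset.prod_congr rfl fun s hs => Finset.prod_congr rfl fun t ht => ?_
        have e : Complex.I * θ s + -(Complex.I * θ t) = Complex.I * θ s - Complex.I * θ t := by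
          ring
        rw [e]
        by_cases h : s = t
        · subst h; simp
        · rw [if_neg h, if_neg (hzero s t h), z_sub θ s t]

include hθ in
theorem correlationSum_eq_det_difMatrix :
    correlationSum N n θ = (difMatrix (fun j => Complex.exp (Complex.I * θ j))
      (fun j => Complex.exp (Complex.I * θ j) ^ N) N).det := by
  set x : Fin n → ℂ := fun j => Complex.exp (Complex.I * θ j) with hxdef
  have hx : Function.Injective x := exp_injective_of_separated θ hθ
  have hx0 : ∀ j, x j ≠ 0 := fun j => Complex.exp_ne_zero _
  have hy : ∀ j, x j ^ N ≠ 0 := fun j => pow_ne_zero _ (hx0 j)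
  rw [correlationSum_eq_sum_splitSum, det_difMatrix_eq_sum_labelledSum]
  refine Finset.sum_congr rfl fun S _ => ?_
  rw [Finset.sum_filter]
  refine Finset.sum_congr rfl fun T hT => ?_
  have hST : Disjoint S T := Finset.disjoint_right.2 fun a ha =>
    Finset.mem_compl.1 (Finset.mem_powerset.1 hT ha)
  -- The two singleton values of `r`, one in each copy, add up to twice the interaction (`e1` and
  -- `e2` below), and the value of `HST` on a mixed pair is the pair weight.
  have hrec := eq_mul_of_recursion (labelledSum x (fun j => x j ^ N) N S T)
    (splitSum N (HST (fun k => -(Complex.I * θ k)) (fun l => Complex.I * θ l) S T))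
    (fun r => N + 2 * (∑ s ∈ S, interaction x r s - ∑ t ∈ T, interaction x r t))
    (fun r k => 2 * pairWeight x r k) (S ∪ T)ᶜ ?_ ?_ (splitSum_empty _ _) (S ∪ T)ᶜ le_rfl
  · rw [hrec, labelledSum]
    simp only [Finset.powerset_empty, Finset.sum_singleton, Finset.union_empty]
    split_ifs with hc
    · rw [det_labelled_base x _ _ hx hx0 hST hc, QST_eq N θ hθ]
    · rw [det_labelled_of_card_ne _ _ _ hST hc, zero_mul]
  · intro R r hR hr
    have hd : Disjoint (S ∪ T) (insert r R) := Finset.disjoint_right.2 fun a ha =>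
      Finset.mem_compl.1 (hR ha)
    rw [Finset.disjoint_union_left, Finset.disjoint_insert_right,
      Finset.disjoint_insert_right] at hd
    exact labelledSum_insert x _ _ hx hy hST hd.1.2 hd.2.2 hd.1.1 hd.2.1 hr
  · intro R r hR hr
    have hd : Disjoint (S ∪ T) (insert r R) := Finset.disjoint_right.2 fun a ha =>
      Finset.mem_compl.1 (hR ha)
    rw [Finset.disjoint_union_left, Finset.disjoint_insert_right,
      Finset.disjoint_insert_right] at hd
    have hrS : ∀ s ∈ S, s ≠ r := fun s hs h => hd.1.1 (h ▸ hs)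
    have hrT : ∀ s ∈ T, s ≠ r := fun s hs h => hd.2.1 (h ▸ hs)
    rw [splitSum_insert (N : ℂ) _ (fun i j => pairWeight x i j)
      (fun U hU => HST_of_two_lt_card _ _ _ _ hU) (fun i j h => HST_inl_inl _ _ _ _ h)
      (fun i j h => HST_inr_inr _ _ _ _ h) ?_ ?_ hr]
    · congr 3
      rw [HST_inl, HST_inr, mul_sub, Finset.mul_sum, Finset.mul_sum]
      have e1 : ∑ s ∈ S, zLog (-(Complex.I * θ r) - -(Complex.I * θ s)) -
          ∑ s ∈ S, zLog (Complex.I * θ r + -(Complex.I * θ s)) =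
          ∑ s ∈ S, 2 * interaction x r s := by
        rw [← Finset.sum_sub_distrib]
        refine Finset.sum_congr rfl fun s hs => ?_
        have h1 : x r - x s ≠ 0 := sub_ne_zero.2 fun h => hrS s hs (hx h).symm
        have h2 : x s - x r ≠ 0 := sub_ne_zero.2 fun h => hrS s hs (hx h)
        rw [show -(Complex.I * θ r) - -(Complex.I * θ s) =
            Complex.I * θ s - Complex.I * θ r by ring,
          show Complex.I * θ r + -(Complex.I * θ s) = Complex.I * θ r - Complex.I * θ s by ring,
          zLog_sub θ hθ (hrS s hs), zLog_sub θ hθ (hrS s hs).symm, interaction]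
        change x r / (x r - x s) - x s / (x s - x r) = _
        field_simp
        ring
      have e2 : ∑ t ∈ T, zLog (Complex.I * θ r - Complex.I * θ t) -
          ∑ t ∈ T, zLog (-(Complex.I * θ r) + Complex.I * θ t) =
          -∑ t ∈ T, 2 * interaction x r t := by
        rw [← Finset.sum_sub_distrib, ← Finset.sum_neg_distrib]
        refine Finset.sum_congr rfl fun s hs => ?_
        have h1 : x r - x s ≠ 0 := sub_ne_zero.2 fun h => hrT s hs (hx h).symm
        have h2 : x s - x r ≠ 0 := sub_ne_zero.2 fun h => hrT s hs (hx h)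
        rw [show -(Complex.I * θ r) + Complex.I * θ s = Complex.I * θ s - Complex.I * θ r by ring,
          zLog_sub θ hθ (hrT s hs), zLog_sub θ hθ (hrT s hs).symm, interaction]
        change x s / (x s - x r) - x r / (x r - x s) = _
        field_simp
        ring
      linear_combination e1 + e2
    · intro i j h
      rw [HST_inl_inr, show -(Complex.I * θ i) + Complex.I * θ j =
        Complex.I * θ j - Complex.I * θ i by ring, zLog'_sub θ hθ h.symm]
      simp only [pairWeight]
      ring
    · intro i j
      simp only [pairWeight]
      ring

end Correlation

/-! ### Oriented sums over integer intervals. -/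

section SignedSum

variable {M M' : Type*} [AddCommGroup M] [AddCommGroup M']

/-- The sum of `f` over `0 < m ≤ k`, or minus the sum over `k < m ≤ 0`. -/
def signedSum (k : ℤ) (f : ℤ → M) : M :=
  ∑ m ∈ Finset.Ioc 0 k, f m - ∑ m ∈ Finset.Ioc k 0, f m

theorem signedSum_zero (f : ℤ → M) : signedSum 0 f = 0 := by simp [signedSum]

theorem signedSum_add_one (k : ℤ) (f : ℤ → M) :
    signedSum (k + 1) f = signedSum k f + f (k + 1) := by
  unfold signedSum
  rcases le_or_gt 0 k with h | h
  · have h1 : Finset.Ioc 0 (k + 1) = insert (k + 1) (Finset.Ioc 0 k) := by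
      ext a; simp only [Finset.mem_Ioc, Finset.mem_insert]; omega
    have h2 : Finset.Ioc (k + 1) 0 = ∅ := Finset.Ioc_eq_empty (by omega)
    have h3 : Finset.Ioc k 0 = ∅ := Finset.Ioc_eq_empty (by omega)
    rw [h1, h2, h3, Finset.sum_insert (by simp)]
    simp [add_comm]
  · have h1 : Finset.Ioc k 0 = insert (k + 1) (Finset.Ioc (k + 1) 0) := by
      ext a; simp only [Finset.mem_Ioc, Finset.mem_insert]; omega
    have h2 : Finset.Ioc 0 (k + 1) = ∅ := Finset.Ioc_eq_empty (by omega)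
    have h3 : Finset.Ioc 0 k = ∅ := Finset.Ioc_eq_empty (by omega)
    rw [h1, h2, h3, Finset.sum_insert (by simp)]
    simp

theorem signedSum_sub_one (k : ℤ) (f : ℤ → M) :
    signedSum (k - 1) f = signedSum k f - f k := by
  have := signedSum_add_one (k - 1) f
  rw [sub_add_cancel] at this
  rw [this, add_sub_cancel_right]

theorem map_signedSum {F : Type*} [FunLike F M M'] [AddMonoidHomClass F M M'] (φ : F) (k : ℤ)
    (f : ℤ → M) : φ (signedSum k f) = signedSum k fun m => φ (f m) := by
  simp [signedSum, map_sub, map_sum]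

theorem signedSum_sum {α : Type*} (s : Finset α) (k : ℤ) (f : α → ℤ → M) :
    signedSum k (fun m => ∑ a ∈ s, f a m) = ∑ a ∈ s, signedSum k (f a) := by
  simp only [signedSum, Finset.sum_sub_distrib]
  rw [Finset.sum_comm, Finset.sum_comm (s := Finset.Ioc k 0)]

theorem signedSum_congr {k : ℤ} {f g : ℤ → M} (h : ∀ m, f m = g m) :
    signedSum k f = signedSum k g := by
  rw [funext h]

theorem signedSum_const {R : Type*} [CommRing R] (k : ℤ) (c : R) :
    signedSum k (fun _ => c) = k * c := by
  induction k using Int.induction_on with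
  | zero => simp [signedSum_zero]
  | succ n ih => rw [signedSum_add_one, ih]; push_cast; ring
  | pred n ih => rw [signedSum_sub_one, ih]; push_cast; ring

/-- The telescoping geometric sum; the orientation convention makes one formula serve exponents of
both signs. -/
theorem signedSum_zpow {K : Type*} [Field K] {a b : K} (ha : a ≠ 0) (hb : b ≠ 0) (k : ℤ) :
    (a - b) * signedSum k (fun m => a ^ m * b ^ (k - m)) = a * (a ^ k - b ^ k) := by
  have step : ∀ k : ℤ, signedSum k (fun m => a ^ m * b ^ (k - m)) =
      b ^ k * signedSum k fun m => a ^ m * b ^ (-m) := by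
    intro k
    rw [← smul_eq_mul, ← DistribSMul.toAddMonoidHom_apply, map_signedSum]
    refine signedSum_congr fun m => ?_
    rw [DistribSMul.toAddMonoidHom_apply, smul_eq_mul, sub_eq_add_neg, zpow_add₀ hb]
    ring
  rw [step]
  induction k using Int.induction_on with
  | zero => simp [signedSum_zero]
  | succ n ih =>
    rw [signedSum_add_one]
    have e : b ^ ((n : ℤ) + 1) * b ^ (-((n : ℤ) + 1)) = 1 := by
      rw [← zpow_add₀ hb]; simp
    have e2 : b ^ ((n : ℤ) + 1) = b ^ (n : ℤ) * b := zpow_add_one₀ hb _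
    have e3 : a ^ ((n : ℤ) + 1) = a ^ (n : ℤ) * a := zpow_add_one₀ ha _
    rw [e2] at e ⊢
    rw [e3]
    linear_combination b * ih + (a - b) * a ^ (n : ℤ) * a * e
  | pred n ih =>
    rw [signedSum_sub_one]
    have e : b ^ (-(n : ℤ)) * b ^ (-(-(n : ℤ))) = 1 := by
      rw [← zpow_add₀ hb]; simp
    have e2 : b ^ (-(n : ℤ)) = b ^ (-(n : ℤ) - 1) * b := by
      rw [← zpow_add_one₀ hb]; simp
    have e3 : a ^ (-(n : ℤ)) = a ^ (-(n : ℤ) - 1) * a := by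
      rw [← zpow_add_one₀ ha]; simp
    apply mul_left_cancel₀ hb
    rw [e2] at e ih
    rw [e3] at ih ⊢
    linear_combination ih - (a - b) * a ^ (-(n : ℤ) - 1) * a * e

end SignedSum

/-! ### Loop expressions in an abstract sequence of power sums. -/

section LoopExpressions

variable {A : Type*} [CommRing A] {α : Type*} [DecidableEq α]

/-- The first order Schwinger–Dyson expression for `p k ∏ p (κ a)`. -/
def sdExpr (p : ℤ → A) (k : ℤ) (s : Finset α) (κ : α → ℤ) : A :=
  signedSum k (fun m => p m * p (k - m)) * ∏ a ∈ s, p (κ a) +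
    ∑ a ∈ s, (κ a : A) * p (k + κ a) * ∏ b ∈ s.erase a, p (κ b)

/-- The image of `∏ p (κ a)` under the radial part of the Laplacian. -/
def loopExpr (p : ℤ → A) (s : Finset α) (κ : α → ℤ) : A :=
  ∑ a ∈ s, (κ a : A) * sdExpr p (κ a) (s.erase a) κ

theorem map_sdExpr {B : Type*} [CommRing B] (φ : A →+* B) (p : ℤ → A) (k : ℤ) (s : Finset α)
    (κ : α → ℤ) : φ (sdExpr p k s κ) = sdExpr (fun m => φ (p m)) k s κ := by
  simp [sdExpr, map_signedSum, map_sum, map_prod]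

theorem map_loopExpr {B : Type*} [CommRing B] (φ : A →+* B) (p : ℤ → A) (s : Finset α)
    (κ : α → ℤ) : φ (loopExpr p s κ) = loopExpr (fun m => φ (p m)) s κ := by
  simp [loopExpr, map_sdExpr, map_sum]

end LoopExpressions

/-! ### The Vandermonde drift in terms of power sums. -/

section PowerSums

/-- The convolution of power sums is a sum of divided differences by `signedSum_zpow`, and its
diagonal terms are the subtracted `k * ∑ i, ζ i ^ k`. Exchanging `i` and `l` moves every power onto
`ζ i`, which leaves `(ζ i + ζ l) / (ζ i - ζ l)`, that is, `2 ζ i / (ζ i - ζ l) - 1`. -/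
theorem sum_logDeriv_eq_signedSum {K : Type*} [Field K] {N : ℕ} (ζ : Fin N → K)
    (hζ : Function.Injective ζ) (h0 : ∀ i, ζ i ≠ 0) (k : ℤ) :
    ∑ i, (2 * ∑ l ∈ Finset.univ.erase i, ζ i / (ζ i - ζ l) - ((N : K) - 1)) * ζ i ^ k =
      signedSum k (fun m => (∑ i, ζ i ^ m) * ∑ l, ζ l ^ (k - m)) - k * ∑ i, ζ i ^ k := by
  have hne : ∀ i l, l ≠ i → ζ i - ζ l ≠ 0 := fun i l h => sub_ne_zero.2 fun h' => h (hζ h').symm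
  have h1 : signedSum k (fun m => (∑ i, ζ i ^ m) * ∑ l, ζ l ^ (k - m)) =
      ∑ i, (k * ζ i ^ k + ∑ l ∈ Finset.univ.erase i, ζ i * (ζ i ^ k - ζ l ^ k) / (ζ i - ζ l)) := by
    have : ∀ m, (∑ i, ζ i ^ m) * ∑ l, ζ l ^ (k - m) = ∑ i, ∑ l, ζ i ^ m * ζ l ^ (k - m) := fun m =>
      Finset.sum_mul_sum _ _ _ _
    rw [signedSum_congr this, signedSum_sum]
    refine Finset.sum_congr rfl fun i _ => ?_
    rw [signedSum_sum, ← Finset.add_sum_erase _ _ (Finset.mem_univ i)]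
    congr 1
    · rw [← signedSum_const]
      refine signedSum_congr fun m => ?_
      rw [← zpow_add₀ (h0 i)]; simp
    · refine Finset.sum_congr rfl fun l hl => ?_
      rw [eq_div_iff (hne i l (Finset.mem_erase.1 hl).1), mul_comm, signedSum_zpow (h0 i) (h0 l)]
  rw [h1, Finset.sum_add_distrib, Finset.mul_sum, add_sub_cancel_left]
  have hswap : ∑ i, ∑ l ∈ Finset.univ.erase i, ζ i * ζ l ^ k / (ζ i - ζ l) =
      -∑ i, ∑ l ∈ Finset.univ.erase i, ζ l * ζ i ^ k / (ζ i - ζ l) := by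
    rw [Finset.sum_comm' (t' := Finset.univ) (s' := fun l => Finset.univ.erase l) (by
      intro i l; simp [eq_comm]), ← Finset.sum_neg_distrib]
    refine Finset.sum_congr rfl fun i _ => ?_
    rw [← Finset.sum_neg_distrib]
    refine Finset.sum_congr rfl fun l _ => ?_
    rw [← neg_sub (ζ i) (ζ l), div_neg]
  have h2 : ∑ i, ∑ l ∈ Finset.univ.erase i, ζ i * (ζ i ^ k - ζ l ^ k) / (ζ i - ζ l) =
      ∑ i, ∑ l ∈ Finset.univ.erase i, (ζ i * ζ i ^ k / (ζ i - ζ l) +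
        ζ l * ζ i ^ k / (ζ i - ζ l)) := by
    simp only [mul_sub, sub_div, Finset.sum_sub_distrib, Finset.sum_add_distrib]
    rw [hswap, sub_neg_eq_add]
  rw [h2]
  refine Finset.sum_congr rfl fun i _ => ?_
  have hcard : ((N : K) - 1) = ∑ l ∈ Finset.univ.erase i, (1 : K) := by
    rw [Finset.sum_const, Finset.card_erase_of_mem (Finset.mem_univ i), Finset.card_univ,
      Fintype.card_fin, nsmul_eq_mul, mul_one, Nat.cast_sub (by have := i.2; omega), Nat.cast_one]
  rw [hcard, Finset.mul_sum, ← Finset.sum_sub_distrib, Finset.sum_mul]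
  refine Finset.sum_congr rfl fun l hl => ?_
  have := hne i l (Finset.mem_erase.1 hl).1
  field_simp
  ring

end PowerSums

/-! ### Laurent polynomials and Euler derivations. -/

section Laurent

/-- Laurent polynomials in `N` variables. -/
abbrev Laurent (N : ℕ) : Type := AddMonoidAlgebra ℂ (Fin N → ℤ)

variable {N : ℕ}

/-- The linear operator multiplying the monomial with exponent `m` by `w m`. -/
def diagOp (w : (Fin N → ℤ) → ℂ) : Laurent N →ₗ[ℂ] Laurent N where
  toFun x := AddMonoidAlgebra.ofCoeff (x.coeff.sum fun m r => Finsupp.single m (w m * r))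
  map_add' x y := by
    ext m
    simp only [AddMonoidAlgebra.coeff_add]
    rw [Finsupp.sum_add_index' (by simp) (by intros; simp [mul_add])]
  map_smul' c x := by
    ext m
    simp only [AddMonoidAlgebra.coeff_smul]
    rw [Finsupp.sum_smul_index (by simp)]
    simp [Finsupp.sum, mul_left_comm, Finsupp.single_apply]

theorem diagOp_single (w : (Fin N → ℤ) → ℂ) (m : Fin N → ℤ) (r : ℂ) :
    diagOp w (AddMonoidAlgebra.single m r) = AddMonoidAlgebra.single m (w m * r) := by
  exact congrArg AddMonoidAlgebra.ofCoeff (Finsupp.sum_single_index (by simp))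

theorem diagOp_coeff (w : (Fin N → ℤ) → ℂ) (x : Laurent N) (m : Fin N → ℤ) :
    (diagOp w x).coeff m = w m * x.coeff m := by
  induction x using AddMonoidAlgebra.induction_linear with
  | zero => simp
  | add x y hx hy => simp only [map_add, AddMonoidAlgebra.coeff_add, Finsupp.add_apply, hx, hy,
      mul_add]
  | single a r =>
    rw [diagOp_single, AddMonoidAlgebra.coeff_single, AddMonoidAlgebra.coeff_single]
    by_cases h : a = m
    · subst h; simp
    · simp [h]

/-- The derivation `z_i ∂ / ∂ z_i`. -/
def eulerDer (i : Fin N) : Derivation ℂ (Laurent N) (Laurent N) :=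
  Derivation.mk' (diagOp fun m => (m i : ℂ)) (by
    intro a b
    induction a using AddMonoidAlgebra.induction_linear with
    | zero => simp
    | add x y hx hy => rw [add_mul, map_add, hx, hy, map_add]; simp only [smul_eq_mul]; ring
    | single a r =>
      induction b using AddMonoidAlgebra.induction_linear with
      | zero => simp
      | add x y hx hy => rw [mul_add, map_add, hx, hy, map_add]; simp only [smul_eq_mul]; ring
      | single b t =>
        rw [AddMonoidAlgebra.single_mul_single, diagOp_single, diagOp_single, diagOp_single,
          smul_eq_mul, smul_eq_mul, AddMonoidAlgebra.single_mul_single,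
          AddMonoidAlgebra.single_mul_single, add_comm b a, ← AddMonoidAlgebra.single_add]
        congr 1
        simp only [Pi.add_apply, Int.cast_add]
        ring)

theorem eulerDer_coeff (i : Fin N) (x : Laurent N) (m : Fin N → ℤ) :
    (eulerDer i x).coeff m = m i * x.coeff m :=
  diagOp_coeff _ _ _

theorem eulerDer_single (i : Fin N) (m : Fin N → ℤ) (r : ℂ) :
    eulerDer i (AddMonoidAlgebra.single m r) = AddMonoidAlgebra.single m (m i * r) :=
  diagOp_single _ _ _

/-- The monomial `z_i ^ k`. -/
def zmono (i : Fin N) (k : ℤ) : Laurent N := AddMonoidAlgebra.single (Pi.single i k) 1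

/-- The power sum `∑ z_i ^ k`. -/
def psum (N : ℕ) (k : ℤ) : Laurent N := ∑ i, zmono i k

theorem zmono_zero (i : Fin N) : zmono i 0 = 1 := by
  simp [zmono, AddMonoidAlgebra.one_def]

theorem zmono_add (i : Fin N) (k l : ℤ) : zmono i (k + l) = zmono i k * zmono i l := by
  simp [zmono, AddMonoidAlgebra.single_mul_single, Pi.single_add]

theorem zmono_pow (i : Fin N) (n : ℕ) : zmono i 1 ^ n = zmono i (n : ℤ) := by
  induction n with
  | zero => simp [zmono_zero]
  | succ n ih => rw [pow_succ, ih, ← zmono_add]; push_cast; rfl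

theorem eulerDer_zmono (i j : Fin N) (k : ℤ) :
    eulerDer i (zmono j k) = if i = j then (k : Laurent N) * zmono j k else 0 := by
  rw [zmono, eulerDer_single]
  split_ifs with h
  · subst h
    rw [Pi.single_eq_same, AddMonoidAlgebra.intCast_def, AddMonoidAlgebra.single_mul_single,
      zero_add]
  · rw [Pi.single_eq_of_ne h]
    simp

theorem eulerDer_psum (i : Fin N) (k : ℤ) :
    eulerDer i (psum N k) = (k : Laurent N) * zmono i k := by
  simp [psum, map_sum, eulerDer_zmono]

theorem derivation_prod {R A : Type*} [CommRing R] [CommRing A] [Algebra R A]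
    (D : Derivation R A A) {α : Type*} [DecidableEq α] (s : Finset α) (f : α → A) :
    D (∏ a ∈ s, f a) = ∑ a ∈ s, D (f a) * ∏ b ∈ s.erase a, f b := by
  induction s using Finset.induction_on with
  | empty => simp
  | insert a s ha ih =>
    rw [Finset.prod_insert ha, Derivation.leibniz, ih, Finset.sum_insert ha,
      Finset.erase_insert ha, smul_eq_mul, smul_eq_mul, Finset.mul_sum, add_comm, mul_comm]
    congr 1
    refine Finset.sum_congr rfl fun b hb => ?_
    have hab : a ≠ b := fun h => ha (h ▸ hb)
    rw [Finset.erase_insert_of_ne hab, Finset.prod_insert (by simp [ha])]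
    ring

end Laurent

/-! ### The radial Laplacian. -/

section Vandermonde

variable {N : ℕ}

/-- The Vandermonde determinant `∏_{i < j} (z_j - z_i)`. -/
def vdm (N : ℕ) : Laurent N := (Matrix.vandermonde fun i : Fin N => zmono i 1).det

theorem vdm_eq_sum : vdm N = ∑ σ : Equiv.Perm (Fin N),
    AddMonoidAlgebra.single (fun i => ((σ i : ℕ) : ℤ)) (((Equiv.Perm.sign σ : ℤˣ) : ℤ) : ℂ) := by
  rw [vdm, ← Matrix.det_transpose, Matrix.det_apply']
  refine Finset.sum_congr rfl fun σ _ => ?_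
  have h1 : ∏ i, (Matrix.vandermonde fun i : Fin N => zmono i 1).transpose (σ i) i =
      AddMonoidAlgebra.single (fun i => ((σ i : ℕ) : ℤ)) 1 := by
    simp only [Matrix.transpose_apply, Matrix.vandermonde_apply, zmono_pow]
    simp only [zmono]
    rw [AddMonoidAlgebra.prod_single]
    congr 1
    · exact Finset.univ_sum_single _
    · simp
  rw [h1, AddMonoidAlgebra.intCast_def, AddMonoidAlgebra.single_mul_single, zero_add, mul_one]

theorem vdm_coeff_id : (vdm N).coeff (fun i => ((i : ℕ) : ℤ)) = 1 := by
  rw [vdm_eq_sum, AddMonoidAlgebra.coeff_sum, Finsupp.finsetSum_apply,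
    Finset.sum_eq_single (1 : Equiv.Perm (Fin N))]
  · simp
  · intro σ _ hσ
    rw [AddMonoidAlgebra.coeff_single, Finsupp.single_eq_of_ne]
    intro h
    apply hσ
    ext i
    have := congrFun h i
    simpa using this.symm
  · simp

theorem vdm_ne_zero : vdm N ≠ 0 := by
  intro h
  have := vdm_coeff_id (N := N)
  rw [h] at this
  simp at this

/-- The weight of an exponent vector: the eigenvalue of the radial Laplacian. -/
def weight (m : Fin N → ℤ) : ℤ := ∑ i, m i * (m i - (N - 1))

/-- The radial part of the Laplacian, acting on alternating Laurent polynomials. -/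
def radialOp (N : ℕ) : Laurent N →ₗ[ℂ] Laurent N :=
  diagOp fun m => ((weight m - weight (fun i : Fin N => ((i : ℕ) : ℤ)) : ℤ) : ℂ)

theorem weight_perm (σ : Equiv.Perm (Fin N)) :
    weight (fun i => ((σ i : ℕ) : ℤ)) = weight (fun i : Fin N => ((i : ℕ) : ℤ)) :=
  Equiv.sum_comp σ fun i : Fin N => ((i : ℕ) : ℤ) * (((i : ℕ) : ℤ) - (N - 1))

theorem radialOp_vdm : radialOp N (vdm N) = 0 := by
  rw [vdm_eq_sum, map_sum]
  refine Finset.sum_eq_zero fun σ _ => ?_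
  rw [radialOp, diagOp_single, weight_perm]
  simp

theorem radialOp_eq (x : Laurent N) : radialOp N x =
    ∑ i, (eulerDer i (eulerDer i x) - ((N : ℂ) - 1) • eulerDer i x) -
      (weight (fun i : Fin N => ((i : ℕ) : ℤ)) : ℂ) • x := by
  ext m
  rw [radialOp, diagOp_coeff]
  simp only [AddMonoidAlgebra.coeff_sub, AddMonoidAlgebra.coeff_sum, AddMonoidAlgebra.coeff_smul,
    Finsupp.sub_apply, Finsupp.finsetSum_apply, Finsupp.smul_apply, eulerDer_coeff, smul_eq_mul]
  rw [Int.cast_sub, sub_mul]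
  congr 1
  rw [weight, Int.cast_sum, Finset.sum_mul]
  refine Finset.sum_congr rfl fun i _ => ?_
  push_cast
  ring

/-- By the Leibniz rule, the terms in which `F` is not differentiated add up to `radialOp N (vdm N)
* F`, which is zero. -/
theorem radialOp_vdm_mul (F : Laurent N) : radialOp N (vdm N * F) =
    vdm N * ∑ i, eulerDer i (eulerDer i F) +
      ∑ i, (2 * eulerDer i (vdm N) - ((N : ℂ) - 1) • vdm N) * eulerDer i F := by
  have h := radialOp_vdm (N := N)
  rw [radialOp_eq] at h ⊢
  have h2 : ∀ i, eulerDer i (eulerDer i (vdm N * F)) - ((N : ℂ) - 1) • eulerDer i (vdm N * F) =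
      vdm N * eulerDer i (eulerDer i F) +
        (2 * eulerDer i (vdm N) - ((N : ℂ) - 1) • vdm N) * eulerDer i F +
        (eulerDer i (eulerDer i (vdm N)) - ((N : ℂ) - 1) • eulerDer i (vdm N)) * F := by
    intro i
    simp only [Derivation.leibniz, map_add, smul_eq_mul, Algebra.smul_def]
    ring
  rw [Finset.sum_congr rfl fun i _ => h2 i, Finset.sum_add_distrib, Finset.sum_add_distrib,
    ← Finset.mul_sum, ← Finset.sum_mul, sub_eq_zero.1 h, smul_mul_assoc, add_sub_cancel_right]

instance : IsDomain (Laurent N) := NoZeroDivisors.to_isDomain _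

/-- `z_i` in the fraction field. -/
def zfrac (i : Fin N) : FractionRing (Laurent N) := algebraMap (Laurent N) _ (zmono i 1)

theorem algebraMap_laurent_injective :
    Function.Injective (algebraMap (Laurent N) (FractionRing (Laurent N))) :=
  IsFractionRing.injective _ _

theorem zmono_injective (k : ℤ) (hk : k ≠ 0) : Function.Injective fun i : Fin N => zmono i k := by
  intro i j h
  by_contra hij
  have := (AddMonoidAlgebra.single_left_inj one_ne_zero).1 h
  have := congrFun this i
  rw [Pi.single_eq_same, Pi.single_eq_of_ne hij] at this
  exact hk this

theorem zfrac_injective : Function.Injective (zfrac (N := N)) :=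
  algebraMap_laurent_injective.comp (zmono_injective 1 one_ne_zero)

theorem zmono_ne_zero (i : Fin N) (k : ℤ) : zmono i k ≠ 0 :=
  AddMonoidAlgebra.single_ne_zero.2 one_ne_zero

theorem zfrac_ne_zero (i : Fin N) : zfrac i ≠ 0 := fun h =>
  zmono_ne_zero i 1 (algebraMap_laurent_injective (h.trans (map_zero _).symm))

theorem algebraMap_zmono (i : Fin N) (k : ℤ) :
    algebraMap (Laurent N) (FractionRing (Laurent N)) (zmono i k) = zfrac i ^ k := by
  induction k using Int.induction_on with
  | zero => simp [zmono_zero]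
  | succ n ih => rw [zmono_add, map_mul, ih, zpow_add_one₀ (zfrac_ne_zero i)]; rfl
  | pred n ih =>
    apply mul_right_cancel₀ (zfrac_ne_zero i)
    rw [← zpow_add_one₀ (zfrac_ne_zero i), sub_add_cancel, ← ih]
    conv_lhs => rw [zfrac, ← map_mul, ← zmono_add, sub_add_cancel]

theorem algebraMap_derivation_prod (D : Derivation ℂ (Laurent N) (Laurent N)) {α : Type*}
    [DecidableEq α] (s : Finset α) (f : α → Laurent N) (hf : ∀ a ∈ s, f a ≠ 0) :
    algebraMap (Laurent N) (FractionRing (Laurent N)) (D (∏ a ∈ s, f a)) =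
      algebraMap _ _ (∏ a ∈ s, f a) * ∑ a ∈ s, algebraMap _ _ (D (f a)) / algebraMap _ _ (f a) := by
  rw [derivation_prod, map_sum, Finset.mul_sum]
  refine Finset.sum_congr rfl fun a ha => ?_
  have : algebraMap (Laurent N) (FractionRing (Laurent N)) (f a) ≠ 0 := fun h =>
    hf a ha (algebraMap_laurent_injective (h.trans (map_zero _).symm))
  rw [map_mul, ← Finset.mul_prod_erase s f ha, map_mul]
  field_simp

theorem vdm_eq_prod : vdm N = ∏ p : Fin N × Fin N with p.1 < p.2, (zmono p.2 1 - zmono p.1 1) := by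
  rw [vdm, Matrix.det_vandermonde, Finset.prod_filter, Fintype.prod_prod_type]
  refine Finset.prod_congr rfl fun i _ => ?_
  rw [← Finset.prod_filter, Finset.filter_lt_eq_Ioi]

/-- The logarithmic derivative of the product formula. The fraction field is needed because the
individual summands are not Laurent polynomials. -/
theorem algebraMap_eulerDer_vdm (i : Fin N) :
    algebraMap (Laurent N) (FractionRing (Laurent N)) (eulerDer i (vdm N)) =
      algebraMap _ _ (vdm N) * ∑ l ∈ Finset.univ.erase i, zfrac i / (zfrac i - zfrac l) := by
  rw [vdm_eq_prod, algebraMap_derivation_prod]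
  · congr 1
    have h1 : ∀ p ∈ Finset.univ.filter (fun p : Fin N × Fin N => p.1 < p.2),
        algebraMap (Laurent N) (FractionRing (Laurent N)) (eulerDer i (zmono p.2 1 - zmono p.1 1)) /
          algebraMap _ _ (zmono p.2 1 - zmono p.1 1) =
        (if i = p.2 then zfrac p.2 / (zfrac p.2 - zfrac p.1) else 0) +
          (if i = p.1 then zfrac p.1 / (zfrac p.1 - zfrac p.2) else 0) := by
      intro p hp
      rw [map_sub, map_sub, map_sub, eulerDer_zmono, eulerDer_zmono]
      change _ / (zfrac p.2 - zfrac p.1) = _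
      rw [← neg_sub (zfrac p.2) (zfrac p.1), div_neg]
      have : p.1 ≠ p.2 := (Finset.mem_filter.1 hp).2.ne
      by_cases h2 : i = p.2 <;> by_cases h3 : i = p.1
      · exact absurd (h3.symm.trans h2) this
      · simp [h2, this.symm, zfrac]
      · simp [h3, this, zfrac, neg_div]
      · simp [h2, h3]
    rw [Finset.sum_congr rfl h1, Finset.sum_add_distrib]
    have h2 : ∑ p : Fin N × Fin N with p.1 < p.2,
        (if i = p.2 then zfrac p.2 / (zfrac p.2 - zfrac p.1) else 0) =
        ∑ l ∈ Finset.univ.filter (· < i), zfrac i / (zfrac i - zfrac l) := by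
      rw [Finset.sum_filter, Fintype.sum_prod_type, Finset.sum_filter]
      refine Finset.sum_congr rfl fun l _ => ?_
      rw [Finset.sum_eq_single i]
      · simp
      · intro b _ hb; simp [hb.symm]
      · simp
    have h3 : ∑ p : Fin N × Fin N with p.1 < p.2,
        (if i = p.1 then zfrac p.1 / (zfrac p.1 - zfrac p.2) else 0) =
        ∑ l ∈ Finset.univ.filter (i < ·), zfrac i / (zfrac i - zfrac l) := by
      rw [Finset.sum_filter, Fintype.sum_prod_type_right, Finset.sum_filter]
      refine Finset.sum_congr rfl fun l _ => ?_
      rw [Finset.sum_eq_single i]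
      · simp
      · intro b _ hb; simp [hb.symm]
      · simp
    rw [h2, h3, ← Finset.sum_union]
    · refine Finset.sum_congr ?_ fun _ _ => rfl
      ext l; simp [lt_or_lt_iff_ne]
    · rw [Finset.disjoint_left]; intro l; simp only [Finset.mem_filter]; intro h; simp [h.2.le]
  · intro p hp
    exact sub_ne_zero.2 fun h => (Finset.mem_filter.1 hp).2.ne' (zmono_injective 1 one_ne_zero h)

theorem sum_eulerDer_vdm_mul_zmono (k : ℤ) :
    ∑ i, (2 * eulerDer i (vdm N) - ((N : ℂ) - 1) • vdm N) * zmono i k =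
      vdm N * (signedSum k (fun m => psum N m * psum N (k - m)) - k * psum N k) := by
  apply algebraMap_laurent_injective
  have hp : ∀ m, algebraMap (Laurent N) (FractionRing (Laurent N)) (psum N m) =
      ∑ i, zfrac i ^ m := fun m => by simp [psum, map_sum, algebraMap_zmono]
  have hN : algebraMap (Laurent N) (FractionRing (Laurent N)) (((N : ℂ) - 1) • vdm N) =
      ((N : FractionRing (Laurent N)) - 1) * algebraMap _ _ (vdm N) := by
    have : algebraMap ℂ (Laurent N) ((N : ℂ) - 1) = (N : Laurent N) - 1 := by
      rw [map_sub, map_natCast, map_one]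
    rw [Algebra.smul_def, map_mul, this, map_sub, map_natCast, map_one]
  rw [map_sum, map_mul, map_sub, map_signedSum, map_mul, map_intCast, hp]
  simp only [map_mul, map_sub, map_ofNat, hp, algebraMap_zmono, algebraMap_eulerDer_vdm, hN]
  rw [← sum_logDeriv_eq_signedSum zfrac zfrac_injective zfrac_ne_zero, Finset.mul_sum]
  refine Finset.sum_congr rfl fun i _ => ?_
  ring

/-- Second derivatives of a single power sum contribute the square of `κ a`, which cancels the term
`k * psum N k` in the drift. The drift supplies the splitting term of `sdExpr`, the mixed first
derivatives its merging terms. -/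
theorem radialOp_vdm_mul_prod {α : Type*} [DecidableEq α] (s : Finset α) (κ : α → ℤ) :
    radialOp N (vdm N * ∏ a ∈ s, psum N (κ a)) = vdm N * loopExpr (psum N) s κ := by
  have hD : ∀ (i : Fin N) (t : Finset α), eulerDer i (∏ a ∈ t, psum N (κ a)) =
      ∑ a ∈ t, (κ a : Laurent N) * zmono i (κ a) * ∏ b ∈ t.erase a, psum N (κ b) := by
    intro i t
    rw [derivation_prod]
    simp only [eulerDer_psum]
  have hDD : ∀ i : Fin N, eulerDer i (eulerDer i (∏ a ∈ s, psum N (κ a))) =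
      ∑ a ∈ s, (κ a : Laurent N) * ((κ a : Laurent N) * zmono i (κ a) *
        ∏ b ∈ s.erase a, psum N (κ b) +
        ∑ b ∈ s.erase a, (κ b : Laurent N) * zmono i (κ a + κ b) *
          ∏ c ∈ (s.erase a).erase b, psum N (κ c)) := by
    intro i
    rw [hD, map_sum]
    refine Finset.sum_congr rfl fun a _ => ?_
    rw [mul_assoc, Derivation.leibniz, Derivation.leibniz, hD, eulerDer_zmono, if_pos rfl,
      Derivation.map_intCast, smul_zero, add_zero, smul_eq_mul, smul_eq_mul, smul_eq_mul,
      Finset.mul_sum]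
    have : ∀ b ∈ s.erase a, zmono i (κ a) * ((κ b : Laurent N) * zmono i (κ b) *
        ∏ c ∈ (s.erase a).erase b, psum N (κ c)) = (κ b : Laurent N) * zmono i (κ a + κ b) *
        ∏ c ∈ (s.erase a).erase b, psum N (κ c) := fun b _ => by rw [zmono_add]; ring
    rw [Finset.sum_congr rfl this]
    ring
  rw [radialOp_vdm_mul]
  simp only [hDD]
  simp only [hD, Finset.mul_sum (s := s)]
  rw [Finset.sum_comm, Finset.sum_comm (s := Finset.univ), Finset.mul_sum,
    ← Finset.sum_add_distrib, loopExpr, Finset.mul_sum]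
  refine Finset.sum_congr rfl fun a _ => ?_
  have key := sum_eulerDer_vdm_mul_zmono (N := N) (κ a)
  have e1 : ∑ i, (2 * eulerDer i (vdm N) - ((N : ℂ) - 1) • vdm N) *
      ((κ a : Laurent N) * zmono i (κ a) * ∏ b ∈ s.erase a, psum N (κ b)) =
      (κ a : Laurent N) * (∏ b ∈ s.erase a, psum N (κ b)) *
      ∑ i, (2 * eulerDer i (vdm N) - ((N : ℂ) - 1) • vdm N) * zmono i (κ a) := by
    rw [Finset.mul_sum]
    exact Finset.sum_congr rfl fun i _ => by ring
  have e2 : vdm N * ∑ i, ((κ a : Laurent N) * ((κ a : Laurent N) * zmono i (κ a) *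
        ∏ b ∈ s.erase a, psum N (κ b) +
        ∑ b ∈ s.erase a, (κ b : Laurent N) * zmono i (κ a + κ b) *
          ∏ c ∈ (s.erase a).erase b, psum N (κ c))) =
      vdm N * (κ a : Laurent N) * ((κ a : Laurent N) * psum N (κ a) *
        ∏ b ∈ s.erase a, psum N (κ b) +
        ∑ b ∈ s.erase a, (κ b : Laurent N) * psum N (κ a + κ b) *
          ∏ c ∈ (s.erase a).erase b, psum N (κ c)) := by
    have : ∀ k, psum N k = ∑ i, zmono i k := fun _ => rfl
    rw [← Finset.mul_sum, Finset.sum_add_distrib, Finset.sum_comm, this (κ a),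
      Finset.mul_sum, Finset.sum_mul, mul_assoc]
    congr 3
    refine Finset.sum_congr rfl fun b _ => ?_
    rw [this (κ a + κ b), Finset.mul_sum, Finset.sum_mul]
  rw [e1, e2, key, sdExpr]
  ring

end Vandermonde

/-! ### Inverting the radial Laplacian on alternating polynomials. -/

section Alternating

variable {N : ℕ}

/-- The ring endomorphism of the Laurent polynomials permuting the variables. -/
def permHom (τ : Equiv.Perm (Fin N)) : Laurent N →+* Laurent N :=
  AddMonoidAlgebra.mapDomainRingHom ℂ
    ({ toFun := fun m => m ∘ τ, map_zero' := rfl, map_add' := fun _ _ => rfl } :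
      (Fin N → ℤ) →+ (Fin N → ℤ))

theorem permHom_single (τ : Equiv.Perm (Fin N)) (m : Fin N → ℤ) (r : ℂ) :
    permHom τ (AddMonoidAlgebra.single m r) = AddMonoidAlgebra.single (m ∘ τ) r :=
  AddMonoidAlgebra.mapDomain_single

theorem permHom_coeff (τ : Equiv.Perm (Fin N)) (x : Laurent N) (m : Fin N → ℤ) :
    (permHom τ x).coeff (m ∘ τ) = x.coeff m :=
  Finsupp.mapDomain_apply (Function.Surjective.injective_comp_right τ.surjective) _ _

theorem permHom_psum (τ : Equiv.Perm (Fin N)) (k : ℤ) : permHom τ (psum N k) = psum N k := by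
  rw [psum, map_sum, ← Equiv.sum_comp τ.symm (fun i => zmono i k)]
  refine Finset.sum_congr rfl fun i _ => ?_
  rw [zmono, permHom_single, zmono]
  congr 1
  ext j
  simp only [Function.comp_apply, Pi.single_apply, Equiv.eq_symm_apply]

theorem permHom_vdm (τ : Equiv.Perm (Fin N)) :
    permHom τ (vdm N) = (((Equiv.Perm.sign τ : ℤˣ) : ℤ) : Laurent N) * vdm N := by
  rw [vdm_eq_sum, map_sum, Finset.mul_sum, ← Equiv.sum_comp (Equiv.mulRight τ)
    (fun σ : Equiv.Perm (Fin N) => (((Equiv.Perm.sign τ : ℤˣ) : ℤ) : Laurent N) *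
      AddMonoidAlgebra.single (fun i => ((σ i : ℕ) : ℤ)) (((Equiv.Perm.sign σ : ℤˣ) : ℤ) : ℂ))]
  refine Finset.sum_congr rfl fun σ _ => ?_
  rw [permHom_single, AddMonoidAlgebra.intCast_def, AddMonoidAlgebra.single_mul_single, zero_add]
  congr 1
  rw [Equiv.coe_mulRight, Equiv.Perm.sign_mul, Units.val_mul, Int.cast_mul, mul_left_comm,
    ← Int.cast_mul, ← Units.val_mul, Int.units_mul_self]
  simp

/-- The algebra generated by the power sums. -/
def psumAlgebra (N : ℕ) : Subalgebra ℂ (Laurent N) := Algebra.adjoin ℂ (Set.range (psum N))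

theorem psum_mem (k : ℤ) : psum N k ∈ psumAlgebra N := Algebra.subset_adjoin ⟨k, rfl⟩

theorem permHom_of_mem {F : Laurent N} (hF : F ∈ psumAlgebra N) (τ : Equiv.Perm (Fin N)) :
    permHom τ F = F := by
  induction hF using Algebra.adjoin_induction with
  | mem x hx => obtain ⟨k, rfl⟩ := hx; exact permHom_psum τ k
  | algebraMap r => exact (permHom_single τ 0 r).trans rfl
  | add x y _ _ hx hy => rw [map_add, hx, hy]
  | mul x y _ _ hx hy => rw [map_mul, hx, hy]

theorem coeff_vdm_mul_comp {F : Laurent N} (hF : F ∈ psumAlgebra N) (τ : Equiv.Perm (Fin N))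
    (m : Fin N → ℤ) :
    (vdm N * F).coeff m = ((Equiv.Perm.sign τ : ℤˣ) : ℤ) * (vdm N * F).coeff (m ∘ τ) := by
  rw [← permHom_coeff τ, map_mul, permHom_of_mem hF, permHom_vdm, mul_assoc,
    AddMonoidAlgebra.intCast_def,
    AddMonoidAlgebra.coeff_single_zero_mul]

theorem injective_of_coeff_ne_zero {F : Laurent N} (hF : F ∈ psumAlgebra N) {m : Fin N → ℤ}
    (h : (vdm N * F).coeff m ≠ 0) : Function.Injective m := by
  intro i j hij
  by_contra hne
  have h1 := coeff_vdm_mul_comp hF (Equiv.swap i j) m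
  have h2 : m ∘ Equiv.swap i j = m := by
    ext k
    simp only [Function.comp_apply, Equiv.swap_apply_def]
    split_ifs with h1 h2
    · rw [h1, hij]
    · rw [h2, hij]
    · rfl
  rw [h2, Equiv.Perm.sign_swap hne] at h1
  apply h
  have : (2 : ℂ) * (vdm N * F).coeff m = 0 := by
    push_cast at h1
    linear_combination h1
  simpa using this

/-- For `N > 0`, the function `t (t - (N - 1))` is nonpositive at `0, …, N - 1` and positive at all
other integers. So distinct exponents of this weight cannot leave that range. -/
theorem exists_perm_of_weight_eq {m : Fin N → ℤ} (hm : Function.Injective m)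
    (hw : weight m = weight (fun i : Fin N => ((i : ℕ) : ℤ))) :
    ∃ σ : Equiv.Perm (Fin N), m = fun i => ((σ i : ℕ) : ℤ) := by
  set f : ℤ → ℤ := fun t => t * (t - (N - 1)) with hf
  set A : Finset ℤ := Finset.univ.image m with hA
  set B : Finset ℤ := Finset.univ.image (fun i : Fin N => ((i : ℕ) : ℤ)) with hB
  have hinj : Function.Injective (fun i : Fin N => ((i : ℕ) : ℤ)) := fun i j h => by
    ext; simpa using h
  have hBmem : ∀ t, t ∈ B ↔ 0 ≤ t ∧ t < N := by
    intro t
    simp only [hB, Finset.mem_image, Finset.mem_univ, true_and]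
    constructor
    · rintro ⟨i, rfl⟩; exact ⟨by positivity, by exact_mod_cast i.2⟩
    · rintro ⟨h1, h2⟩; exact ⟨⟨t.toNat, by omega⟩, by simp [h1]⟩
  have h1 : weight m = ∑ t ∈ A, f t := by rw [hA, Finset.sum_image hm.injOn]; rfl
  have h2 : weight (fun i : Fin N => ((i : ℕ) : ℤ)) = ∑ t ∈ B, f t := by
    rw [hB, Finset.sum_image hinj.injOn]; rfl
  have h3 : ∑ t ∈ A \ B, f t = ∑ t ∈ B \ A, f t := by
    have e1 := Finset.sum_inter_add_sum_sdiff A B f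
    have e2 := Finset.sum_inter_add_sum_sdiff B A f
    rw [Finset.inter_comm] at e2
    linarith
  have h4 : ∑ t ∈ B \ A, f t ≤ 0 := by
    refine Finset.sum_nonpos fun t ht => ?_
    have := (hBmem t).1 (Finset.mem_sdiff.1 ht).1
    exact mul_nonpos_of_nonneg_of_nonpos this.1 (by omega)
  have hpos : ∀ t ∈ A \ B, 0 < f t := by
    intro t ht
    have hN : 0 < N := by
      rcases Nat.eq_zero_or_pos N with h | h
      · subst h; simp [hA] at ht
      · exact h
    have := mt (hBmem t).2 (Finset.mem_sdiff.1 ht).2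
    rcases lt_or_ge t 0 with h | h
    · exact mul_pos_of_neg_of_neg h (by omega)
    · exact mul_pos (by omega) (by omega)
  have hAB : A ⊆ B := by
    rw [← Finset.sdiff_eq_empty_iff_subset]
    by_contra hne
    have := Finset.sum_pos hpos (Finset.nonempty_iff_ne_empty.2 hne)
    omega
  have hmB : ∀ i, 0 ≤ m i ∧ m i < N := fun i =>
    (hBmem _).1 (hAB (Finset.mem_image_of_mem m (Finset.mem_univ i)))
  let g : Fin N → Fin N := fun i => ⟨(m i).toNat, by have := hmB i; omega⟩
  have hg : Function.Injective g := by
    intro i j h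
    apply hm
    have h' := congrArg Fin.val h
    simp only [g] at h'
    have := hmB i
    have := hmB j
    omega
  refine ⟨Equiv.ofBijective g (Finite.injective_iff_bijective.1 hg), ?_⟩
  ext i
  simp [g, hmB i]

/-- A surviving coefficient would sit at distinct exponents of minimal weight, hence at a
permutation of `(0, …, N - 1)`; by alternation it is, up to sign, the coefficient assumed to vanish.
-/
theorem eq_zero_of_radialOp_eq_zero {F : Laurent N} (hF : F ∈ psumAlgebra N)
    (h0 : (vdm N * F).coeff (fun i : Fin N => ((i : ℕ) : ℤ)) = 0)
    (hR : radialOp N (vdm N * F) = 0) : vdm N * F = 0 := by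
  ext m
  by_contra hne
  have hne' : (vdm N * F).coeff m ≠ 0 := by simpa using hne
  have h1 : (radialOp N (vdm N * F)).coeff m = 0 := by rw [hR]; simp
  rw [radialOp, diagOp_coeff] at h1
  have h2 := (mul_eq_zero.1 h1).resolve_right hne'
  have h3 : weight m = weight (fun i : Fin N => ((i : ℕ) : ℤ)) :=
    sub_eq_zero.1 (by exact_mod_cast h2)
  obtain ⟨σ, rfl⟩ := exists_perm_of_weight_eq (injective_of_coeff_ne_zero hF hne') h3
  apply hne'
  have h4 := coeff_vdm_mul_comp hF σ (fun i : Fin N => ((i : ℕ) : ℤ))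
  rw [h0] at h4
  exact (mul_eq_zero.1 h4.symm).resolve_left (by simp)

/-- The span of the loop expressions. -/
def loopSpan (N : ℕ) : Submodule ℂ (Laurent N) :=
  Submodule.span ℂ {x | ∃ (r : ℕ) (κ : Fin r → ℤ), x = loopExpr (psum N) Finset.univ κ}

theorem exists_radialOp_eq {F : Laurent N} (hF : F ∈ psumAlgebra N) :
    ∃ G ∈ loopSpan N, radialOp N (vdm N * F) = vdm N * G := by
  have hF' : F ∈ Submodule.span ℂ (Submonoid.closure (Set.range (psum N)) : Set (Laurent N)) := by
    rw [← Algebra.adjoin_eq_span]; exact hF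
  induction hF' using Submodule.span_induction with
  | mem x hx =>
    obtain ⟨l, hl, rfl⟩ := Submonoid.exists_list_of_mem_closure hx
    choose κ hκ using fun a : Fin l.length => hl (l.get a) (List.get_mem l a)
    refine ⟨loopExpr (psum N) Finset.univ κ, Submodule.subset_span ⟨_, κ, rfl⟩, ?_⟩
    rw [← radialOp_vdm_mul_prod]
    congr 2
    rw [← Fin.prod_univ_getElem]
    exact Finset.prod_congr rfl fun a _ => (hκ a).symm
  | zero => exact ⟨0, Submodule.zero_mem _, by simp⟩
  | add x y hx hy h1 h2 =>
    have mem : ∀ z ∈ Submodule.span ℂ (Submonoid.closure (Set.range (psum N)) : Set (Laurent N)),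
        z ∈ psumAlgebra N := fun z hz => by
      rw [← Algebra.adjoin_eq_span] at hz; exact hz
    obtain ⟨G1, hG1, e1⟩ := h1 (mem x hx)
    obtain ⟨G2, hG2, e2⟩ := h2 (mem y hy)
    exact ⟨G1 + G2, Submodule.add_mem _ hG1 hG2, by rw [mul_add, map_add, e1, e2, mul_add]⟩
  | smul c x hx h1 =>
    have mem : ∀ z ∈ Submodule.span ℂ (Submonoid.closure (Set.range (psum N)) : Set (Laurent N)),
        z ∈ psumAlgebra N := fun z hz => by
      rw [← Algebra.adjoin_eq_span] at hz; exact hz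
    obtain ⟨G1, hG1, e1⟩ := h1 (mem x hx)
    exact ⟨c • G1, Submodule.smul_mem _ c hG1, by rw [mul_smul_comm, map_smul, e1, mul_smul_comm]⟩

theorem signedSum_mem {M : Type*} [AddCommGroup M] {S : Type*} [SetLike S M] [AddSubgroupClass S M]
    (s : S) (k : ℤ) (f : ℤ → M) (h : ∀ m, f m ∈ s) : signedSum k f ∈ s :=
  sub_mem (sum_mem fun m _ => h m) (sum_mem fun m _ => h m)

theorem loopExpr_mem {α : Type*} [DecidableEq α] (s : Finset α) (κ : α → ℤ) :
    loopExpr (psum N) s κ ∈ psumAlgebra N := by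
  have hint : ∀ k : ℤ, (k : Laurent N) ∈ psumAlgebra N := fun k => intCast_mem _ k
  refine sum_mem fun a _ => mul_mem (hint _) (add_mem (mul_mem ?_ ?_) (sum_mem fun b _ => ?_))
  · exact signedSum_mem _ _ _ fun m => mul_mem (psum_mem _) (psum_mem _)
  · exact prod_mem fun b _ => psum_mem _
  · exact mul_mem (mul_mem (hint _) (psum_mem _)) (prod_mem fun c _ => psum_mem _)

theorem loopSpan_le : loopSpan N ≤ Subalgebra.toSubmodule (psumAlgebra N) :=
  Submodule.span_le.2 fun x ⟨r, κ, hx⟩ => by rw [hx]; exact loopExpr_mem _ κ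

/-- Every symmetric Laurent polynomial is, up to a constant, a combination of loop expressions; the
constant is a coefficient of its product with the Vandermonde determinant. -/
theorem sub_coeff_mem_loopSpan {F : Laurent N} (hF : F ∈ psumAlgebra N) :
    F - algebraMap ℂ (Laurent N) ((vdm N * F).coeff (fun i : Fin N => ((i : ℕ) : ℤ))) ∈
      loopSpan N := by
  set c := (vdm N * F).coeff (fun i : Fin N => ((i : ℕ) : ℤ)) with hc
  set F' := F - algebraMap ℂ (Laurent N) c with hF'
  have hF'mem : F' ∈ psumAlgebra N := sub_mem hF (Subalgebra.algebraMap_mem _ c)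
  have hmulc : vdm N * algebraMap ℂ (Laurent N) c = c • vdm N := by
    rw [Algebra.smul_def, mul_comm]
  have hF'0 : (vdm N * F').coeff (fun i : Fin N => ((i : ℕ) : ℤ)) = 0 := by
    rw [hF', mul_sub, hmulc, AddMonoidAlgebra.coeff_sub, AddMonoidAlgebra.coeff_smul,
      Finsupp.sub_apply, Finsupp.smul_apply, vdm_coeff_id, ← hc]
    simp
  -- A diagonal operator does not enlarge supports. Restricting to the support of the target gives a
  -- finite-dimensional invariant space, on which injectivity yields surjectivity.
  let U : Submodule ℂ (Laurent N) :=
    ((Subalgebra.toSubmodule (psumAlgebra N)).map (LinearMap.mulLeft ℂ (vdm N))) ⊓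
      AddMonoidAlgebra.supported ℂ ℂ ((vdm N * F').coeff.support : Set (Fin N → ℤ))
  have hU0 : ∀ x ∈ U, x.coeff (fun i : Fin N => ((i : ℕ) : ℤ)) = 0 := fun x hx =>
    AddMonoidAlgebra.mem_supported'.1 hx.2 _ (by simpa using hF'0)
  have hUmap : ∀ x ∈ U, radialOp N x ∈ U := by
    rintro x ⟨⟨G, hG, rfl⟩, hx⟩
    constructor
    · obtain ⟨H, hH, e⟩ := exists_radialOp_eq hG
      exact ⟨H, loopSpan_le hH, e.symm⟩
    · refine AddMonoidAlgebra.mem_supported'.2 fun m hm => ?_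
      rw [radialOp, diagOp_coeff, AddMonoidAlgebra.mem_supported'.1 hx m hm, mul_zero]
  have : FiniteDimensional ℂ U := by
    have : FiniteDimensional ℂ (AddMonoidAlgebra.supported ℂ ℂ
        ((vdm N * F').coeff.support : Set (Fin N → ℤ)) : Submodule ℂ (Laurent N)) := by
      rw [AddMonoidAlgebra.supported_eq_span_single]
      exact FiniteDimensional.span_of_finite ℂ (Set.Finite.image _ (Finset.finite_toSet _))
    exact Submodule.finiteDimensional_of_le inf_le_right
  let T : U →ₗ[ℂ] U := (radialOp N).restrict hUmap
  have hinj : Function.Injective T := by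
    rw [← LinearMap.ker_eq_bot, LinearMap.ker_eq_bot']
    rintro ⟨x, hx⟩ h
    obtain ⟨G, hG, rfl⟩ := hx.1
    ext1
    exact eq_zero_of_radialOp_eq_zero hG (hU0 _ hx) (congrArg Subtype.val h)
  obtain ⟨⟨y, hy⟩, hTy⟩ := (LinearMap.injective_iff_surjective.1 hinj)
    ⟨vdm N * F', ⟨F', hF'mem, rfl⟩, AddMonoidAlgebra.mem_supported.2 le_rfl⟩
  obtain ⟨G, hG, rfl⟩ := hy.1
  obtain ⟨H, hH, e⟩ := exists_radialOp_eq hG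
  have h1 : radialOp N (vdm N * G) = vdm N * F' := congrArg Subtype.val hTy
  rw [e] at h1
  rw [← mul_left_cancel₀ vdm_ne_zero h1]
  exact hH

end Alternating

/-! ### Schwinger–Dyson equations from invariance of Haar measure. -/

section Group

variable {N : ℕ}

open scoped Matrix.Norms.L2Operator in
instance compactSpace_unitaryGroup : CompactSpace (Matrix.unitaryGroup (Fin N) ℂ) := by
  have : ProperSpace (Matrix (Fin N) (Fin N) ℂ) := FiniteDimensional.proper ℂ _
  refine isCompact_iff_compactSpace.1 (Metric.isCompact_of_isClosed_isBounded isClosed_unitary ?_)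
  refine (Metric.isBounded_closedBall (x := (0 : Matrix (Fin N) (Fin N) ℂ)) (r := 1)).subset ?_
  intro X hX
  rw [mem_closedBall_zero_iff]
  rcases subsingleton_or_nontrivial (Matrix (Fin N) (Fin N) ℂ) with h | h
  · rw [Subsingleton.elim X 0, norm_zero]; exact zero_le_one
  · exact (CStarRing.norm_of_mem_unitary hX).le

/-- The integer power of a unitary matrix, as a matrix. -/
def matPow (X : Matrix.unitaryGroup (Fin N) ℂ) (k : ℤ) : Matrix (Fin N) (Fin N) ℂ :=
  ((X ^ k : Matrix.unitaryGroup (Fin N) ℂ) : Matrix (Fin N) (Fin N) ℂ)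

theorem matPow_add (X : Matrix.unitaryGroup (Fin N) ℂ) (k l : ℤ) :
    matPow X (k + l) = matPow X k * matPow X l := by
  rw [matPow, zpow_add]; rfl

theorem matPow_zero (X : Matrix.unitaryGroup (Fin N) ℂ) : matPow X 0 = 1 := by
  rw [matPow, zpow_zero]; rfl

theorem matPow_one (X : Matrix.unitaryGroup (Fin N) ℂ) : matPow X 1 = X := by
  rw [matPow, zpow_one]

theorem matPow_neg (X : Matrix.unitaryGroup (Fin N) ℂ) (k : ℤ) :
    matPow X (-k) = star (matPow X k) := by
  rw [matPow, zpow_neg]; rfl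

theorem continuous_matPow (k : ℤ) :
    Continuous fun X : Matrix.unitaryGroup (Fin N) ℂ => matPow X k :=
  continuous_subtype_val.comp (continuous_zpow k)

/-- The traces of the integer powers of a unitary matrix. -/
def powTrace (X : Matrix.unitaryGroup (Fin N) ℂ) (k : ℤ) : ℂ := (matPow X k).trace

theorem continuous_powTrace (k : ℤ) :
    Continuous fun X : Matrix.unitaryGroup (Fin N) ℂ => powTrace X k :=
  (continuous_matPow k).matrix_trace

/-- The derivative of `X ↦ X ^ k` at `X` in the direction `B * X`. -/
def powDeriv (B : Matrix (Fin N) (Fin N) ℂ) (k : ℤ) (X : Matrix.unitaryGroup (Fin N) ℂ) :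
    Matrix (Fin N) (Fin N) ℂ :=
  signedSum k fun m => matPow X (k - m) * B * matPow X m

theorem matPow_mul_powDeriv (B : Matrix (Fin N) (Fin N) ℂ) (k l : ℤ)
    (X : Matrix.unitaryGroup (Fin N) ℂ) :
    matPow X l * powDeriv B k X = signedSum k fun m => matPow X (k + l - m) * B * matPow X m := by
  rw [powDeriv]
  refine (map_signedSum (AddMonoidHom.mulLeft (matPow X l)) _ _).trans
    (signedSum_congr fun m => ?_)
  rw [AddMonoidHom.coe_mulLeft, ← mul_assoc, ← mul_assoc, ← matPow_add]
  congr 3; ring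

theorem powDeriv_add_one (B : Matrix (Fin N) (Fin N) ℂ) (k : ℤ)
    (X : Matrix.unitaryGroup (Fin N) ℂ) :
    powDeriv B (k + 1) X = matPow X 1 * powDeriv B k X + B * matPow X 1 * matPow X k := by
  rw [matPow_mul_powDeriv, powDeriv, signedSum_add_one, sub_self, matPow_zero, one_mul,
    mul_assoc B, ← matPow_add, add_comm 1 k]

theorem powDeriv_sub_one (B : Matrix (Fin N) (Fin N) ℂ) (k : ℤ)
    (X : Matrix.unitaryGroup (Fin N) ℂ) :
    powDeriv B (k - 1) X =
      matPow X (-1) * powDeriv B k X + (-(matPow X (-1) * B)) * matPow X k := by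
  rw [matPow_mul_powDeriv, powDeriv, signedSum_sub_one, neg_mul, ← sub_eq_add_neg,
    sub_sub_cancel_left]
  rfl

open scoped Matrix.Norms.L2Operator in
-- The product rule, inductively in both directions. The inverse is differentiated as the adjoint,
-- which is where skewness of `B` enters.
theorem hasDerivAt_matPow {B : Matrix (Fin N) (Fin N) ℂ} (hB : star B = -B)
    (γ : ℝ → Matrix.unitaryGroup (Fin N) ℂ)
    (hγ : ∀ s, HasDerivAt (fun s => matPow (γ s) 1) (B * matPow (γ s) 1) s) (k : ℤ) (s : ℝ) :
    HasDerivAt (fun s => matPow (γ s) k) (powDeriv B k (γ s)) s := by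
  have hneg : ∀ s, HasDerivAt (fun s => matPow (γ s) (-1)) (-(matPow (γ s) (-1) * B)) s := by
    intro s
    have h := (hγ s).star
    simp_rw [star_mul, hB, ← matPow_neg, mul_neg] at h
    exact h
  induction k using Int.induction_on with
  | zero =>
    simp_rw [matPow_zero, powDeriv, signedSum_zero]
    exact hasDerivAt_const s _
  | succ k ih =>
    rw [powDeriv_add_one, add_comm (matPow _ 1 * _)]
    have h := (hγ s).mul ih
    refine h.congr_of_eventuallyEq (Filter.Eventually.of_forall fun t => ?_)
    change _ = matPow (γ t) 1 * matPow (γ t) k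
    exact (congrArg _ (add_comm (k : ℤ) 1)).trans (matPow_add _ _ _)
  | pred k ih =>
    rw [powDeriv_sub_one, add_comm (matPow _ (-1) * _)]
    have h := (hneg s).mul ih
    refine h.congr_of_eventuallyEq (Filter.Eventually.of_forall fun t => ?_)
    change _ = matPow (γ t) (-1) * matPow (γ t) (-k)
    exact (congrArg _ (sub_eq_neg_add (-(k : ℤ)) 1)).trans (matPow_add _ _ _)

open scoped Matrix.Norms.L2Operator in
/-- The curve `s ↦ exp (s B) X` for skew-Hermitian `B`. -/
theorem exists_curve {B : Matrix (Fin N) (Fin N) ℂ} (hB : star B = -B) :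
    ∃ g : ℝ → Matrix.unitaryGroup (Fin N) ℂ, ∀ X s,
      HasDerivAt (fun s => matPow (g s * X) 1) (B * matPow (g s * X) 1) s := by
  let _ : NormedAlgebra ℚ (Matrix (Fin N) (Fin N) ℂ) := NormedAlgebra.restrictScalars ℚ ℂ _
  have hmem : ∀ s : ℝ, NormedSpace.exp (s • B) ∈ unitary (Matrix (Fin N) (Fin N) ℂ) := fun s =>
    NormedSpace.exp_mem_unitary_of_mem_skewAdjoint
      (skewAdjoint.mem_iff.2 (by rw [star_smul, hB, smul_neg, star_trivial]))
  refine ⟨fun s => ⟨_, hmem s⟩, fun X s => ?_⟩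
  simp_rw [matPow_one]
  have h := (hasDerivAt_exp_smul_const' B s).mul_const (X : Matrix (Fin N) (Fin N) ℂ)
  rw [mul_assoc] at h
  exact h

/-- By left invariance the integral of `Φ (g s * X)` does not depend on `s`, so its derivative at
`0` vanishes. Invariance also removes `g 0` from that derivative, so the curve need not start at the
identity. -/
theorem integral_eq_zero_of_hasDerivAt [MeasurableSpace (Matrix.unitaryGroup (Fin N) ℂ)]
    [BorelSpace (Matrix.unitaryGroup (Fin N) ℂ)] (μ : Measure (Matrix.unitaryGroup (Fin N) ℂ))
    [μ.IsMulLeftInvariant] [IsFiniteMeasure μ] {Φ Ψ : Matrix.unitaryGroup (Fin N) ℂ → ℂ}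
    (hΦ : Continuous Φ) (hΨ : Continuous Ψ) (g : ℝ → Matrix.unitaryGroup (Fin N) ℂ)
    (h : ∀ X s, HasDerivAt (fun s => Φ (g s * X)) (Ψ (g s * X)) s) : ∫ X, Ψ X ∂μ = 0 := by
  obtain ⟨C, hC⟩ := isCompact_univ.exists_bound_of_continuousOn hΨ.continuousOn
  have key := (hasDerivAt_integral_of_dominated_loc_of_deriv_le (𝕜 := ℝ) (μ := μ)
    (F := fun s X => Φ (g s * X)) (F' := fun s X => Ψ (g s * X)) (x₀ := 0) (s := Set.univ)
    (bound := fun _ => C) Filter.univ_mem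
    (Filter.Eventually.of_forall fun s =>
      (hΦ.comp (continuous_const_mul (g s))).aestronglyMeasurable)
    ((hΦ.comp (continuous_const_mul (g 0))).integrable_of_hasCompactSupport
      (HasCompactSupport.of_compactSpace _))
    (hΨ.comp (continuous_const_mul (g 0))).aestronglyMeasurable
    (Filter.Eventually.of_forall fun X s _ => hC _ (Set.mem_univ _))
    (integrable_const C)
    (Filter.Eventually.of_forall fun X s _ => h X s)).2
  simp_rw [integral_mul_left_eq_self] at key
  exact key.unique (hasDerivAt_const _ _)

/-- The derivative of `X ↦ tr (B' X ^ k) ∏ tr (X ^ κ a)` in the direction `B * X`. -/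
def traceDeriv {α : Type*} [DecidableEq α] (B B' : Matrix (Fin N) (Fin N) ℂ) (k : ℤ)
    (s : Finset α) (κ : α → ℤ) (X : Matrix.unitaryGroup (Fin N) ℂ) : ℂ :=
  (B' * powDeriv B k X).trace * ∏ a ∈ s, powTrace X (κ a) +
    (B' * matPow X k).trace *
      ∑ a ∈ s, (κ a * (B * matPow X (κ a)).trace) * ∏ b ∈ s.erase a, powTrace X (κ b)

theorem trace_powDeriv (B : Matrix (Fin N) (Fin N) ℂ) (k : ℤ)
    (X : Matrix.unitaryGroup (Fin N) ℂ) :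
    (powDeriv B k X).trace = k * (B * matPow X k).trace := by
  rw [powDeriv, ← Matrix.traceAddMonoidHom_apply, map_signedSum]
  rw [signedSum_congr (g := fun _ => (B * matPow X k).trace), signedSum_const]
  intro m
  rw [Matrix.traceAddMonoidHom_apply, Matrix.trace_mul_comm, ← mul_assoc, ← matPow_add,
    Matrix.trace_mul_comm]
  congr 3; ring

theorem powDeriv_add_smul (B C : Matrix (Fin N) (Fin N) ℂ) (c : ℂ) (k : ℤ)
    (X : Matrix.unitaryGroup (Fin N) ℂ) :
    powDeriv (B + c • C) k X = powDeriv B k X + c • powDeriv C k X := by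
  simp only [powDeriv, signedSum, mul_add, add_mul, Finset.sum_add_distrib, Matrix.mul_smul,
    Matrix.smul_mul, ← Finset.smul_sum, smul_sub]
  abel

theorem traceDeriv_add_smul {α : Type*} [DecidableEq α] (B C B' : Matrix (Fin N) (Fin N) ℂ)
    (c : ℂ) (k : ℤ) (s : Finset α) (κ : α → ℤ) (X : Matrix.unitaryGroup (Fin N) ℂ) :
    traceDeriv (B + c • C) B' k s κ X = traceDeriv B B' k s κ X + c * traceDeriv C B' k s κ X := by
  simp only [traceDeriv, powDeriv_add_smul, mul_add, add_mul, Matrix.trace_add, Matrix.mul_smul,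
    Matrix.smul_mul, Matrix.trace_smul, smul_eq_mul, Finset.sum_add_distrib]
  have : ∀ a : α, (κ a : ℂ) * (c * (C * matPow X (κ a)).trace) *
      ∏ b ∈ s.erase a, powTrace X (κ b) =
      c * (κ a * (C * matPow X (κ a)).trace * ∏ b ∈ s.erase a, powTrace X (κ b)) := by
    intro a; ring
  simp_rw [this, ← Finset.mul_sum]
  ring

theorem continuous_powDeriv (B : Matrix (Fin N) (Fin N) ℂ) (k : ℤ) :
    Continuous fun X : Matrix.unitaryGroup (Fin N) ℂ => powDeriv B k X := by
  have h : ∀ m : ℤ, Continuous fun X : Matrix.unitaryGroup (Fin N) ℂ =>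
      matPow X (k - m) * B * matPow X m := fun m =>
    ((continuous_matPow _).mul continuous_const).mul (continuous_matPow m)
  exact (continuous_finsetSum _ fun m _ => h m).sub (continuous_finsetSum _ fun m _ => h m)

theorem continuous_traceDeriv {α : Type*} [DecidableEq α] (B B' : Matrix (Fin N) (Fin N) ℂ)
    (k : ℤ) (s : Finset α) (κ : α → ℤ) :
    Continuous fun X : Matrix.unitaryGroup (Fin N) ℂ => traceDeriv B B' k s κ X := by
  refine Continuous.add (Continuous.mul ?_ ?_) (Continuous.mul ?_ ?_)
  · exact (continuous_const.mul (continuous_powDeriv B k)).matrix_trace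
  · exact continuous_finsetProd _ fun a _ => continuous_powTrace _
  · exact (continuous_const.mul (continuous_matPow k)).matrix_trace
  · refine continuous_finsetSum _ fun a _ => ((continuous_const.mul ?_)).mul ?_
    · exact (continuous_const.mul (continuous_matPow _)).matrix_trace
    · exact continuous_finsetProd _ fun a _ => continuous_powTrace _

open scoped Matrix.Norms.L2Operator in
theorem hasDerivAt_matrix_trace {u : ℝ → Matrix (Fin N) (Fin N) ℂ} {u' : Matrix (Fin N) (Fin N) ℂ}
    {s : ℝ} (h : HasDerivAt u u' s) : HasDerivAt (fun s => (u s).trace) u'.trace s :=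
  ((Matrix.traceLinearMap (Fin N) ℝ ℂ).toContinuousLinearMap.hasFDerivAt).comp_hasDerivAt s h

theorem trace_single_mul (i j : Fin N) (Y : Matrix (Fin N) (Fin N) ℂ) :
    (Matrix.single i j 1 * Y).trace = Y j i := by
  rw [Matrix.trace_single_mul]; exact one_mul _

/-- Summing over dual pairs of matrix units has two effects: inside one trace it splits the trace
into two (`h1`), and across two traces it merges them into one (`h2`). -/
theorem sum_traceDeriv {α : Type*} [DecidableEq α] (k : ℤ) (s : Finset α) (κ : α → ℤ)
    (X : Matrix.unitaryGroup (Fin N) ℂ) :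
    ∑ i, ∑ j, traceDeriv (Matrix.single i j 1) (Matrix.single j i 1) k s κ X =
      sdExpr (powTrace X) k s κ := by
  have h1 : ∀ Y Z : Matrix (Fin N) (Fin N) ℂ,
      ∑ i, ∑ j, (Matrix.single j i 1 * (Y * Matrix.single i j 1 * Z)).trace =
        Y.trace * Z.trace := by
    intro Y Z
    rw [Matrix.trace, Matrix.trace, Finset.sum_mul_sum]
    refine Finset.sum_congr rfl fun i _ => Finset.sum_congr rfl fun j _ => ?_
    rw [trace_single_mul, Matrix.mul_assoc, Matrix.mul_apply, Finset.sum_eq_single i]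
    · simp
    · intro l _ hl
      rw [Matrix.single_mul_apply_of_ne _ _ _ _ _ hl, mul_zero]
    · simp
  have h2 : ∀ Y Z : Matrix (Fin N) (Fin N) ℂ,
      ∑ i, ∑ j, (Matrix.single j i 1 * Y).trace * (Matrix.single i j 1 * Z).trace =
        (Y * Z).trace := by
    intro Y Z
    simp_rw [trace_single_mul, Matrix.trace, Matrix.diag, Matrix.mul_apply]
  have h3 : ∑ i, ∑ j, (Matrix.single j i 1 * powDeriv (Matrix.single i j 1) k X).trace =
      signedSum k fun m => powTrace X m * powTrace X (k - m) := by
    have : ∀ i j, (Matrix.single j i 1 * powDeriv (Matrix.single i j 1) k X).trace =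
        signedSum k fun m => (Matrix.single j i 1 *
          (matPow X (k - m) * Matrix.single i j 1 * matPow X m)).trace := by
      intro i j
      rw [powDeriv]
      exact map_signedSum ((Matrix.traceAddMonoidHom (Fin N) ℂ).comp
        (AddMonoidHom.mulLeft (Matrix.single j i 1))) _ _
    simp_rw [this, ← signedSum_sum]
    refine signedSum_congr fun m => ?_
    rw [h1, mul_comm]; rfl
  simp_rw [traceDeriv, Finset.sum_add_distrib]
  rw [sdExpr, ← h3]
  simp_rw [Finset.sum_mul]
  congr 1
  simp_rw [Finset.mul_sum]
  rw [Finset.sum_congr rfl fun i _ => Finset.sum_comm, Finset.sum_comm]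
  refine Finset.sum_congr rfl fun a _ => ?_
  rw [powTrace, matPow_add, ← h2, Finset.mul_sum, Finset.sum_mul]
  refine Finset.sum_congr rfl fun i _ => ?_
  rw [Finset.mul_sum, Finset.sum_mul]
  refine Finset.sum_congr rfl fun j _ => ?_
  ring

theorem continuous_sdExpr_powTrace {α : Type*} [DecidableEq α] (k : ℤ) (s : Finset α)
    (κ : α → ℤ) :
    Continuous fun X : Matrix.unitaryGroup (Fin N) ℂ => sdExpr (powTrace X) k s κ := by
  simp_rw [← sum_traceDeriv]
  exact continuous_finsetSum _ fun i _ => continuous_finsetSum _ fun j _ =>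
    continuous_traceDeriv _ _ _ _ _

variable [MeasurableSpace (Matrix.unitaryGroup (Fin N) ℂ)]
  [BorelSpace (Matrix.unitaryGroup (Fin N) ℂ)] (μ : Measure (Matrix.unitaryGroup (Fin N) ℂ))
  [μ.IsMulLeftInvariant] [IsFiniteMeasure μ]

omit [μ.IsMulLeftInvariant] in
theorem integrable_of_continuous {F : Matrix.unitaryGroup (Fin N) ℂ → ℂ} (hF : Continuous F) :
    Integrable F μ :=
  hF.integrable_of_hasCompactSupport (HasCompactSupport.of_compactSpace _)

open scoped Matrix.Norms.L2Operator in
theorem integral_traceDeriv_of_skew {α : Type*} [DecidableEq α] {B : Matrix (Fin N) (Fin N) ℂ}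
    (hB : star B = -B) (B' : Matrix (Fin N) (Fin N) ℂ) (k : ℤ) (s : Finset α) (κ : α → ℤ) :
    ∫ X, traceDeriv B B' k s κ X ∂μ = 0 := by
  obtain ⟨g, hg⟩ := exists_curve hB
  refine integral_eq_zero_of_hasDerivAt μ
    (Φ := fun X => (B' * matPow X k).trace * ∏ a ∈ s, powTrace X (κ a))
    (((continuous_const.mul (continuous_matPow k)).matrix_trace).mul
      (continuous_finsetProd _ fun a _ => continuous_powTrace _))
    (continuous_traceDeriv B B' k s κ) g fun X t => ?_
  have hpow := fun k => hasDerivAt_matPow hB (fun s => g s * X) (hg X) k t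
  have h1 := hasDerivAt_matrix_trace ((hpow k).const_mul B')
  have h2 : HasDerivAt (fun t => ∏ a ∈ s, powTrace (g t * X) (κ a)) _ t :=
    HasDerivAt.fun_finsetProd fun a _ => hasDerivAt_matrix_trace (hpow (κ a))
  refine (h1.mul h2).congr_deriv ?_
  rw [traceDeriv]
  congr 2
  refine Finset.sum_congr rfl fun a _ => ?_
  rw [trace_powDeriv, smul_eq_mul, mul_comm]

/-- The expression is complex linear in `B`, and every matrix is `B₁ + i B₂` with both parts
skew-Hermitian. This admits matrix units as directions although they need not be tangent to the
group. -/
theorem integral_traceDeriv {α : Type*} [DecidableEq α] (B B' : Matrix (Fin N) (Fin N) ℂ) (k : ℤ)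
    (s : Finset α) (κ : α → ℤ) : ∫ X, traceDeriv B B' k s κ X ∂μ = 0 := by
  set B₁ : Matrix (Fin N) (Fin N) ℂ := (1 / 2 : ℂ) • (B - star B) with hB₁
  set B₂ : Matrix (Fin N) (Fin N) ℂ := (-Complex.I / 2 : ℂ) • (B + star B) with hB₂
  have h₁ : star B₁ = -B₁ := by
    rw [hB₁, star_smul, star_sub, star_star, ← smul_neg, neg_sub]
    congr 1
    simp
  have h₂ : star B₂ = -B₂ := by
    rw [hB₂, star_smul, star_add, star_star, ← neg_smul, add_comm]
    congr 1
    simp [neg_div]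
  have hB : B = B₁ + Complex.I • B₂ := by
    rw [hB₁, hB₂, smul_smul]
    have : Complex.I * (-Complex.I / 2) = 1 / 2 := by
      rw [mul_div_assoc', mul_neg, Complex.I_mul_I, neg_neg]
    rw [this, ← smul_add, sub_add_add_cancel, ← two_smul ℂ B, smul_smul]
    norm_num
  rw [hB]
  simp_rw [traceDeriv_add_smul]
  rw [integral_add (integrable_of_continuous μ (continuous_traceDeriv _ _ _ _ _))
    ((integrable_of_continuous μ (continuous_traceDeriv _ _ _ _ _)).const_mul _),
    integral_const_mul, integral_traceDeriv_of_skew μ h₁, integral_traceDeriv_of_skew μ h₂]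
  simp

/-- The Schwinger–Dyson (loop) equations for the unitary group. -/
theorem integral_sdExpr_powTrace {α : Type*} [DecidableEq α] (k : ℤ) (s : Finset α) (κ : α → ℤ) :
    ∫ X, sdExpr (powTrace X) k s κ ∂μ = 0 := by
  simp_rw [← sum_traceDeriv]
  rw [integral_finsetSum]
  · refine Finset.sum_eq_zero fun i _ => ?_
    rw [integral_finsetSum]
    · exact Finset.sum_eq_zero fun j _ => integral_traceDeriv μ _ _ _ _ _
    · exact fun j _ => integrable_of_continuous μ (continuous_traceDeriv _ _ _ _ _)
  · exact fun i _ => integrable_of_continuous μ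
      (continuous_finsetSum _ fun j _ => continuous_traceDeriv _ _ _ _ _)

theorem integral_loopExpr_powTrace {α : Type*} [DecidableEq α] (s : Finset α) (κ : α → ℤ) :
    ∫ X, loopExpr (powTrace X) s κ ∂μ = 0 := by
  simp_rw [loopExpr]
  rw [integral_finsetSum]
  · refine Finset.sum_eq_zero fun a _ => ?_
    rw [integral_const_mul, integral_sdExpr_powTrace, mul_zero]
  · exact fun a _ => (integrable_of_continuous μ (continuous_sdExpr_powTrace _ _ _)).const_mul _

end Group

/-! ### Traces, eigenangles and the Weyl integration formula. -/

section Spectral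

variable {N : ℕ}

open Polynomial in
theorem det_aeval_of_charpoly_eq {A : Matrix (Fin N) (Fin N) ℂ} {ζ : Fin N → ℂ}
    (h : A.charpoly = ∏ j, (X - C (ζ j))) (p : ℂ[X]) :
    (aeval A p).det = ∏ j, p.eval (ζ j) := by
  have hlin : ∀ s : ℂ, (aeval A (X - C s)).det = ∏ j, (X - C s).eval (ζ j) := by
    intro s
    have h1 : aeval A (X - C s) = -(Matrix.scalar (Fin N) s - A) := by
      rw [map_sub, aeval_X, aeval_C, neg_sub]
      rfl
    rw [h1, Matrix.det_neg, ← Matrix.eval_charpoly, h, eval_prod, Fintype.card_fin]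
    have h2 : ((-1 : ℂ)) ^ N = ∏ _j : Fin N, (-1) := by simp
    rw [h2, ← Finset.prod_mul_distrib]
    exact Finset.prod_congr rfl fun j _ => by simp
  have hprod : ∀ m : Multiset ℂ, (aeval A (m.map fun s => X - C s).prod).det =
      ∏ j, ((m.map fun s => X - C s).prod).eval (ζ j) := by
    intro m
    induction m using Multiset.induction_on with
    | empty => simp
    | cons s m ih =>
      rw [Multiset.map_cons, Multiset.prod_cons, map_mul, Matrix.det_mul, ih, hlin,
        ← Finset.prod_mul_distrib]
      exact Finset.prod_congr rfl fun j _ => eval_mul.symm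
  rw [(IsAlgClosed.splits p).eq_prod_roots, map_mul, Matrix.det_mul, hprod, aeval_C,
    Algebra.algebraMap_eq_smul_one, Matrix.det_smul, Matrix.det_one, mul_one]
  simp_rw [eval_mul, Finset.prod_mul_distrib, eval_C]
  simp

open Polynomial in
-- The characteristic polynomial of `A ^ k` at `s` is the determinant of `p(A)` for `p = s - X ^ k`;
-- spectral mapping with multiplicity then gives its roots.
theorem trace_pow_of_charpoly_eq {A : Matrix (Fin N) (Fin N) ℂ} {ζ : Fin N → ℂ}
    (h : A.charpoly = ∏ j, (X - C (ζ j))) (k : ℕ) : (A ^ k).trace = ∑ j, ζ j ^ k := by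
  have hc : (A ^ k).charpoly = ∏ j, (X - C (ζ j ^ k)) := by
    refine Polynomial.funext fun s => ?_
    have h1 := det_aeval_of_charpoly_eq h (C s - X ^ k)
    rw [Matrix.eval_charpoly, eval_prod]
    simp only [map_sub, map_pow, aeval_X, aeval_C, eval_sub, eval_C, eval_pow, eval_X] at h1 ⊢
    exact h1
  have hm : ∏ j, (X - C (ζ j ^ k)) =
      ((Finset.univ.val.map fun j => ζ j ^ k).map fun a => X - C a).prod := by
    rw [Multiset.map_map]; rfl
  rw [Matrix.trace_eq_sum_roots_charpoly, hc, hm, roots_multiset_prod_X_sub_C]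
  rfl

theorem powTrace_eq {X : Matrix.unitaryGroup (Fin N) ℂ} {θ : Fin N → ℝ} (h : IsEigenangles X θ)
    (k : ℤ) : powTrace X k = ∑ j, Complex.exp (Complex.I * (k * θ j)) := by
  have hnat : ∀ n : ℕ, powTrace X n = ∑ j, Complex.exp (Complex.I * (n * θ j)) := by
    intro n
    rw [powTrace, matPow, zpow_natCast, SubmonoidClass.coe_pow, trace_pow_of_charpoly_eq h.2]
    refine Finset.sum_congr rfl fun j _ => ?_
    rw [← Complex.exp_nat_mul]
    congr 1; ring
  obtain ⟨n, rfl | rfl⟩ := k.eq_nat_or_neg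
  · simpa using hnat n
  · rw [powTrace, matPow_neg, Matrix.star_eq_conjTranspose, Matrix.trace_conjTranspose]
    refine (congrArg star (hnat n)).trans ?_
    rw [star_sum]
    refine Finset.sum_congr rfl fun j _ => ?_
    rw [Complex.star_def, ← Complex.exp_conj]
    congr 1
    simp

/-- Evaluation of a Laurent polynomial at `z_j = exp (i θ_j)`. -/
def evalAngle (θ : Fin N → ℂ) : Laurent N →ₐ[ℂ] ℂ :=
  AddMonoidAlgebra.lift ℂ ℂ (Fin N → ℤ)
    { toFun := fun m => Complex.exp (Complex.I * ∑ i, (Multiplicative.toAdd m i) * θ i)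
      map_one' := by simp
      map_mul' := fun m l => by
        rw [← Complex.exp_add, ← mul_add, ← Finset.sum_add_distrib]
        simp [add_mul] }

theorem evalAngle_single (θ : Fin N → ℂ) (m : Fin N → ℤ) (c : ℂ) :
    evalAngle θ (AddMonoidAlgebra.single m c) =
      c * Complex.exp (Complex.I * ∑ i, m i * θ i) := by
  rw [evalAngle, AddMonoidAlgebra.lift_single]
  rfl

theorem evalAngle_zmono (θ : Fin N → ℂ) (i : Fin N) (k : ℤ) :
    evalAngle θ (zmono i k) = Complex.exp (Complex.I * (k * θ i)) := by
  rw [zmono, evalAngle_single, one_mul, Finset.sum_eq_single i]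
  · simp
  · intro j _ hj
    simp [hj]
  · simp

/-- Evaluation of a Laurent polynomial at the eigenvalues of a unitary matrix. -/
def evalUnitary (X : Matrix.unitaryGroup (Fin N) ℂ) : Laurent N →ₐ[ℂ] ℂ :=
  evalAngle fun i => (eigenangle X i : ℂ)

theorem evalUnitary_psum (X : Matrix.unitaryGroup (Fin N) ℂ) (k : ℤ) :
    evalUnitary X (psum N k) = powTrace X k := by
  rw [psum, map_sum, powTrace_eq (exists_isEigenangles X).choose_spec]
  exact Finset.sum_congr rfl fun i _ => evalAngle_zmono _ i k

/-- `eigenangle` is an arbitrary choice and carries no continuity; power sums of the eigenvalues are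
traces of powers and do. -/
theorem continuous_evalUnitary {F : Laurent N} (hF : F ∈ psumAlgebra N) :
    Continuous fun X : Matrix.unitaryGroup (Fin N) ℂ => evalUnitary X F := by
  induction hF using Algebra.adjoin_induction with
  | mem x hx =>
    obtain ⟨k, rfl⟩ := hx
    simp_rw [evalUnitary_psum]
    exact continuous_powTrace k
  | algebraMap r => simp_rw [AlgHom.commutes]; exact continuous_const
  | add x y _ _ hx hy => simp_rw [map_add]; exact hx.add hy
  | mul x y _ _ hx hy => simp_rw [map_mul]; exact hx.mul hy

theorem evalUnitary_loopExpr {α : Type*} [DecidableEq α] (X : Matrix.unitaryGroup (Fin N) ℂ)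
    (s : Finset α) (κ : α → ℤ) :
    evalUnitary X (loopExpr (psum N) s κ) = loopExpr (powTrace X) s κ := by
  have h := map_loopExpr (evalUnitary X : Laurent N →+* ℂ) (psum N) s κ
  simp only [RingHom.coe_coe, evalUnitary_psum] at h
  exact h

/-- The Weyl integration formula for the algebra generated by the power sums. -/
theorem integral_evalUnitary [MeasurableSpace (Matrix.unitaryGroup (Fin N) ℂ)]
    [BorelSpace (Matrix.unitaryGroup (Fin N) ℂ)] (μ : Measure (Matrix.unitaryGroup (Fin N) ℂ))
    [μ.IsMulLeftInvariant] [IsProbabilityMeasure μ] {F : Laurent N} (hF : F ∈ psumAlgebra N) :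
    ∫ X, evalUnitary X F ∂μ = (vdm N * F).coeff (fun i => ((i : ℕ) : ℤ)) := by
  have key : ∀ x ∈ loopSpan N, ∫ X, evalUnitary X x ∂μ = 0 := by
    intro x hx
    induction hx using Submodule.span_induction with
    | mem x hx =>
      obtain ⟨r, κ, rfl⟩ := hx
      simp_rw [evalUnitary_loopExpr]
      exact integral_loopExpr_powTrace μ _ _
    | zero => simp
    | add x y hx hy ihx ihy =>
      simp_rw [map_add]
      rw [integral_add (integrable_of_continuous μ (continuous_evalUnitary (loopSpan_le hx)))
        (integrable_of_continuous μ (continuous_evalUnitary (loopSpan_le hy))), ihx, ihy, add_zero]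
    | smul c x hx ih =>
      simp_rw [map_smul, smul_eq_mul]
      rw [integral_const_mul, ih, mul_zero]
  have h := key _ (sub_coeff_mem_loopSpan hF)
  simp_rw [map_sub, AlgHom.commutes] at h
  rw [integral_sub (integrable_of_continuous μ (continuous_evalUnitary hF)) (integrable_const _),
    integral_const, sub_eq_zero] at h
  simpa using h

end Spectral

/-! ### Sums over distinct indices. -/

section DistinctSums

variable {N n : ℕ}

theorem sum_embedding_eq {ι κ M : Type*} [Fintype ι] [Fintype κ] [DecidableEq ι] [DecidableEq κ]
    [AddCommMonoid M] (f : (ι → κ) → M) :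
    ∑ e : ι ↪ κ, f e = ∑ a : ι → κ, if Function.Injective a then f a else 0 := by
  rw [← Finset.sum_filter, ← (Equiv.subtypeInjectiveEquivEmbedding ι κ).sum_comp]
  exact (Finset.sum_subtype _ (by simp) f).symm

/-- The sum of `∏ z_{a m} ^ k m` over injective `a`. -/
def distinctMono (N : ℕ) (k : Fin n → ℤ) : Laurent N :=
  ∑ e : Fin n ↪ Fin N, ∏ m, zmono (e m) (k m)

/-- An unrestricted new index either avoids the old ones or coincides with exactly one of them, and
then the two exponents add. -/
theorem distinctMono_cons (k₀ : ℤ) (k : Fin n → ℤ) :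
    distinctMono N (Fin.cons k₀ k : Fin (n + 1) → ℤ) = psum N k₀ * distinctMono N k -
      ∑ l, distinctMono N (Function.update k l (k l + k₀)) := by
  have hupd : ∀ (a : Fin n → Fin N) (l : Fin n),
      ∏ m, zmono (a m) (Function.update k l (k l + k₀) m) =
        zmono (a l) k₀ * ∏ m, zmono (a m) (k m) := by
    intro a l
    rw [← Finset.mul_prod_erase _ _ (Finset.mem_univ l),
      ← Finset.mul_prod_erase _ (fun m => zmono (a m) (k m)) (Finset.mem_univ l),
      Function.update_self, add_comm, zmono_add, mul_assoc]
    congr 2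
    refine Finset.prod_congr rfl fun m hm => ?_
    rw [Function.update_of_ne (Finset.ne_of_mem_erase hm)]
  have hfun : ∀ k : Fin n → ℤ, distinctMono N k = ∑ a : Fin n → Fin N,
      if Function.Injective a then ∏ m, zmono (a m) (k m) else 0 := fun k =>
    sum_embedding_eq fun a : Fin n → Fin N => ∏ m, zmono (a m) (k m)
  simp_rw [hfun, hupd]
  rw [Finset.sum_comm, Finset.mul_sum, ← Finset.sum_sub_distrib, distinctMono,
    sum_embedding_eq fun a : Fin (n + 1) → Fin N =>
      ∏ m, zmono (a m) ((Fin.cons k₀ k : Fin (n + 1) → ℤ) m),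
    ← (Fin.consEquiv fun _ : Fin (n + 1) => Fin N).sum_comp, Fintype.sum_prod_type_right]
  refine Finset.sum_congr rfl fun a _ => ?_
  have hinj : ∀ x : Fin N,
      Function.Injective (Fin.consEquiv (fun _ : Fin (n + 1) => Fin N) (x, a)) ↔
      x ∉ Set.range a ∧ Function.Injective a := fun x => Fin.cons_injective_iff
  simp only [hinj, Fin.consEquiv_apply, Fin.prod_univ_succ, Fin.cons_zero,
    Fin.cons_succ]
  by_cases ha : Function.Injective a
  · simp only [ha, and_true, if_true]
    rw [← Finset.sum_mul, ← sub_mul, ← Finset.sum_filter, ← Finset.sum_mul]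
    congr 1
    have h1 : ∑ l, zmono (a l) k₀ = ∑ x ∈ Finset.univ.filter (· ∈ Set.range a), zmono x k₀ := by
      rw [← Finset.sum_image (f := fun x => zmono x k₀) (s := Finset.univ) fun x _ y _ h => ha h]
      congr 1
      ext x; simp
    rw [h1, psum, eq_sub_iff_add_eq, add_comm, Finset.sum_filter_add_sum_filter_not]
  · simp [ha]

theorem distinctMono_mem (k : Fin n → ℤ) : distinctMono N k ∈ psumAlgebra N := by
  induction n with
  | zero =>
    rw [distinctMono]
    simp only [Finset.univ_eq_empty, Finset.prod_empty]
    exact sum_mem fun _ _ => one_mem _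
  | succ n ih =>
    rw [← Fin.cons_self_tail k, distinctMono_cons]
    exact sub_mem (mul_mem (psum_mem _) (ih _)) (sum_mem fun _ _ => ih _)

theorem evalAngle_distinctMono (θ : Fin N → ℂ) (k : Fin n → ℤ) :
    evalAngle θ (distinctMono N k) =
      ∑ e : Fin n ↪ Fin N, Complex.exp (Complex.I * ∑ m, k m * θ (e m)) := by
  simp_rw [distinctMono, map_sum, map_prod, evalAngle_zmono, ← Complex.exp_sum, Finset.mul_sum]

theorem prod_zmono (a : Fin n → Fin N) (k : Fin n → ℤ) :
    ∏ m, zmono (a m) (k m) = AddMonoidAlgebra.single (∑ m, Pi.single (a m) (k m)) 1 := by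
  simp_rw [zmono]
  have h := map_prod (AddMonoidAlgebra.of ℂ (Fin N → ℤ))
    (fun m => Multiplicative.ofAdd (Pi.single (a m) (k m) : Fin N → ℤ)) Finset.univ
  simp only [AddMonoidAlgebra.of_apply] at h
  rw [toAdd_prod] at h
  exact h.symm

/-- The Leibniz expansion of the Vandermonde determinant makes this coefficient an `N × N`
determinant of Kronecker deltas. Rows outside the range of `e` are rows of the identity, so only the
block indexed by `e` matters. -/
theorem coeff_vdm_mul_prod_zmono (e : Fin n ↪ Fin N) (k : Fin n → ℤ) :
    (vdm N * ∏ m, zmono (e m) (k m)).coeff (fun i => ((i : ℕ) : ℤ)) =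
      (Matrix.of fun m l : Fin n =>
        if ((e l : ℕ) : ℤ) + k m = ((e m : ℕ) : ℤ) then (1 : ℂ) else 0).det := by
  set c : Fin N → ℤ := ∑ m, Pi.single (e m) (k m) with hc
  have hce : ∀ m, c (e m) = k m := by
    intro m
    rw [hc, Finset.sum_apply, Finset.sum_eq_single m, Pi.single_eq_same]
    · intro l _ hl
      exact Pi.single_eq_of_ne (fun h => hl (e.injective h).symm) _
    · simp
  have hc0 : ∀ i, i ∉ Set.range e → c i = 0 := by
    intro i hi
    rw [hc, Finset.sum_apply]
    exact Finset.sum_eq_zero fun m _ => Pi.single_eq_of_ne (fun h => hi ⟨m, h.symm⟩) _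
  set D : Matrix (Fin N) (Fin N) ℂ :=
    Matrix.of fun i j => if ((j : ℕ) : ℤ) + c i = ((i : ℕ) : ℤ) then 1 else 0 with hD
  have h1 : (vdm N * ∏ m, zmono (e m) (k m)).coeff (fun i => ((i : ℕ) : ℤ)) = D.det := by
    rw [prod_zmono, ← hc, vdm_eq_sum, Finset.sum_mul, ← Matrix.det_transpose, Matrix.det_apply,
      AddMonoidAlgebra.coeff_sum, Finsupp.finsetSum_apply]
    refine Finset.sum_congr rfl fun σ _ => ?_
    rw [AddMonoidAlgebra.single_mul_single, AddMonoidAlgebra.coeff_single, Finsupp.single_apply,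
      mul_one]
    simp only [Matrix.transpose_apply, hD, Matrix.of_apply, Finset.prod_boole, Finset.mem_univ,
      true_imp_iff, funext_iff, Pi.add_apply]
    split_ifs
    · rcases Int.units_eq_one_or (Equiv.Perm.sign σ) with h | h <;> simp [h]
    · simp
  rw [h1, Matrix.twoBlockTriangular_det D (· ∈ Set.range e)]
  · have h2 : (D.toSquareBlockProp fun i => i ∉ Set.range e) = 1 := by
      ext ⟨i, hi⟩ ⟨j, hj⟩
      simp only [Matrix.toSquareBlockProp_def, hD, Matrix.of_apply, hc0 i hi, add_zero,
        Nat.cast_inj, Matrix.one_apply, Subtype.mk.injEq, Fin.val_inj, eq_comm]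
    rw [h2, Matrix.det_one, mul_one]
    let E : Fin n ≃ {i // i ∈ Set.range e} := Equiv.ofInjective e e.injective
    have h3 : (D.toSquareBlockProp (· ∈ Set.range e)).submatrix E E = Matrix.of fun m l : Fin n =>
        if ((e l : ℕ) : ℤ) + k m = ((e m : ℕ) : ℤ) then (1 : ℂ) else 0 := by
      ext m l
      change (if ((e l : ℕ) : ℤ) + c (e m) = ((e m : ℕ) : ℤ) then (1 : ℂ) else 0) = _
      rw [hce, Matrix.of_apply]
    rw [← h3]
    convert (Matrix.det_submatrix_equiv_self E _).symm
  · intro i hi j hj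
    rw [hD, Matrix.of_apply, hc0 i hi, add_zero, if_neg]
    intro h
    refine hi ?_
    rwa [← Fin.val_injective (Nat.cast_injective h)]

/-- The sum may run over all `a`, because a repeated value gives two equal columns. -/
theorem coeff_vdm_mul_distinctMono (k : Fin n → ℤ) :
    (vdm N * distinctMono N k).coeff (fun i => ((i : ℕ) : ℤ)) =
      ∑ a : Fin n → Fin N, (Matrix.of fun m l : Fin n =>
        if ((a l : ℕ) : ℤ) + k m = ((a m : ℕ) : ℤ) then (1 : ℂ) else 0).det := by
  rw [distinctMono, Finset.mul_sum, AddMonoidAlgebra.coeff_sum, Finsupp.finsetSum_apply]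
  simp_rw [coeff_vdm_mul_prod_zmono]
  rw [sum_embedding_eq fun a : Fin n → Fin N => (Matrix.of fun m l : Fin n =>
        if ((a l : ℕ) : ℤ) + k m = ((a m : ℕ) : ℤ) then (1 : ℂ) else 0).det]
  refine Finset.sum_congr rfl fun a _ => ?_
  split_ifs with ha
  · rfl
  · obtain ⟨i, j, hij, hne⟩ := Function.not_injective_iff.1 ha
    exact (Matrix.det_zero_of_column_eq hne fun m => by simp [hij]).symm

/-- The matrix `(∑_{a < N} e^{i a (θ_k - θ_j)})_{j, k}`. -/
def dysonMatrix (N : ℕ) (θ : Fin n → ℂ) : Matrix (Fin n) (Fin n) ℂ :=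
  Matrix.of fun j k => ∑ a : Fin N, Complex.exp (Complex.I * ((a : ℕ) * (θ k - θ j)))

/-- Linearity in each row pulls out the sums over `a`; what remains are pure exponentials with
integer frequencies. -/
theorem det_dysonMatrix (θ : Fin n → ℂ) :
    (dysonMatrix N θ).det = ∑ a : Fin n → Fin N, ∑ σ : Equiv.Perm (Fin n),
      (Equiv.Perm.sign σ : ℂ) *
        Complex.exp (Complex.I * ∑ m, (((a (σ m) : ℕ) : ℤ) - ((a m : ℕ) : ℤ) : ℤ) * θ m) := by
  have h1 : (dysonMatrix N θ).det = ∑ a : Fin n → Fin N, (Matrix.of fun j k =>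
      Complex.exp (Complex.I * ((a j : ℕ) * (θ k - θ j)))).det := by
    have h := (Matrix.detRowAlternating (n := Fin n) (R := ℂ)).toMultilinearMap.map_sum
      (fun (j : Fin n) (a : Fin N) (k : Fin n) =>
        Complex.exp (Complex.I * ((a : ℕ) * (θ k - θ j))))
    refine Eq.trans ?_ h
    congr 1
    ext j k
    simp [dysonMatrix]
  rw [h1]
  refine Finset.sum_congr rfl fun a _ => ?_
  rw [Matrix.det_apply']
  refine Finset.sum_congr rfl fun σ _ => ?_
  simp only [Matrix.of_apply]
  rw [← Complex.exp_sum, ← Finset.mul_sum]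
  congr 3
  simp only [mul_sub, Int.cast_sub, sub_mul, Finset.sum_sub_distrib, Int.cast_natCast]
  rw [Equiv.sum_comp σ fun i => ((a i : ℕ) : ℂ) * θ i]

end DistinctSums

/-! ### Fourier coefficients of the Dyson determinant. -/

section Fourier

variable {N n : ℕ}

theorem integral_exp_int (l : ℤ) :
    ∫ t in Set.Icc (0 : ℝ) (2 * Real.pi), Complex.exp (Complex.I * (l * t)) =
      if l = 0 then 2 * (Real.pi : ℂ) else 0 := by
  rw [integral_Icc_eq_integral_Ioc, ← intervalIntegral.integral_of_le Real.two_pi_pos.le]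
  split_ifs with h
  · simp [h]
  · have hc : Complex.I * l ≠ 0 := mul_ne_zero Complex.I_ne_zero (Int.cast_ne_zero.2 h)
    simp_rw [← mul_assoc]
    rw [integral_exp_mul_complex hc]
    have : Complex.exp (Complex.I * l * ((2 * Real.pi : ℝ) : ℂ)) = 1 := by
      rw [Complex.exp_eq_one_iff]
      exact ⟨l, by push_cast; ring⟩
    rw [this]
    simp

theorem integral_cube_exp (l : Fin n → ℤ) :
    ∫ θ in Set.Icc (fun _ : Fin n => (0 : ℝ)) (fun _ => 2 * Real.pi),
      Complex.exp (Complex.I * ∑ m, l m * (θ m : ℂ)) =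
        if ∀ m, l m = 0 then (2 * (Real.pi : ℂ)) ^ n else 0 := by
  rw [← Set.pi_univ_Icc, volume_pi, Measure.restrict_pi_pi]
  simp_rw [Finset.mul_sum, Complex.exp_sum]
  rw [integral_fintype_prod_eq_prod (𝕜 := ℂ)
    (fun (m : Fin n) (t : ℝ) => Complex.exp (Complex.I * (l m * t)))]
  simp_rw [integral_exp_int]
  split_ifs with h
  · simp [h]
  · obtain ⟨m, hm⟩ := not_forall.1 h
    exact Finset.prod_eq_zero (Finset.mem_univ m) (if_neg hm)

theorem integrableOn_cube {F : (Fin n → ℝ) → ℂ} (hF : Continuous F) :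
    IntegrableOn F (Set.Icc (fun _ : Fin n => (0 : ℝ)) (fun _ => 2 * Real.pi)) volume :=
  hF.continuousOn.integrableOn_compact isCompact_Icc

/-- Orthogonality selects the pairs of `a` and `σ` with `a (σ m) + k m = a m` for all `m`. These are
the nonzero Leibniz terms in `coeff_vdm_mul_distinctMono`. -/
theorem integral_det_dysonMatrix_mul_exp (k : Fin n → ℤ) :
    ∫ θ in Set.Icc (fun _ : Fin n => (0 : ℝ)) (fun _ => 2 * Real.pi),
      (dysonMatrix N fun j => (θ j : ℂ)).det * Complex.exp (Complex.I * ∑ m, k m * (θ m : ℂ)) =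
    (2 * (Real.pi : ℂ)) ^ n * (vdm N * distinctMono N k).coeff (fun i => ((i : ℕ) : ℤ)) := by
  have h : ∀ θ : Fin n → ℝ,
      (dysonMatrix N fun j => (θ j : ℂ)).det * Complex.exp (Complex.I * ∑ m, k m * (θ m : ℂ)) =
      ∑ a : Fin n → Fin N, ∑ σ : Equiv.Perm (Fin n), (Equiv.Perm.sign σ : ℂ) *
        Complex.exp (Complex.I *
          ∑ m, (((a (σ m) : ℕ) : ℤ) - ((a m : ℕ) : ℤ) + k m : ℤ) * (θ m : ℂ)) := by
    intro θ
    rw [det_dysonMatrix, Finset.sum_mul]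
    refine Finset.sum_congr rfl fun a _ => ?_
    rw [Finset.sum_mul]
    refine Finset.sum_congr rfl fun σ _ => ?_
    rw [mul_assoc, ← Complex.exp_add, ← mul_add, ← Finset.sum_add_distrib]
    simp_rw [← add_mul, ← Int.cast_add]
  simp_rw [h]
  have hint : ∀ (a : Fin n → Fin N) (σ : Equiv.Perm (Fin n)), IntegrableOn (fun θ : Fin n → ℝ =>
      (Equiv.Perm.sign σ : ℂ) * Complex.exp (Complex.I *
          ∑ m, (((a (σ m) : ℕ) : ℤ) - ((a m : ℕ) : ℤ) + k m : ℤ) * (θ m : ℂ)))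
      (Set.Icc (fun _ : Fin n => (0 : ℝ)) (fun _ => 2 * Real.pi)) volume := fun a σ =>
    integrableOn_cube (by fun_prop)
  rw [integral_finsetSum _ fun a _ => integrable_finsetSum _ fun σ _ => hint a σ,
    coeff_vdm_mul_distinctMono, Finset.mul_sum]
  refine Finset.sum_congr rfl fun a _ => ?_
  rw [integral_finsetSum _ fun σ _ => hint a σ, ← Matrix.det_transpose, Matrix.det_apply',
    Finset.mul_sum]
  refine Finset.sum_congr rfl fun σ _ => ?_
  rw [integral_const_mul, integral_cube_exp]
  simp only [Matrix.transpose_apply, Matrix.of_apply, Finset.prod_boole, Finset.mem_univ,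
    true_imp_iff]
  have : (∀ m, ((a (σ m) : ℕ) : ℤ) - ((a m : ℕ) : ℤ) + k m = 0) ↔
      ∀ m, ((a (σ m) : ℕ) : ℤ) + k m = ((a m : ℕ) : ℤ) :=
    forall_congr' fun m => by omega
  simp_rw [this]
  split_ifs <;> ring

end Fourier

/-! ### The combinatorial sum and the Dyson kernel. -/

section Correlation

variable {N n : ℕ}

/-- A finite geometric series with ratio `x_j / x_k`, which differs from 1 off the diagonal by the
separation hypothesis. -/
theorem dysonMatrix_transpose_eq_difMatrix (θ : Fin n → ℂ)
    (hθ : ∀ j k, j ≠ k → ∀ m : ℤ, θ j - θ k ≠ 2 * (Real.pi : ℂ) * (m : ℂ)) :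
    (dysonMatrix N θ).transpose = difMatrix (fun j => Complex.exp (Complex.I * θ j))
      (fun j => Complex.exp (Complex.I * θ j) ^ N) N := by
  ext j k
  rw [Matrix.transpose_apply, dysonMatrix, difMatrix, Matrix.of_apply, Matrix.of_apply]
  split_ifs with h
  · simp [h]
  · have hk := Complex.exp_ne_zero (Complex.I * θ k)
    have hne : Complex.exp (Complex.I * θ j) / Complex.exp (Complex.I * θ k) ≠ 1 := by
      rw [Ne, div_eq_one_iff_eq hk]
      exact fun e => h (exp_injective_of_separated θ hθ e)
    have hsum : ∀ a : Fin N, Complex.exp (Complex.I * ((a : ℕ) * (θ j - θ k))) =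
        (Complex.exp (Complex.I * θ j) / Complex.exp (Complex.I * θ k)) ^ (a : ℕ) := by
      intro a
      rw [← Complex.exp_sub, ← Complex.exp_nat_mul]
      congr 1; ring
    simp_rw [hsum]
    rw [Fin.sum_univ_eq_sum_range
      (fun a => (Complex.exp (Complex.I * θ j) / Complex.exp (Complex.I * θ k)) ^ a),
      geom_sum_eq hne, div_eq_iff (sub_ne_zero.2 hne), div_pow]
    have hkj : Complex.exp (Complex.I * θ k) - Complex.exp (Complex.I * θ j) ≠ 0 := fun e =>
      hne ((div_eq_one_iff_eq hk).2 (sub_eq_zero.1 e).symm)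
    field_simp
    ring

/-- The correlation sum is the determinant of the Dyson kernel. -/
theorem correlationSum_eq_det_dysonMatrix (θ : Fin n → ℂ)
    (hθ : ∀ j k, j ≠ k → ∀ m : ℤ, θ j - θ k ≠ 2 * (Real.pi : ℂ) * (m : ℂ)) :
    correlationSum N n θ = (dysonMatrix N θ).det := by
  rw [correlationSum_eq_det_difMatrix N θ hθ, ← dysonMatrix_transpose_eq_difMatrix θ hθ,
    Matrix.det_transpose]

theorem differentiable_det_dysonMatrix :
    Differentiable ℂ fun θ : Fin n → ℂ => (dysonMatrix N θ).det := by
  simp_rw [det_dysonMatrix]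
  fun_prop

theorem continuous_det_dysonMatrix_ofReal :
    Continuous fun θ : Fin n → ℝ => (dysonMatrix N fun j => (θ j : ℂ)).det := by
  simp_rw [det_dysonMatrix]
  fun_prop

theorem volume_hyperplane_eq_zero {j k : Fin n} (hjk : j ≠ k) (c : ℝ) :
    volume {θ : Fin n → ℝ | θ j - θ k = c} = 0 := by
  let L : (Fin n → ℝ) →ₗ[ℝ] ℝ := 
    LinearMap.proj (R := ℝ) (φ := fun _ : Fin n => ℝ) j -
      LinearMap.proj (R := ℝ) (φ := fun _ : Fin n => ℝ) k
  let s : AffineSubspace ℝ (Fin n → ℝ) := (AffineSubspace.mk' c ⊥).comap L.toAffineMap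
  have hs : {θ : Fin n → ℝ | θ j - θ k = c} = (s : Set (Fin n → ℝ)) := by
    ext θ
    simp [s, L, AffineSubspace.mem_mk', sub_eq_zero]
  rw [hs]
  refine Measure.addHaar_affineSubspace volume s fun h => ?_
  have hmem : (Pi.single j (c + 1) : Fin n → ℝ) ∈ s := h ▸ AffineSubspace.mem_top ℝ _ _
  rw [← SetLike.mem_coe, ← hs] at hmem
  simp [hjk.symm] at hmem

/-- At coincident angles the combinatorial sum involves `z` and its derivatives at poles, so
equality is claimed only off countably many hyperplanes, each of measure zero. -/
theorem ae_correlationSum_eq : ∀ᵐ θ : Fin n → ℝ,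
    correlationSum N n (fun j => (θ j : ℂ)) = (dysonMatrix N fun j => (θ j : ℂ)).det := by
  have h : ∀ᵐ θ : Fin n → ℝ, ∀ j k : Fin n, ∀ m : ℤ, j ≠ k → θ j - θ k ≠ 2 * Real.pi * m := by
    simp_rw [ae_all_iff]
    intro j k m hjk
    rw [ae_iff]
    simpa using volume_hyperplane_eq_zero hjk (2 * Real.pi * m)
  filter_upwards [h] with θ hθ
  exact correlationSum_eq_det_dysonMatrix _ fun j k hjk m e => hθ j k m hjk (by exact_mod_cast e)

end Correlation

/-! ### Passage to continuous functions on the torus. -/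

section Torus

variable {N n : ℕ}

/-- The point of the torus with angles `θ`. -/
def torusPoint (θ : Fin n → ℝ) : UnitAddTorus (Fin n) :=
  fun m => ((θ m / (2 * Real.pi) : ℝ) : UnitAddCircle)

theorem continuous_torusPoint : Continuous (torusPoint (n := n)) :=
  continuous_pi fun m => (AddCircle.continuous_mk' 1).comp (by fun_prop)

theorem mFourier_torusPoint (k : Fin n → ℤ) (θ : Fin n → ℝ) :
    UnitAddTorus.mFourier k (torusPoint θ) = Complex.exp (Complex.I * ∑ m, k m * (θ m : ℂ)) := by
  change ∏ m, fourier (k m) (torusPoint θ m) = _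
  rw [Finset.mul_sum, Complex.exp_sum]
  refine Finset.prod_congr rfl fun m _ => ?_
  rw [torusPoint, fourier_coe_apply]
  congr 1
  have : (Real.pi : ℂ) ≠ 0 := by exact_mod_cast Real.pi_ne_zero
  push_cast
  field_simp

theorem apply_eq_of_sub_int {Z : Type*} {F : (Fin n → ℝ) → Z}
    (hF : ∀ t j, F (Function.update t j (t j + 1)) = F t) {a b : Fin n → ℝ}
    (h : ∀ j, ∃ m : ℤ, b j = a j + m) : F b = F a := by
  have h1 : ∀ (t : Fin n → ℝ) (j : Fin n) (m : ℤ), F (Function.update t j (t j + m)) = F t := by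
    intro t j m
    induction m using Int.induction_on with
    | zero => simp
    | succ k ih =>
      rw [← ih, ← hF (Function.update t j (t j + (k : ℤ))) j]
      simp [add_assoc]
    | pred k ih =>
      rw [← ih, ← hF (Function.update t j (t j + (-(k : ℤ) - 1 : ℤ))) j]
      simp [add_assoc]
  have h2 : ∀ s : Finset (Fin n), F (s.piecewise b a) = F a := by
    intro s
    induction s using Finset.induction_on with
    | empty => simp
    | insert j s hj ih =>
      obtain ⟨m, hm⟩ := h j
      have hja : s.piecewise b a j = a j := Finset.piecewise_eq_of_notMem _ _ _ hj
      rw [Finset.piecewise_insert, hm, ← hja, h1, ih]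
  simpa using h2 Finset.univ

/-- A continuous function on `ℝⁿ` that is `2π`-periodic in each variable is a function on the
torus. -/
theorem exists_torus_lift {g : (Fin n → ℝ) → ℂ} (hg : Continuous g)
    (hper : ∀ θ j, g (Function.update θ j (θ j + 2 * Real.pi)) = g θ) :
    ∃ φ : C(UnitAddTorus (Fin n), ℂ), ∀ θ, φ (torusPoint θ) = g θ := by
  have hπ : (2 * Real.pi) ≠ 0 := Real.two_pi_pos.ne'
  let F : C(Fin n → ℝ, ℂ) := ⟨fun t => g fun m => 2 * Real.pi * t m, by fun_prop⟩
  have hF : ∀ t j, F (Function.update t j (t j + 1)) = F t := by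
    intro t j
    change g _ = g _
    rw [← hper (fun m => 2 * Real.pi * t m) j]
    congr 1
    ext m
    by_cases h : m = j
    · subst h; simp [mul_add]
    · simp [h]
  -- Openness of the factors is what makes the product map a quotient map; products of mere quotient
  -- maps need not be.
  have hq : Topology.IsQuotientMap
      (fun (t : Fin n → ℝ) (m : Fin n) => ((t m : ℝ) : UnitAddCircle)) :=
    (IsOpenQuotientMap.piMap fun _ : Fin n =>
      (QuotientAddGroup.isOpenQuotientMap_mk (N := AddSubgroup.zmultiples (1 : ℝ)))).isQuotientMap
  let π : C(Fin n → ℝ, UnitAddTorus (Fin n)) := ⟨_, hq.continuous⟩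
  have hlift : Function.FactorsThrough F π := by
    intro a b hab
    refine (apply_eq_of_sub_int hF fun j => ?_).symm
    have hj : ((b j - a j : ℝ) : UnitAddCircle) = 0 := by
      rw [AddCircle.coe_sub, sub_eq_zero]
      exact (congrFun hab j).symm
    obtain ⟨m, hm⟩ := (AddCircle.coe_eq_zero_iff (1 : ℝ)).1 hj
    refine ⟨m, ?_⟩
    rw [zsmul_one] at hm
    rw [hm, add_sub_cancel]
  refine ⟨(show Topology.IsQuotientMap π from hq).lift F hlift, fun θ => ?_⟩
  have h := DFunLike.congr_fun ((show Topology.IsQuotientMap π from hq).lift_comp F hlift)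
    (fun m => θ m / (2 * Real.pi))
  refine h.trans ?_
  change g _ = g _
  congr 1
  ext m
  field_simp

/-- The sum of a function on the torus over the tuples of distinct eigenangles. -/
def torusSum (φ : UnitAddTorus (Fin n) → ℂ) (X : Matrix.unitaryGroup (Fin N) ℂ) : ℂ :=
  ∑ e : Fin n ↪ Fin N, φ (torusPoint fun m => eigenangle X (e m))

theorem torusSum_mFourier (k : Fin n → ℤ) (X : Matrix.unitaryGroup (Fin N) ℂ) :
    torusSum (UnitAddTorus.mFourier k) X = evalUnitary X (distinctMono N k) := by
  rw [torusSum, evalUnitary, evalAngle_distinctMono]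
  simp_rw [mFourier_torusPoint]

theorem norm_torusSum_sub_le (φ ψ : C(UnitAddTorus (Fin n), ℂ))
    (X : Matrix.unitaryGroup (Fin N) ℂ) :
    ‖torusSum φ X - torusSum ψ X‖ ≤ Fintype.card (Fin n ↪ Fin N) * ‖φ - ψ‖ := by
  rw [torusSum, torusSum, ← Finset.sum_sub_distrib, ← nsmul_eq_mul]
  exact norm_sum_le_of_le _ (fun e _ => (φ - ψ).norm_coe_le_norm _) |>.trans (by simp)

/-- On characters the sum is a polynomial in traces. The bound `norm_torusSum_sub_le` makes the
general case a uniform limit, so no continuous choice of eigenangles is needed. -/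
theorem continuous_torusSum (φ : C(UnitAddTorus (Fin n), ℂ)) :
    Continuous fun X : Matrix.unitaryGroup (Fin N) ℂ => torusSum φ X := by
  have hspan : ∀ ψ ∈ Submodule.span ℂ (Set.range (UnitAddTorus.mFourier (d := Fin n))),
      Continuous fun X : Matrix.unitaryGroup (Fin N) ℂ => torusSum ψ X := by
    intro ψ hψ
    induction hψ using Submodule.span_induction with
    | mem x hx =>
      obtain ⟨k, rfl⟩ := hx
      simp_rw [torusSum_mFourier]
      exact continuous_evalUnitary (distinctMono_mem k)
    | zero => simpa [torusSum] using continuous_const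
    | add x y _ _ hx hy =>
      refine (hx.add hy).congr fun X => ?_
      simp [torusSum, Finset.sum_add_distrib]
    | smul c x _ hx =>
      refine (continuous_const.mul hx : Continuous fun X => c * torusSum x X).congr fun X => ?_
      simp [torusSum, Finset.mul_sum]
  have hφ : φ ∈ (Submodule.span ℂ
      (Set.range (UnitAddTorus.mFourier (d := Fin n)))).topologicalClosure := by
    rw [UnitAddTorus.span_mFourier_closure_eq_top]; trivial
  refine continuous_of_uniform_approx_of_continuous fun u hu => ?_
  obtain ⟨ε, hε, hεu⟩ := Metric.mem_uniformity_dist.1 hu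
  -- The added 1 keeps `C` positive when `n > N` and there are no embeddings.
  set C : ℝ := Fintype.card (Fin n ↪ Fin N) + 1 with hC
  have hC0 : 0 < C := by positivity
  obtain ⟨ψ, hψ, hd⟩ := Metric.mem_closure_iff.1 hφ (ε / C) (by positivity)
  refine ⟨_, hspan ψ hψ, fun X => hεu ?_⟩
  rw [dist_eq_norm] at hd ⊢
  refine (norm_torusSum_sub_le φ ψ X).trans_lt ?_
  rw [lt_div_iff₀ hC0] at hd
  nlinarith [norm_nonneg (φ - ψ)]

variable [MeasurableSpace (Matrix.unitaryGroup (Fin N) ℂ)]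
  [BorelSpace (Matrix.unitaryGroup (Fin N) ℂ)] (μ : Measure (Matrix.unitaryGroup (Fin N) ℂ))
  [μ.IsMulLeftInvariant] [IsProbabilityMeasure μ]

/-- Both sides are bounded linear functionals of `φ` for the supremum norm, and they agree on the
characters, whose span is dense. -/
theorem integral_torusSum (φ : C(UnitAddTorus (Fin n), ℂ)) :
    ∫ X, torusSum φ X ∂μ = 1 / (2 * (Real.pi : ℂ)) ^ n *
      ∫ θ in Set.Icc (fun _ : Fin n => (0 : ℝ)) (fun _ => 2 * Real.pi),
        (dysonMatrix N fun j => (θ j : ℂ)).det * φ (torusPoint θ) := by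
  have hcont : ∀ φ : C(UnitAddTorus (Fin n), ℂ), Continuous fun θ : Fin n → ℝ =>
      (dysonMatrix N fun j => (θ j : ℂ)).det * φ (torusPoint θ) := fun φ =>
    continuous_det_dysonMatrix_ofReal.mul (φ.continuous.comp continuous_torusPoint)
  let L₁ : C(UnitAddTorus (Fin n), ℂ) →L[ℂ] ℂ := LinearMap.mkContinuous
    { toFun := fun φ => ∫ X, torusSum φ X ∂μ
      map_add' := fun φ ψ => by
        rw [← integral_add (integrable_of_continuous μ (continuous_torusSum φ))
          (integrable_of_continuous μ (continuous_torusSum ψ))]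
        simp [torusSum, Finset.sum_add_distrib]
      map_smul' := fun c φ => by
        rw [RingHom.id_apply, smul_eq_mul, ← integral_const_mul]
        simp [torusSum, Finset.mul_sum] }
    (Fintype.card (Fin n ↪ Fin N)) fun φ => by
      refine (norm_integral_le_of_norm_le_const (Filter.Eventually.of_forall fun X =>
        (?_ : ‖torusSum φ X‖ ≤ Fintype.card (Fin n ↪ Fin N) * ‖φ‖))).trans (by simp)
      simpa [torusSum] using norm_torusSum_sub_le φ 0 X
  let L₂ : C(UnitAddTorus (Fin n), ℂ) →L[ℂ] ℂ := LinearMap.mkContinuous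
    { toFun := fun φ => ∫ θ in Set.Icc (fun _ : Fin n => (0 : ℝ)) (fun _ => 2 * Real.pi),
        (dysonMatrix N fun j => (θ j : ℂ)).det * φ (torusPoint θ)
      map_add' := fun φ ψ => by
        rw [← integral_add (integrableOn_cube (hcont φ)) (integrableOn_cube (hcont ψ))]
        simp [mul_add]
      map_smul' := fun c φ => by
        rw [RingHom.id_apply, smul_eq_mul, ← integral_const_mul]
        simp [mul_left_comm] }
    (∫ θ in Set.Icc (fun _ : Fin n => (0 : ℝ)) (fun _ => 2 * Real.pi),
        ‖(dysonMatrix N fun j => (θ j : ℂ)).det‖) fun φ => by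
      rw [← integral_mul_const]
      refine norm_integral_le_of_norm_le
        ((integrableOn_cube continuous_det_dysonMatrix_ofReal).norm.mul_const _)
        (Filter.Eventually.of_forall fun θ => ?_)
      rw [norm_mul]
      exact mul_le_mul_of_nonneg_left (φ.norm_coe_le_norm _) (norm_nonneg _)
  have hπ : (2 * (Real.pi : ℂ)) ^ n ≠ 0 := by
    simp [Real.pi_ne_zero]
  have h : L₁ = (1 / (2 * (Real.pi : ℂ)) ^ n) • L₂ := by
    refine ContinuousLinearMap.ext_on (s := Set.range (UnitAddTorus.mFourier (d := Fin n))) ?_ ?_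
    · refine Submodule.dense_iff_topologicalClosure_eq_top.2 ?_
      exact UnitAddTorus.span_mFourier_closure_eq_top
    · rintro _ ⟨k, rfl⟩
      change ∫ X, torusSum (UnitAddTorus.mFourier k) X ∂μ = 1 / (2 * (Real.pi : ℂ)) ^ n *
        ∫ θ in Set.Icc (fun _ : Fin n => (0 : ℝ)) (fun _ => 2 * Real.pi),
          (dysonMatrix N fun j => (θ j : ℂ)).det * UnitAddTorus.mFourier k (torusPoint θ)
      simp_rw [torusSum_mFourier, mFourier_torusPoint]
      rw [integral_evalUnitary μ (distinctMono_mem k), integral_det_dysonMatrix_mul_exp,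
        ← mul_assoc, one_div_mul_cancel hπ, one_mul]
  exact DFunLike.congr_fun h φ

end Torus

end

end UnitaryCorrelation

/-! ### The correlation theorem. -/

theorem mainTheorem1 (N n : ℕ)
    [MeasurableSpace (Matrix.unitaryGroup (Fin N) ℂ)]
    [BorelSpace (Matrix.unitaryGroup (Fin N) ℂ)]
    (μ : Measure (Matrix.unitaryGroup (Fin N) ℂ))
    [μ.IsHaarMeasure] [IsProbabilityMeasure μ] :
    -- the sum has no poles: it extends holomorphically across the hyperplanes `θ_j = θ_k`
    (∃ G : (Fin n → ℂ) → ℂ, Differentiable ℂ G ∧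
      ∀ θ : Fin n → ℂ,
        (∀ j k, j ≠ k → ∀ m : ℤ, θ j - θ k ≠ 2 * (Real.pi : ℂ) * (m : ℂ)) →
        G θ = UnitaryCorrelation.correlationSum N n θ) ∧
    -- the correlation formula
    ∀ (δ : ℝ) (_ : 0 < δ) (f : (Fin n → ℂ) → ℂ)
      (_ : DifferentiableOn ℂ f (UnitaryCorrelation.strip n δ))
      (_ : ∀ w ∈ UnitaryCorrelation.strip n δ, ∀ j : Fin n,
        f (Function.update w j (w j + 2 * (Real.pi : ℂ))) = f w),
      Integrable (fun X => UnitaryCorrelation.distinctSum f X) μ ∧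
      IntegrableOn
        (fun θ : Fin n → ℝ =>
          UnitaryCorrelation.correlationSum N n (fun j => (θ j : ℂ)) * f (fun j => (θ j : ℂ)))
        (Set.Icc (fun _ => 0) (fun _ => 2 * Real.pi)) volume ∧
      ∫ X, UnitaryCorrelation.distinctSum f X ∂μ =
        1 / (2 * (Real.pi : ℂ)) ^ n *
          ∫ θ in Set.Icc (fun _ : Fin n => (0 : ℝ)) (fun _ => 2 * Real.pi),
            UnitaryCorrelation.correlationSum N n (fun j => (θ j : ℂ)) *
              f (fun j => (θ j : ℂ)) := by
  refine ⟨⟨fun θ => (UnitaryCorrelation.dysonMatrix N θ).det,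
    UnitaryCorrelation.differentiable_det_dysonMatrix,
    fun θ hθ => (UnitaryCorrelation.correlationSum_eq_det_dysonMatrix θ hθ).symm⟩, ?_⟩
  intro δ hδ f hf hper
  have hstrip : ∀ θ : Fin n → ℝ, (fun j => (θ j : ℂ)) ∈ UnitaryCorrelation.strip n δ :=
    fun θ j => by simpa using hδ
  -- Holomorphy of `f` enters only through continuity on the real points.
  have hg : Continuous fun θ : Fin n → ℝ => f fun j => (θ j : ℂ) :=
    hf.continuousOn.comp_continuous (by fun_prop) hstrip
  obtain ⟨φ, hφ⟩ := UnitaryCorrelation.exists_torus_lift hg fun θ j => by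
    rw [← hper _ (hstrip θ) j]
    congr 1
    ext m
    by_cases h : m = j
    · subst h; simp
    · simp [h]
  have hsum : (fun X : Matrix.unitaryGroup (Fin N) ℂ => UnitaryCorrelation.distinctSum f X) =
      fun X => UnitaryCorrelation.torusSum φ X := by
    ext X
    exact Finset.sum_congr rfl fun e _ => (hφ _).symm
  have hae : (fun θ : Fin n → ℝ => UnitaryCorrelation.correlationSum N n (fun j => (θ j : ℂ)) *
      f (fun j => (θ j : ℂ))) =ᵐ[volume.restrict
        (Set.Icc (fun _ => (0 : ℝ)) (fun _ => 2 * Real.pi))]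
      fun θ => (UnitaryCorrelation.dysonMatrix N fun j => (θ j : ℂ)).det *
        φ (UnitaryCorrelation.torusPoint θ) := by
    filter_upwards [ae_restrict_of_ae (UnitaryCorrelation.ae_correlationSum_eq (N := N))] with θ hθ
    rw [hθ, hφ]
  refine ⟨?_, ?_, ?_⟩
  · rw [hsum]
    exact UnitaryCorrelation.integrable_of_continuous μ (UnitaryCorrelation.continuous_torusSum φ)
  · exact (UnitaryCorrelation.integrableOn_cube
      (UnitaryCorrelation.continuous_det_dysonMatrix_ofReal.mul
        (φ.continuous.comp UnitaryCorrelation.continuous_torusPoint))).congr hae.symm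
  · rw [hsum, integral_congr_ae hae]
    exact UnitaryCorrelation.integral_torusSum μ φ
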